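/- **Setting.** Let $T>0$, $\delta>0$. Let $X^0,U^0\in L^2(0,1)$ with $X^0$ nondecreasing and $\partial_wX^0\ge 1$ a.e. For every $N\ge2$ let $x^0_1,\dots,x^0_N$ and $u^0_1,\dots,u^0_N$ be real numbers (depending on $N$) with $x^0_{i+1}-x^0_i\ge \frac1N$ and with $u^0_{i}\le u^0_{i+1}$ whenever $x^0_{i+1}-x^0_i=\frac1N$ $(1\le i<N)$. Set $x^0_0:=x^0_1-\frac1N-\delta$, and suppose that $x^0_N-x^0_0\le C$ and $\sup_i|u^0_i|\le C$ with $C$ independent of $N$. Suppose that the piecewise constant interpolations $X_N^0,U_N^0$ (equal to $x^0_i,u^0_i$ on $(\frac{i-1}N,\frac iN]$) converge to $X^0,U^0$ strongly in $L^2(0,1)$. For every $N\ge2$ let $(x_i,\lambda_i)$ solve the microscopic system on $[0,T]$: the $x_i$ $(1\le i\le N)$ are Lipschitz, $x_i(0)=x_i^0$, $x_{i+1}(t)-x_i(t)\ge\frac1N$ for all $t\in[0,T]$, and, with $u_i:=\dot x_i$, for a.e. $t$, $$u_i+N(\lambda_i-\lambda_{i-1})=u_i^0,\qquad \lambda_0=\lambda_N=0,\qquad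 \lambda_i\ge0,\qquad \big(x_{i+1}-x_i-\tfrac1N\big)\lambda_i=0\quad(1\le i<N).$$ Put $x_0:=x_1-\frac1N-\delta$, $u_0:=\dot x_0$ and $p_i:=\frac{d}{dt}\lambda_i$ in $\mathcal D'(0,T)$. Let $X_N,U_N$ be the piecewise constant interpolations of $(x_i),(u_i)$, equal to $x_i,u_i$ for $w\in(\frac{i-1}N,\frac iN]$, and let $\widetilde X_N,\widetilde U_N,\widetilde P_N$ be the continuous piecewise affine interpolations in $w$ of $(x_i),(u_i),(p_i)$ with nodes $w=\frac iN$, $0\le i\le N$. **Proposition 3.7.** There exist $X\in L^\infty((0,T)\times(0,1))$, nondecreasing in $w$ and Lipschitz in $t$ uniformly in $w$, $$U\in L^\infty((0,T)\times(0,1))\cap\bigcap_{0<\alpha<T}L^\infty(\alpha,T;BV(0,1)),\qquad P\in\mathcal M_+((0,T)\times(0,1)),$$ where $P$ is finite and charges no line $\{w=\text{const}\}$, such that, along a common subsequence, $X_N\to X$ and $\widetilde X_N\to X$ in $\mathcal C([0,T];L^1(0,1))$, and $$U_N\rightharpoonup^*U\ \text{ in }L^\infty((0,T)\times(0,1)),\qquad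 \widetilde U_N\rightharpoonup^*U\ \text{ in }L^\infty(\alpha,T;BV(0,1))\ \ \forall\,\alpha\in(0,T),$$ $$\widetilde P_N\rightharpoonup^*P\ \text{ in }\mathcal M_+((0,T)\times(0,1));$$ in particular, for each $N\ge 2$, $U_N$ and $\widetilde U_N$ belong to these spaces and $\widetilde P_N$ is a finite nonnegative measure. Moreover $$\partial_tX=U\ \text{ a.e.},\qquad \partial_tU+\partial_wP=0\ \text{ in }\mathcal D',\qquad \partial_wX\ge1,\quad(\partial_wX-1)P=0,\quad P\ge0\ \text{ in }\mathcal D',$$ and the Oleinik inequality $\partial_wU<\partial_wX/t$ holds in $\mathcal D'((0,T)\times(0,1))$. Here the product is defined as $(\partial_wX-1)P:=\partial_w\big((X-w)P\big)-(X-w)\,\partial_wP$ with $\partial_wP=-\partial_tU$, that is, for all $\Psi\in C_c^\infty((0,T)\times(0,1))$, $$\langle(\partial_wX-1)P,\Psi\rangle=-\int(X-w)\,\partial_w\Psi\,dP-\int_0^T\!\!\int_0^1U\,\partial_t\big((X-w)\Psi\big)\,dw\,dt ,$$ and the strict inequality means that $\partial_wX/t-\partial_wU$ is positive on every nonnegative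 test function that is not identically zero. A sequence converges weakly-* in $L^\infty(\alpha,T;BV(0,1))$ if it converges when tested with the functionals $U\mapsto\int_\alpha^T\big(\int_0^1Uf\,dw+\int_{(0,1)}g\,dD_wU(t)\big)dt$, $f,g\in L^1(\alpha,T;C_0(0,1))$. -/

import Mathlib

open MeasureTheory Set Filter Topology
open scoped ContDiff ZeroAtInfty

noncomputable section

namespace LagrangianCongestion

/-! ### Interpolation of discrete quantities -/

/-- Piecewise constant interpolation on `(0,1)`:
the value is `a i` for `w ∈ ((i-1)/N, i/N]`, and for such `w` one has `⌈N w⌉₊ = i`. -/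
def pcInterp (N : ℕ) (a : ℕ → ℝ) (w : ℝ) : ℝ := a ⌈(N : ℝ) * w⌉₊

/-- Continuous piecewise affine interpolation on `(0,1)`:
the value is `N (a i - a (i-1)) (w - (i-1)/N) + a (i-1)` for `w ∈ ((i-1)/N, i/N]`. -/
def affInterp (N : ℕ) (a : ℕ → ℝ) (w : ℝ) : ℝ :=
  let i := ⌈(N : ℝ) * w⌉₊
  N * (a i - a (i - 1)) * (w - ((i : ℝ) - 1) / N) + a (i - 1)

/-! ### The microscopic system -/

/-- `(x, lam)` is a solution on `[0,T]` of the first order microscopic system with `N` particles of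
diameter `1/N` starting from the positions `x0` with the desired velocities `u0`: the `x i`,
`1 ≤ i ≤ N`, are Lipschitz, the particles do not overlap, and with `u i = d/dt (x i)`
`u i + N (lam i - lam (i-1)) = u0 i`, `lam 0 = lam N = 0`,
`lam i ≥ 0`, `(x (i+1) - x i - 1/N) lam i = 0`. -/
structure IsMicroSolution (N : ℕ) (T : ℝ) (x0 u0 : ℕ → ℝ) (x lam : ℕ → ℝ → ℝ) : Prop where
  lipschitz : ∃ K : NNReal, ∀ i, 1 ≤ i → i ≤ N → LipschitzOnWith K (x i) (Icc 0 T)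
  initial : ∀ i, 1 ≤ i → i ≤ N → x i 0 = x0 i
  nonoverlap : ∀ t ∈ Icc 0 T, ∀ i, 1 ≤ i → i < N → 1 / (N : ℝ) ≤ x (i + 1) t - x i t
  velocity : ∀ᵐ t ∂(volume.restrict (Ioo 0 T)), ∀ i, 1 ≤ i → i ≤ N →
    deriv (x i) t + N * (lam i t - lam (i - 1) t) = u0 i
  boundary : ∀ᵐ t ∂(volume.restrict (Ioo 0 T)), lam 0 t = 0 ∧ lam N t = 0
  complementarity : ∀ᵐ t ∂(volume.restrict (Ioo 0 T)), ∀ i, 1 ≤ i → i < N →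
    0 ≤ lam i t ∧ (x (i + 1) t - x i t - 1 / (N : ℝ)) * lam i t = 0

/-- The positions completed by the artificial particle `x 0 = x 1 - 1/N - δ` on the left. -/
def posExt (N : ℕ) (δ : ℝ) (x : ℕ → ℝ → ℝ) (i : ℕ) (t : ℝ) : ℝ :=
  if i = 0 then x 1 t - 1 / (N : ℝ) - δ else x i t

/-- The velocities `u i = d/dt (x i)`, artificial particle included. -/
def velExt (N : ℕ) (δ : ℝ) (x : ℕ → ℝ → ℝ) (i : ℕ) (t : ℝ) : ℝ :=
  deriv (posExt N δ x i) t

/-- `X_N`, piecewise constant in `w`. -/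
def XN (N : ℕ) (x : ℕ → ℝ → ℝ) (t w : ℝ) : ℝ := pcInterp N (fun i => x i t) w

/-- The piecewise affine interpolation of the positions. -/
def XNaff (N : ℕ) (δ : ℝ) (x : ℕ → ℝ → ℝ) (t w : ℝ) : ℝ :=
  affInterp N (fun i => posExt N δ x i t) w

/-- `U_N`, piecewise constant in `w`. -/
def UN (N : ℕ) (x : ℕ → ℝ → ℝ) (t w : ℝ) : ℝ := pcInterp N (fun i => deriv (x i) t) w

/-- The piecewise affine interpolation of the velocities. -/
def UNaff (N : ℕ) (δ : ℝ) (x : ℕ → ℝ → ℝ) (t w : ℝ) : ℝ :=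
  affInterp N (fun i => velExt N δ x i t) w

/-! ### Test functions and distributions on `(0,T) × (0,1)`; points are `z = (t, w)` -/

/-- The space-time domain `(0,T) × (0,1)`. -/
def dom (T : ℝ) : Set (ℝ × ℝ) := Ioo 0 T ×ˢ Ioo 0 1

/-- Smooth test functions with compact support in `(0,T) × (0,1)`. -/
structure IsTest (T : ℝ) (ψ : ℝ × ℝ → ℝ) : Prop where
  smooth : ContDiff ℝ ∞ ψ
  compact : HasCompactSupport ψ
  support : tsupport ψ ⊆ dom T

/-- `∂_t ψ`. -/
def dt (ψ : ℝ × ℝ → ℝ) (z : ℝ × ℝ) : ℝ := deriv (fun s => ψ (s, z.2)) z.1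

/-- `∂_w ψ`. -/
def dw (ψ : ℝ × ℝ → ℝ) (z : ℝ × ℝ) : ℝ := deriv (fun v => ψ (z.1, v)) z.2

/-- The distribution `p = d/dt lam` on `(0,T)`, applied to the test function `θ`. -/
def timeDerivDist (T : ℝ) (lam : ℝ → ℝ) (θ : ℝ → ℝ) : ℝ :=
  - ∫ t in Ioo 0 T, lam t * deriv θ t

/-- The distribution on `(0,T) × (0,1)` that is the piecewise affine interpolation in `w` of the
pressures `p i = d/dt (lam i)`, applied to the test function `ψ`. -/
def PNaff (N : ℕ) (T : ℝ) (lam : ℕ → ℝ → ℝ) (ψ : ℝ × ℝ → ℝ) : ℝ :=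
  ∫ w in Ioo (0 : ℝ) 1, affInterp N (fun i => timeDerivDist T (lam i) (fun t => ψ (t, w))) w

/-- Finite nonnegative measures on the open set `(0,T) × (0,1)`. -/
def IsPosMeasure (T : ℝ) (P : Measure (ℝ × ℝ)) : Prop :=
  IsFiniteMeasure P ∧ P (dom T)ᶜ = 0

/-- Weak-* convergence of finite measures on `(0,T) × (0,1)`, tested against the continuous
functions that vanish at the boundary. -/
def WeakStarMeasure (T : ℝ) (Pk : ℕ → Measure (ℝ × ℝ)) (P : Measure (ℝ × ℝ)) : Prop :=
  ∀ ψ : ℝ × ℝ → ℝ, Continuous ψ → (∀ z, z ∉ dom T → ψ z = 0) →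
    Tendsto (fun k => ∫ z, ψ z ∂(Pk k)) atTop (𝓝 (∫ z, ψ z ∂P))

/-- `U ∈ L^∞((0,T) × (0,1))`. -/
def MemLinfty (T : ℝ) (U : ℝ → ℝ → ℝ) : Prop :=
  MemLp (fun z : ℝ × ℝ => U z.1 z.2) ⊤ (volume.restrict (dom T))

/-- Weak-* convergence in `L^∞((0,T) × (0,1))`, tested against `L^1`. -/
def WeakStarLinfty (T : ℝ) (Uk : ℕ → ℝ → ℝ → ℝ) (U : ℝ → ℝ → ℝ) : Prop :=
  ∀ f : ℝ × ℝ → ℝ, IntegrableOn f (dom T) →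
    Tendsto (fun k => ∫ z in dom T, Uk k z.1 z.2 * f z) atTop
      (𝓝 (∫ z in dom T, U z.1 z.2 * f z))

/-! ### `BV(0,1)` and `L^∞(a,b;BV(0,1))` -/

/-- The Lebesgue measure of the space `(0,1)`. -/
def lebI : Measure (Ioo (0 : ℝ) 1) := Measure.comap Subtype.val volume

/-- The integral of `g` against a finite signed measure on `(0,1)`. -/
def pairing (m : SignedMeasure (Ioo (0 : ℝ) 1)) (g : Ioo (0 : ℝ) 1 → ℝ) : ℝ :=
  (∫ w, g w ∂m.toJordanDecomposition.posPart) - ∫ w, g w ∂m.toJordanDecomposition.negPart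

/-- `u ∈ L^1(0,1)` and its distributional derivative is the finite signed measure `m`. -/
def HasDerivMeasure (u : ℝ → ℝ) (m : SignedMeasure (Ioo (0 : ℝ) 1)) : Prop :=
  IntegrableOn u (Ioo 0 1) ∧
    ∀ φ : ℝ → ℝ, ContDiff ℝ 1 φ → HasCompactSupport φ → tsupport φ ⊆ Ioo 0 1 →
      ∫ w in Ioo (0 : ℝ) 1, u w * deriv φ w = - pairing m (fun w => φ w)

/-- `u ∈ BV(0,1)`. -/
def IsBV (u : ℝ → ℝ) : Prop := ∃ m, HasDerivMeasure u m

open Classical in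
/-- The distributional derivative `Du` of `u ∈ BV(0,1)`, which is unique (`0` if `u ∉ BV(0,1)`). -/
def derivMeasure (u : ℝ → ℝ) : SignedMeasure (Ioo (0 : ℝ) 1) :=
  if h : IsBV u then h.choose else 0

/-- The norm `‖u‖_{L^1} + |Du|(0,1)` of `u ∈ BV(0,1)`. -/
def bvNorm (u : ℝ → ℝ) : ℝ :=
  (∫ w in Ioo (0 : ℝ) 1, |u w|) + ((derivMeasure u).totalVariation univ).toReal

/-- `U ∈ L^∞(a,b;BV(0,1))`. -/
def MemLinftyBV (a b : ℝ) (U : ℝ → ℝ → ℝ) : Prop :=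
  AEStronglyMeasurable (fun z : ℝ × ℝ => U z.1 z.2) (volume.restrict (Ioo a b ×ˢ Ioo 0 1)) ∧
    ∃ C : ℝ, ∀ᵐ t ∂(volume.restrict (Ioo a b)), IsBV (U t) ∧ bvNorm (U t) ≤ C

/-- Weak-* convergence in `L^∞(a,b;BV(0,1))`. A predual of `BV(0,1)` consists of the functionals
`u ↦ ∫ u f dw + ∫ g dDu` with `f, g ∈ C₀(0,1)`; correspondingly, one tests against
`f, g ∈ L^1(a,b;C₀(0,1))`. -/
def WeakStarLinftyBV (a b : ℝ) (Uk : ℕ → ℝ → ℝ → ℝ) (U : ℝ → ℝ → ℝ) : Prop :=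
  ∀ f g : ℝ → C₀(Ioo (0 : ℝ) 1, ℝ),
    IntegrableOn f (Ioo a b) → IntegrableOn g (Ioo a b) →
    Tendsto
      (fun k => ∫ t in Ioo a b,
        ((∫ w, Uk k t w * f t w ∂lebI) + pairing (derivMeasure (Uk k t)) (g t)))
      atTop
      (𝓝 (∫ t in Ioo a b,
        ((∫ w, U t w * f t w ∂lebI) + pairing (derivMeasure (U t)) (g t))))

/-! ### The limit system -/

/-- `∂_t U + ∂_w P = 0` in `D'((0,T) × (0,1))`. -/
def MomentumEq (T : ℝ) (U : ℝ → ℝ → ℝ) (P : Measure (ℝ × ℝ)) : Prop :=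
  ∀ ψ, IsTest T ψ → (∫ z in dom T, U z.1 z.2 * dt ψ z) + ∫ z, dw ψ z ∂P = 0

/-- `∂_w X ≥ 1` in `D'((0,T) × (0,1))`. -/
def CongestionConstraint (T : ℝ) (X : ℝ → ℝ → ℝ) : Prop :=
  ∀ ψ, IsTest T ψ → (∀ z, 0 ≤ ψ z) →
    ∫ z in dom T, ψ z ≤ - ∫ z in dom T, X z.1 z.2 * dw ψ z

/-- `(∂_w X - 1) P = 0` in `D'((0,T) × (0,1))`. The product is
`∂_w((X - w) P) - (X - w) ∂_w P`, where `∂_w P = - ∂_t U`; hence its value at `ψ` is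
`- ∫ (X - w) ∂_w ψ dP - ∫ U ∂_t((X - w) ψ) dt dw`. -/
def ExclusionRelation (T : ℝ) (X U : ℝ → ℝ → ℝ) (P : Measure (ℝ × ℝ)) : Prop :=
  ∀ ψ, IsTest T ψ →
    - (∫ z, (X z.1 z.2 - z.2) * dw ψ z ∂P)
      - (∫ z in dom T, U z.1 z.2 * dt (fun y => (X y.1 y.2 - y.2) * ψ y) z) = 0

/-- `∂_w U < ∂_w X / t` in `D'((0,T) × (0,1))`: the distribution `∂_w X / t - ∂_w U` is positive on
every nonnegative test function that is not identically zero. -/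
def OleinikStrict (T : ℝ) (X U : ℝ → ℝ → ℝ) : Prop :=
  ∀ ψ, IsTest T ψ → (∀ z, 0 ≤ ψ z) → (∃ z, ψ z ≠ 0) →
    0 < (- ∫ z in dom T, X z.1 z.2 / z.1 * dw ψ z) - (- ∫ z in dom T, U z.1 z.2 * dw ψ z)

end LagrangianCongestion

end

/-!
The convergence proof rests on monotonicity: it makes the sequences converge almost everywhere, not
only weakly, and so the products of positions, velocities and multipliers pass to the limit.

*Microscopic level.* The gaps that the particles would have under free motion are affine in time.
Projecting the free motion onto the configurations without overlap amounts to a discrete obstacle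
problem, whose solution is the smallest nonnegative sequence with second difference at most the free
gap. By minimality this solution, `multInt`, is a convex function of the time
(`convexOn_obstacle`). Being convex, nonnegative and zero at time `0`, it stays positive once it is
positive, so that the projected motion has sticky collisions and solves the microscopic system.
Solutions are unique (`IsMicroSolution.eq_projPos`), so that `N λ_i` is the time derivative of a
convex function. Hence the `λ_i` are nondecreasing in time, touching particles with positive
multiplier have equal velocities, and comparing a convex function with its tangent gives the
discrete Oleinik inequality `t (u_{i+1} - u_i) ≤ x_{i+1} - x_i - 1/N`
(`IsMicroSolution.exists_monotone_multipliers`, `RegularTime`).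

*Interpolation.* With `l` the interpolated multiplier, the velocity equation reads `U + ∂_w l = U⁰`,
and `∫ V ∂_w (l χ) dw = 0` for `V = X - w` and for `V = U`, since neither varies where `l` is
positive. These relations, bounds and monotonicity properties make up `DiscreteFlow`.

*Compactness.* Positions are monotone in `w` and Lipschitz in `t`, multipliers are monotone in `t`
and Lipschitz in `w`; a diagonal argument gives a subsequence along which both converge almost
everywhere (`exists_subseq_tendsto_pos_mult`). At a fixed time, `(X - w)/t - U` is nondecreasing
in `w` and its primitives converge, by convergence of positions and multipliers; therefore it
converges almost everywhere, and so do the velocities (`ae_exists_tendsto_vel`). The relations above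
are thus inherited by the limit (`limitFlow_of_tendsto`, `LimitFlow`).

*The limit system.* The pressure `P` is the time derivative of the limit multiplier. For a function
that is nondecreasing in time, this derivative is the push-forward of the Lebesgue measure in `w`
and in the level under the generalized inverse `levelTime`, which yields its integration by parts
(`timeDerivMeasure`, `integral_timeDerivMeasure`) and shows that lines `{w = const}` carry no mass.
Differentiating the velocity equation in time gives the momentum equation. The exclusion relation
combines the two orthogonality relations with an integration by parts in time
(`LimitFlow.exclusionRelation`). The Oleinik inequality is strict because
the difference of its two sides is at least `1/t` (`LimitFlow.oleinikStrict`). The same monotone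
function bounds the total variation of the velocities at positive times, which together with the
density of test functions gives the weak-* convergence in `BV` (`tendsto_pairing`).
-/

noncomputable section

namespace LagrangianCongestion

/-! ### A discrete obstacle problem -/

/-- The nonnegative sequences on `{0, …, N}` whose second difference is at most `D`. -/
def supersolutions (N : ℕ) (D : ℕ → ℝ) : Set (ℕ → ℝ) :=
  {M | (∀ i, i ≤ N → 0 ≤ M i) ∧
    ∀ i, 1 ≤ i → i < N → M (i + 1) - 2 * M i + M (i - 1) ≤ D i}

/-- The solution of the discrete obstacle problem: the smallest nonnegative sequence whose second
difference is at most `D`. -/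
def obstacle (N : ℕ) (D : ℕ → ℝ) (i : ℕ) : ℝ := sInf ((fun M : ℕ → ℝ => M i) '' supersolutions N D)

lemma supersolutions_nonempty (N : ℕ) (D : ℕ → ℝ) : (supersolutions N D).Nonempty := by
  set K : ℝ := ∑ j ∈ Finset.range N, |D j| with hK
  have hK0 : 0 ≤ K := Finset.sum_nonneg fun _ _ => abs_nonneg _
  refine ⟨fun i => K * ((N : ℝ) ^ 2 - (i : ℝ) ^ 2), fun i hi => ?_, fun i h1 hi => ?_⟩
  · have : (i : ℝ) ≤ N := by exact_mod_cast hi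
    have h0 : (0 : ℝ) ≤ i := by positivity
    exact mul_nonneg hK0 (by nlinarith)
  · have hD : |D i| ≤ K := Finset.single_le_sum (f := fun j => |D j|)
      (fun _ _ => abs_nonneg _) (Finset.mem_range.2 hi)
    have hc : ((i - 1 : ℕ) : ℝ) = i - 1 := by push_cast [h1]; ring
    have := neg_abs_le (D i)
    simp only [hc]
    push_cast
    nlinarith

lemma obstacle_le {N : ℕ} {D M : ℕ → ℝ} (hM : M ∈ supersolutions N D) {i : ℕ} (hi : i ≤ N) :
    obstacle N D i ≤ M i :=
  csInf_le ⟨0, by rintro _ ⟨M', hM', rfl⟩; exact hM'.1 i hi⟩ ⟨M, hM, rfl⟩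

lemma le_obstacle {N : ℕ} {D : ℕ → ℝ} {i : ℕ} {c : ℝ} (h : ∀ M ∈ supersolutions N D, c ≤ M i) :
    c ≤ obstacle N D i :=
  le_csInf ((supersolutions_nonempty N D).image _) (by rintro _ ⟨M, hM, rfl⟩; exact h M hM)

lemma obstacle_nonneg {N : ℕ} {D : ℕ → ℝ} {i : ℕ} (hi : i ≤ N) : 0 ≤ obstacle N D i :=
  le_obstacle fun _ hM => hM.1 i hi

lemma obstacle_mem (N : ℕ) (D : ℕ → ℝ) : obstacle N D ∈ supersolutions N D := by
  refine ⟨fun i hi => obstacle_nonneg hi, fun i h1 hi => ?_⟩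
  have : (obstacle N D (i + 1) + obstacle N D (i - 1) - D i) / 2 ≤ obstacle N D i := by
    refine le_obstacle fun M hM => ?_
    have h2 := hM.2 i h1 hi
    have h3 := obstacle_le hM (i := i + 1) (by omega)
    have h4 := obstacle_le hM (i := i - 1) (by omega)
    linarith
  linarith

/-- Minimality of the solution, tested with a modification at a single index. -/
lemma obstacle_le_of_update {N : ℕ} {D : ℕ → ℝ} {i : ℕ} {v : ℝ} (hi : i ≤ N) (hv : 0 ≤ v)
    (h : 1 ≤ i → i < N → obstacle N D (i + 1) - 2 * v + obstacle N D (i - 1) ≤ D i) :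
    obstacle N D i ≤ v := by
  by_contra! hlt
  have hmem := obstacle_mem N D
  have : Function.update (obstacle N D) i v ∈ supersolutions N D := by
    refine ⟨fun j hj => ?_, fun j h1 hj => ?_⟩
    · rcases eq_or_ne j i with rfl | hne
      · simpa using hv
      · simpa [hne] using hmem.1 j hj
    · have h2 := hmem.2 j h1 hj
      rcases eq_or_ne j i with rfl | hne
      · have a1 : j + 1 ≠ j := by omega
        have a2 : j - 1 ≠ j := by omega
        simpa [a1, a2] using h h1 hj
      · have hup : ∀ k, Function.update (obstacle N D) i v k ≤ obstacle N D k := by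
          intro k
          rcases eq_or_ne k i with rfl | hk
          · simpa using hlt.le
          · simp [hk]
        have h3 := hup (j + 1)
        have h4 := hup (j - 1)
        have h5 : Function.update (obstacle N D) i v j = obstacle N D j := by simp [hne]
        rw [h5]
        linarith
  have := obstacle_le this hi
  simp at this
  linarith

lemma obstacle_zero (N : ℕ) (D : ℕ → ℝ) : obstacle N D 0 = 0 :=
  le_antisymm (obstacle_le_of_update (Nat.zero_le _) le_rfl (by omega))
    (obstacle_nonneg (Nat.zero_le _))

lemma obstacle_last (N : ℕ) (D : ℕ → ℝ) : obstacle N D N = 0 :=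
  le_antisymm (obstacle_le_of_update le_rfl le_rfl (by omega)) (obstacle_nonneg le_rfl)

lemma obstacle_complementarity {N : ℕ} {D : ℕ → ℝ} {i : ℕ} (h1 : 1 ≤ i) (hi : i < N)
    (hpos : 0 < obstacle N D i) :
    obstacle N D (i + 1) - 2 * obstacle N D i + obstacle N D (i - 1) = D i := by
  refine le_antisymm ((obstacle_mem N D).2 i h1 hi) ?_
  by_contra! hlt
  set e := D i - (obstacle N D (i + 1) - 2 * obstacle N D i + obstacle N D (i - 1)) with he
  have hmin : 0 < min (obstacle N D i) (e / 2) := lt_min hpos (by linarith)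
  have h2 := min_le_left (obstacle N D i) (e / 2)
  have h3 := min_le_right (obstacle N D i) (e / 2)
  have := obstacle_le_of_update (D := D) (v := obstacle N D i - min (obstacle N D i) (e / 2))
    hi.le (by linarith) (fun _ _ => by linarith)
  linarith

lemma obstacle_eq_zero_of_nonneg {N : ℕ} {D : ℕ → ℝ} (hD : ∀ i, 1 ≤ i → i < N → 0 ≤ D i) {i : ℕ}
    (hi : i ≤ N) : obstacle N D i = 0 :=
  le_antisymm (obstacle_le (M := fun _ => 0) ⟨fun _ _ => le_rfl, by simpa using hD⟩ hi)
    (obstacle_nonneg hi)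

/-- The solution is a convex function of the datum, because supersolutions can be averaged. -/
lemma convexOn_obstacle {N : ℕ} (g v : ℕ → ℝ) {i : ℕ} (hi : i ≤ N) :
    ConvexOn ℝ univ (fun t : ℝ => obstacle N (fun j => g j + t * v j) i) := by
  refine ⟨convex_univ, fun s _ t _ a b ha hb hab => ?_⟩
  have hs := obstacle_mem N (fun j => g j + s * v j)
  have ht := obstacle_mem N (fun j => g j + t * v j)
  refine obstacle_le (M := fun j => a * obstacle N (fun j => g j + s * v j) j +
    b * obstacle N (fun j => g j + t * v j) j) ⟨fun j hj => ?_, fun j h1 hj => ?_⟩ hi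
  · exact add_nonneg (mul_nonneg ha (hs.1 j hj)) (mul_nonneg hb (ht.1 j hj))
  · have h3 := mul_le_mul_of_nonneg_left (hs.2 j h1 hj) ha
    have h4 := mul_le_mul_of_nonneg_left (ht.2 j h1 hj) hb
    have h5 : g j = a * g j + b * g j := by rw [← add_mul, hab, one_mul]
    simp only [smul_eq_mul]
    nlinarith

/-! ### Lipschitz and convex functions of time -/

lemma exists_lipschitzOnWith_of_convexOn {f : ℝ → ℝ} (hf : ConvexOn ℝ univ f) (a b : ℝ) :
    ∃ K : NNReal, LipschitzOnWith K f (Icc a b) := by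
  have h : LocallyLipschitz f := by
    have := hf.locallyLipschitzOn isOpen_univ
    exact locallyLipschitzOn_univ.1 this
  exact h.locallyLipschitzOn.exists_lipschitzOnWith_of_compact isCompact_Icc

lemma absolutelyContinuousOnInterval_of_lipschitzOnWith {f : ℝ → ℝ} {a b : ℝ} (hab : a ≤ b)
    {K : NNReal} (hf : LipschitzOnWith K f (Icc a b)) : AbsolutelyContinuousOnInterval f a b :=
  LipschitzOnWith.absolutelyContinuousOnInterval (K := K) (by rwa [uIcc_of_le hab])

lemma ae_differentiableAt_of_absolutelyContinuous {f : ℝ → ℝ} {a b : ℝ} (hab : a ≤ b)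
    (hf : AbsolutelyContinuousOnInterval f a b) :
    ∀ᵐ t ∂(volume.restrict (Ioo a b)), DifferentiableAt ℝ f t := by
  rw [ae_restrict_iff' measurableSet_Ioo]
  filter_upwards [hf.ae_differentiableAt] with t ht hmem
  exact ht (by rw [uIcc_of_le hab]; exact Ioo_subset_Icc_self hmem)

lemma le_of_deriv_nonpos_ae {f : ℝ → ℝ} {a b t : ℝ} (ht : t ∈ Icc a b)
    (hf : AbsolutelyContinuousOnInterval f a b)
    (h : ∀ᵐ s ∂(volume.restrict (Ioo a b)), deriv f s ≤ 0) : f t ≤ f a := by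
  have hab : a ≤ b := ht.1.trans ht.2
  have hat : AbsolutelyContinuousOnInterval f a t :=
    hf.mono (by rw [uIcc_of_le hab, uIcc_of_le ht.1]; exact Icc_subset_Icc_right ht.2)
  have h1 := hat.integral_deriv_eq_sub
  have h2 : ∫ s in a..t, deriv f s ≤ 0 := by
    rw [intervalIntegral.integral_of_le ht.1, ← integral_Ioc_eq_integral_Ioo.symm]
    refine integral_nonpos_of_ae ?_
    exact ae_restrict_of_ae_restrict_of_subset (Ioo_subset_Ioo_right ht.2) h
  linarith

lemma sum_Icc_mul_sub (N : ℕ) (v k : ℕ → ℝ) (h0 : k 0 = 0) (hN : k N = 0) :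
    ∑ i ∈ Finset.Icc 1 N, v i * (k i - k (i - 1)) =
      -∑ i ∈ Finset.Ico 1 N, (v (i + 1) - v i) * k i := by
  have key : ∀ n : ℕ, ∑ i ∈ Finset.Icc 1 n, v i * (k i - k (i - 1)) =
      v n * k n - ∑ i ∈ Finset.Ico 1 n, (v (i + 1) - v i) * k i := by
    intro n
    induction n with
    | zero => simp [h0]
    | succ n ih =>
      rw [Finset.sum_Icc_succ_top (by omega), ih]
      rcases Nat.eq_zero_or_pos n with rfl | hn
      · simp [h0]
      · rw [Finset.sum_Ico_succ_top (by omega)]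
        simp only [Nat.add_sub_cancel]
        ring
  rw [key N, hN]
  ring

/-! ### The microscopic dynamics as an obstacle problem -/

/-- The time integral of `N lam i`, described as the solution at time `t` of the obstacle problem
whose datum is the gap that particles `i` and `i + 1` would have under free motion. -/
def multInt (N : ℕ) (x0 u0 : ℕ → ℝ) (i : ℕ) (t : ℝ) : ℝ :=
  obstacle N (fun j => (x0 (j + 1) - x0 j - 1 / (N : ℝ)) + t * (u0 (j + 1) - u0 j)) i

/-- The positions obtained by projecting the free motion `x0 i + t * u0 i` onto the configurations
without overlap. -/
def projPos (N : ℕ) (x0 u0 : ℕ → ℝ) (i : ℕ) (t : ℝ) : ℝ :=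
  x0 i + t * u0 i - (multInt N x0 u0 i t - multInt N x0 u0 (i - 1) t)

section Micro

variable {N : ℕ} {T C : ℝ} {x0 u0 : ℕ → ℝ} {x lam : ℕ → ℝ → ℝ}

lemma multInt_nonneg {i : ℕ} (hi : i ≤ N) (t : ℝ) : 0 ≤ multInt N x0 u0 i t := obstacle_nonneg hi

lemma multInt_zero (t : ℝ) : multInt N x0 u0 0 t = 0 := obstacle_zero _ _

lemma multInt_last (t : ℝ) : multInt N x0 u0 N t = 0 := obstacle_last _ _

lemma convexOn_multInt {i : ℕ} (hi : i ≤ N) : ConvexOn ℝ univ (multInt N x0 u0 i) :=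
  convexOn_obstacle _ _ hi

lemma multInt_initial (hx0 : ∀ i, 1 ≤ i → i < N → 1 / (N : ℝ) ≤ x0 (i + 1) - x0 i) {i : ℕ}
    (hi : i ≤ N) : multInt N x0 u0 i 0 = 0 :=
  obstacle_eq_zero_of_nonneg (fun j h1 hj => by have := hx0 j h1 hj; simp at this ⊢; linarith) hi

lemma projPos_gap (i : ℕ) (t : ℝ) :
    projPos N x0 u0 (i + 1) t - projPos N x0 u0 i t - 1 / (N : ℝ) =
      ((x0 (i + 1) - x0 i - 1 / (N : ℝ)) + t * (u0 (i + 1) - u0 i)) -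
      (multInt N x0 u0 (i + 1) t - 2 * multInt N x0 u0 i t + multInt N x0 u0 (i - 1) t) := by
  simp only [projPos, Nat.add_sub_cancel]
  ring

lemma projPos_gap_nonneg {i : ℕ} (h1 : 1 ≤ i) (hi : i < N) (t : ℝ) :
    0 ≤ projPos N x0 u0 (i + 1) t - projPos N x0 u0 i t - 1 / (N : ℝ) := by
  rw [projPos_gap i]
  have := (obstacle_mem N
    (fun j => (x0 (j + 1) - x0 j - 1 / (N : ℝ)) + t * (u0 (j + 1) - u0 j))).2 i h1 hi
  simp only [multInt]
  linarith

lemma projPos_gap_eq_zero {i : ℕ} (h1 : 1 ≤ i) (hi : i < N) {t : ℝ}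
    (hpos : 0 < multInt N x0 u0 i t) :
    projPos N x0 u0 (i + 1) t - projPos N x0 u0 i t - 1 / (N : ℝ) = 0 := by
  rw [projPos_gap i]
  have := obstacle_complementarity h1 hi hpos
  simp only [multInt]
  linarith

lemma deriv_multInt_eq_zero {i : ℕ} (hi : i ≤ N) {t : ℝ} (h : multInt N x0 u0 i t = 0) :
    deriv (multInt N x0 u0 i) t = 0 :=
  IsLocalMin.deriv_eq_zero
    (Eventually.of_forall fun s => by rw [h]; exact multInt_nonneg hi s)

lemma ae_differentiableAt_multInt (hT : 0 < T) :
    ∀ᵐ t ∂(volume.restrict (Ioo 0 T)), ∀ i, i ≤ N → DifferentiableAt ℝ (multInt N x0 u0 i) t := by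
  rw [ae_all_iff]
  intro i
  rw [ae_all_iff]
  intro hi
  obtain ⟨K, hK⟩ := exists_lipschitzOnWith_of_convexOn
    (convexOn_multInt (x0 := x0) (u0 := u0) hi) 0 T
  exact ae_differentiableAt_of_absolutelyContinuous hT.le
    (absolutelyContinuousOnInterval_of_lipschitzOnWith hT.le hK)

lemma IsMicroSolution.ae_differentiableAt (hT : 0 < T) (h : IsMicroSolution N T x0 u0 x lam) :
    ∀ᵐ t ∂(volume.restrict (Ioo 0 T)), ∀ i, 1 ≤ i → i ≤ N → DifferentiableAt ℝ (x i) t := by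
  simp only [ae_all_iff]
  intro i h1 hi
  obtain ⟨K, hK⟩ := h.lipschitz
  exact ae_differentiableAt_of_absolutelyContinuous hT.le
    (absolutelyContinuousOnInterval_of_lipschitzOnWith hT.le (hK i h1 hi))

/-- The microscopic system has at most one solution, hence its solution is the projection of the
free motion: the squared distance between both is nonincreasing. -/
lemma IsMicroSolution.eq_projPos (hT : 0 < T) (h : IsMicroSolution N T x0 u0 x lam)
    (hx0 : ∀ i, 1 ≤ i → i < N → 1 / (N : ℝ) ≤ x0 (i + 1) - x0 i)
    {t : ℝ} (ht : t ∈ Icc 0 T) {i : ℕ} (h1 : 1 ≤ i) (hi : i ≤ N) :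
    x i t = projPos N x0 u0 i t := by
  set m := multInt N x0 u0 with hm
  set w : ℕ → ℝ → ℝ := fun j s => x j s - projPos N x0 u0 j s with hw
  obtain ⟨K, hK⟩ := h.lipschitz
  have hmac : ∀ j, j ≤ N → AbsolutelyContinuousOnInterval (m j) 0 T := fun j hj => by
    obtain ⟨K', hK'⟩ := exists_lipschitzOnWith_of_convexOn
      (convexOn_multInt (x0 := x0) (u0 := u0) hj) 0 T
    exact absolutelyContinuousOnInterval_of_lipschitzOnWith hT.le hK'
  have hid : ∀ a b : ℝ, AbsolutelyContinuousOnInterval (fun s : ℝ => a + s * b) 0 T := fun a b =>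
    absolutelyContinuousOnInterval_of_lipschitzOnWith (K := ⟨|b|, abs_nonneg b⟩) hT.le <| by
      refine LipschitzOnWith.of_dist_le_mul fun p _ q _ => le_of_eq ?_
      have : a + p * b - (a + q * b) = b * (p - q) := by ring
      rw [Real.dist_eq, this, abs_mul, Real.dist_eq]
      rfl
  have hwac : ∀ j, 1 ≤ j → j ≤ N → AbsolutelyContinuousOnInterval (w j) 0 T := fun j hj1 hjN =>
    (absolutelyContinuousOnInterval_of_lipschitzOnWith hT.le (hK j hj1 hjN)).sub
      ((hid (x0 j) (u0 j)).sub ((hmac j hjN).sub (hmac (j - 1) (by omega))))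
  set E : ℝ → ℝ := fun s => ∑ j ∈ Finset.Icc 1 N, w j s * w j s with hE
  have hEac : AbsolutelyContinuousOnInterval E 0 T := by
    have : ∀ s : Finset ℕ, (∀ j ∈ s, 1 ≤ j ∧ j ≤ N) →
        AbsolutelyContinuousOnInterval (fun r => ∑ j ∈ s, w j r * w j r) 0 T := by
      intro s
      induction s using Finset.induction_on with
      | empty => intro _; simpa using hid 0 0
      | insert j s hj ih =>
        intro hs
        have hsplit : (fun r => ∑ l ∈ insert j s, w l r * w l r) =
            (fun r => w j r * w j r) + fun r => ∑ l ∈ s, w l r * w l r :=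
          funext fun r => Finset.sum_insert hj
        rw [hsplit]
        have hj' := hs j (Finset.mem_insert_self _ _)
        exact ((hwac j hj'.1 hj'.2).mul (hwac j hj'.1 hj'.2)).add
          (ih fun k hk => hs k (Finset.mem_insert_of_mem hk))
    exact this _ fun j hj => Finset.mem_Icc.1 hj
  have hE0 : E 0 = 0 := by
    refine Finset.sum_eq_zero fun j hj => ?_
    have hj' := Finset.mem_Icc.1 hj
    have : w j 0 = 0 := by
      simp only [hw, projPos, multInt_initial hx0 hj'.2, h.initial j hj'.1 hj'.2,
        multInt_initial hx0 (show j - 1 ≤ N by omega)]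
      ring
    simp [this]
  have hEd : ∀ᵐ s ∂(volume.restrict (Ioo 0 T)), deriv E s ≤ 0 := by
    filter_upwards [h.ae_differentiableAt hT, ae_differentiableAt_multInt (x0 := x0) (u0 := u0) hT,
      h.velocity, h.boundary, h.complementarity, ae_restrict_mem measurableSet_Ioo]
      with s hxd hmd hvel hbd hcomp hs
    set k : ℕ → ℝ := fun j => deriv (m j) s - N * lam j s with hk
    have hwd : ∀ j, 1 ≤ j → j ≤ N → HasDerivAt (w j) (k j - k (j - 1)) s := by
      intro j hj1 hjN
      have e1 := (hxd j hj1 hjN).hasDerivAt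
      have e2 := ((hasDerivAt_id s).mul_const (u0 j)).const_add (x0 j)
      have e3 := (hmd j hjN).hasDerivAt.sub (hmd (j - 1) (by omega)).hasDerivAt
      have e4 : HasDerivAt (w j)
          (deriv (x j) s - (1 * u0 j - (deriv (m j) s - deriv (m (j - 1)) s))) s :=
        e1.sub (e2.sub e3)
      refine e4.congr_deriv ?_
      have := hvel j hj1 hjN
      simp only [hk]
      linarith
    have hEder : HasDerivAt E (∑ j ∈ Finset.Icc 1 N,
        ((k j - k (j - 1)) * w j s + w j s * (k j - k (j - 1)))) s := by
      refine HasDerivAt.fun_sum fun j hj => ?_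
      have hj' := Finset.mem_Icc.1 hj
      exact (hwd j hj'.1 hj'.2).mul (hwd j hj'.1 hj'.2)
    rw [hEder.deriv]
    have hsum : ∑ j ∈ Finset.Icc 1 N, ((k j - k (j - 1)) * w j s + w j s * (k j - k (j - 1))) =
        2 * ∑ j ∈ Finset.Icc 1 N, w j s * (k j - k (j - 1)) := by
      rw [Finset.mul_sum]
      exact Finset.sum_congr rfl fun j _ => by ring
    have hk0 : k 0 = 0 := by
      simp [hk, hm, hbd.1, deriv_multInt_eq_zero (Nat.zero_le N) (multInt_zero (x0 := x0) s)]
    have hkN : k N = 0 := by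
      simp [hk, hm, hbd.2, deriv_multInt_eq_zero (le_refl N) (multInt_last (x0 := x0) s)]
    rw [hsum, sum_Icc_mul_sub N (fun j => w j s) k hk0 hkN]
    have : 0 ≤ ∑ j ∈ Finset.Ico 1 N, (w (j + 1) s - w j s) * k j := by
      refine Finset.sum_nonneg fun j hj => ?_
      have hj' := Finset.mem_Ico.1 hj
      obtain ⟨hl0, hlg⟩ := hcomp j hj'.1 hj'.2
      have hgx : 0 ≤ x (j + 1) s - x j s - 1 / (N : ℝ) := by
        have := h.nonoverlap s (Ioo_subset_Icc_self hs) j hj'.1 hj'.2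
        linarith
      have hgy := projPos_gap_nonneg (x0 := x0) (u0 := u0) hj'.1 hj'.2 s
      have hdm : 0 ≤ deriv (m j) s := by
        have hc := (convexOn_multInt (x0 := x0) (u0 := u0) hj'.2.le).slope_le_deriv
          (mem_univ 0) (mem_univ s) hs.1 (hmd j hj'.2.le)
        refine le_trans ?_ hc
        rw [slope_def_field, multInt_initial hx0 hj'.2.le]
        exact div_nonneg (by simpa using multInt_nonneg hj'.2.le s) (by linarith [hs.1])
      have hmg : deriv (m j) s *
          (projPos N x0 u0 (j + 1) s - projPos N x0 u0 j s - 1 / (N : ℝ)) = 0 := by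
        rcases (multInt_nonneg (x0 := x0) (u0 := u0) hj'.2.le s).eq_or_lt with h0 | hpos
        · rw [hm, deriv_multInt_eq_zero hj'.2.le h0.symm, zero_mul]
        · rw [projPos_gap_eq_zero hj'.1 hj'.2 hpos, mul_zero]
      have e1 := mul_nonneg hgx hdm
      have e2 := mul_nonneg (mul_nonneg hgy hl0) (Nat.cast_nonneg (α := ℝ) N)
      simp only [hw, hk]
      nlinarith
    linarith
  have hle := le_of_deriv_nonpos_ae ht hEac hEd
  have hterm : w i t * w i t ≤ E t := Finset.single_le_sum (f := fun j => w j t * w j t)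
    (fun j _ => mul_self_nonneg _) (Finset.mem_Icc.2 ⟨h1, hi⟩)
  have : w i t = 0 := by nlinarith [mul_self_nonneg (w i t)]
  simp only [hw] at this
  linarith

end Micro

/-! ### Regular times of the microscopic dynamics -/

/-- The properties of the microscopic dynamics, with multipliers `l`, that hold at almost every
time: the velocity equation, bounds, stickiness of congested blocks, and the discrete Oleinik
inequality. -/
structure RegularTime (N : ℕ) (C : ℝ) (u0 : ℕ → ℝ) (x l : ℕ → ℝ → ℝ) (t : ℝ) : Prop where
  velocity : ∀ i, 1 ≤ i → i ≤ N → deriv (x i) t + N * (l i t - l (i - 1) t) = u0 i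
  bound : ∀ i, 1 ≤ i → i ≤ N → |deriv (x i) t| ≤ C
  mult_gap : ∀ i, 1 ≤ i → i < N → l i t * (x (i + 1) t - x i t - 1 / (N : ℝ)) = 0
  mult_vel : ∀ i, 1 ≤ i → i < N → l i t * (deriv (x (i + 1)) t - deriv (x i) t) = 0
  oleinik : ∀ i, 1 ≤ i → i < N →
    1 / (N : ℝ) ≤ x (i + 1) t - x i t - t * (deriv (x (i + 1)) t - deriv (x i) t)

section Micro

variable {N : ℕ} {T C : ℝ} {x0 u0 : ℕ → ℝ} {x lam : ℕ → ℝ → ℝ}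

lemma deriv_multInt_nonneg (hx0 : ∀ i, 1 ≤ i → i < N → 1 / (N : ℝ) ≤ x0 (i + 1) - x0 i) {i : ℕ}
    (hi : i ≤ N) {t : ℝ} (ht : 0 < t) (hd : DifferentiableAt ℝ (multInt N x0 u0 i) t) :
    0 ≤ deriv (multInt N x0 u0 i) t := by
  refine le_trans ?_ ((convexOn_multInt hi).slope_le_deriv (mem_univ 0) (mem_univ t) ht hd)
  rw [slope_def_field, multInt_initial hx0 hi]
  exact div_nonneg (by simpa using multInt_nonneg hi t) (by linarith)

/-- Convexity of the time integral of the multiplier and its vanishing at time `0`. -/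
lemma multInt_le_mul_deriv (hx0 : ∀ i, 1 ≤ i → i < N → 1 / (N : ℝ) ≤ x0 (i + 1) - x0 i) {i : ℕ}
    (hi : i ≤ N) {t : ℝ} (ht : 0 < t) (hd : DifferentiableAt ℝ (multInt N x0 u0 i) t) :
    multInt N x0 u0 i t ≤ t * deriv (multInt N x0 u0 i) t := by
  have := (convexOn_multInt hi).slope_le_deriv (mem_univ 0) (mem_univ t) ht hd
  rw [slope_def_field, multInt_initial hx0 hi, sub_zero, sub_zero, div_le_iff₀ ht] at this
  linarith

/-- Particles `i` and `i + 1` move together while the time integral of their multiplier is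
positive. -/
lemma IsMicroSolution.deriv_eq_of_multInt_pos (hT : 0 < T)
    (h : IsMicroSolution N T x0 u0 x lam)
    (hx0 : ∀ i, 1 ≤ i → i < N → 1 / (N : ℝ) ≤ x0 (i + 1) - x0 i) {i : ℕ} (h1 : 1 ≤ i) (hi : i < N)
    {t : ℝ} (ht : t ∈ Ioo 0 T) (hpos : 0 < multInt N x0 u0 i t) :
    deriv (x (i + 1)) t = deriv (x i) t := by
  have hcont : Continuous (multInt N x0 u0 i) :=
    continuousOn_univ.1 ((convexOn_multInt hi.le).continuousOn isOpen_univ)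
  have hev : x (i + 1) =ᶠ[𝓝 t] fun s => x i s + 1 / (N : ℝ) := by
    filter_upwards [hcont.continuousAt.eventually (lt_mem_nhds hpos), isOpen_Ioo.mem_nhds ht]
      with s hs hsT
    have hs' := Ioo_subset_Icc_self hsT
    have := projPos_gap_eq_zero h1 hi hs
    rw [← h.eq_projPos hT hx0 hs' h1 hi.le, ← h.eq_projPos hT hx0 hs' (by omega) hi] at this
    linarith
  rw [hev.deriv_eq]
  simp

lemma IsMicroSolution.ae_deriv_multInt (hT : 0 < T) (h : IsMicroSolution N T x0 u0 x lam)
    (hx0 : ∀ i, 1 ≤ i → i < N → 1 / (N : ℝ) ≤ x0 (i + 1) - x0 i) :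
    ∀ᵐ t ∂(volume.restrict (Ioo 0 T)), ∀ i, i ≤ N → deriv (multInt N x0 u0 i) t = N * lam i t := by
  filter_upwards [ae_differentiableAt_multInt (x0 := x0) (u0 := u0) hT, h.velocity, h.boundary,
    ae_restrict_mem measurableSet_Ioo] with t hmd hvel hbd ht i
  induction i with
  | zero =>
    intro hi
    rw [deriv_multInt_eq_zero hi (multInt_zero t), hbd.1, mul_zero]
  | succ i ih =>
    intro hi
    have hev : x (i + 1) =ᶠ[𝓝 t] projPos N x0 u0 (i + 1) := by
      filter_upwards [isOpen_Ioo.mem_nhds ht] with s hs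
      exact h.eq_projPos hT hx0 (Ioo_subset_Icc_self hs) (by omega) hi
    have e2 := ((hasDerivAt_id t).mul_const (u0 (i + 1))).const_add (x0 (i + 1))
    have e3 := (hmd (i + 1) hi).hasDerivAt.sub (hmd i (by omega)).hasDerivAt
    have e4 : HasDerivAt (projPos N x0 u0 (i + 1)) (1 * u0 (i + 1) -
        (deriv (multInt N x0 u0 (i + 1)) t - deriv (multInt N x0 u0 i) t)) t := e2.sub e3
    have e5 := hvel (i + 1) (by omega) hi
    rw [hev.deriv_eq, e4.deriv, Nat.add_sub_cancel] at e5
    have := ih (by omega)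
    linarith

lemma IsMicroSolution.ae_regularTime_multInt (hN : 2 ≤ N) (hT : 0 < T)
    (h : IsMicroSolution N T x0 u0 x lam)
    (hx0 : ∀ i, 1 ≤ i → i < N → 1 / (N : ℝ) ≤ x0 (i + 1) - x0 i)
    (hu0 : ∀ i, 1 ≤ i → i ≤ N → |u0 i| ≤ C) :
    ∀ᵐ t ∂(volume.restrict (Ioo 0 T)),
      RegularTime N C u0 x (fun i s => deriv (multInt N x0 u0 i) s / N) t ∧
      ∀ i, i ≤ N → 0 ≤ deriv (multInt N x0 u0 i) t / N ∧
        deriv (multInt N x0 u0 i) t / N ≤ 2 * C := by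
  have hN0 : (0 : ℝ) < N := by exact_mod_cast (by omega : 0 < N)
  filter_upwards [ae_differentiableAt_multInt (x0 := x0) (u0 := u0) hT, h.velocity,
    h.ae_deriv_multInt hT hx0, ae_restrict_mem measurableSet_Ioo] with t hmd hvel hlam ht
  set k : ℕ → ℝ := fun i => deriv (multInt N x0 u0 i) t with hk
  have hk0 : ∀ i, i ≤ N → 0 ≤ k i := fun i hi => deriv_multInt_nonneg hx0 hi ht.1 (hmd i hi)
  have hkz : k 0 = 0 := deriv_multInt_eq_zero (Nat.zero_le _) (multInt_zero t)
  have hkN : k N = 0 := deriv_multInt_eq_zero le_rfl (multInt_last t)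
  have hvel' : ∀ i, 1 ≤ i → i ≤ N → deriv (x i) t + (k i - k (i - 1)) = u0 i := by
    intro i h1 hi
    have := hvel i h1 hi
    simp only [hk]
    rw [hlam i hi, hlam (i - 1) (by omega)]
    linarith
  have hstick : ∀ i, 1 ≤ i → i < N → multInt N x0 u0 i t = 0 ∧ k i = 0 ∨
      0 < multInt N x0 u0 i t ∧ deriv (x (i + 1)) t = deriv (x i) t ∧
        x (i + 1) t - x i t - 1 / (N : ℝ) = 0 := by
    intro i h1 hi
    rcases (multInt_nonneg (x0 := x0) (u0 := u0) hi.le t).eq_or_lt with h0 | hpos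
    · exact Or.inl ⟨h0.symm, deriv_multInt_eq_zero hi.le h0.symm⟩
    · refine Or.inr ⟨hpos, h.deriv_eq_of_multInt_pos hT hx0 h1 hi ht hpos, ?_⟩
      rw [h.eq_projPos hT hx0 (Ioo_subset_Icc_self ht) h1 hi.le,
        h.eq_projPos hT hx0 (Ioo_subset_Icc_self ht) (by omega) hi]
      exact projPos_gap_eq_zero h1 hi hpos
  -- The upper bound propagates from the left end of a congested block, the lower bound from its
  -- right end.
  have hup : ∀ n, n + 1 ≤ N → deriv (x (n + 1)) t ≤ C := by
    intro n
    induction n with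
    | zero =>
      intro hn
      have e1 := hvel' 1 le_rfl hn
      have e2 := hk0 1 hn
      have e3 := (abs_le.1 (hu0 1 le_rfl hn)).2
      simp only [Nat.sub_self, hkz] at e1
      simp only [zero_add]
      linarith
    | succ n ih =>
      intro hn
      rcases hstick (n + 1) (by omega) (by omega) with ⟨-, h0⟩ | ⟨-, h0, -⟩
      · have e1 := hvel' (n + 1 + 1) (by omega) hn
        have e2 := hk0 (n + 1 + 1) hn
        have e3 := (abs_le.1 (hu0 (n + 1 + 1) (by omega) hn)).2
        rw [Nat.add_sub_cancel, h0] at e1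
        linarith
      · rw [h0]
        exact ih (by omega)
  have hlow : ∀ n, n < N → -C ≤ deriv (x (N - n)) t := by
    intro n
    induction n with
    | zero =>
      intro _
      have e1 := hvel' N (by omega) le_rfl
      have e2 := hk0 (N - 1) (by omega)
      have e3 := (abs_le.1 (hu0 N (by omega) le_rfl)).1
      rw [hkN] at e1
      simp only [Nat.sub_zero]
      linarith
    | succ n ih =>
      intro hn
      have hs : N - (n + 1) + 1 = N - n := by omega
      rcases hstick (N - (n + 1)) (by omega) (by omega) with ⟨-, h0⟩ | ⟨-, h0, -⟩
      · have e1 := hvel' (N - (n + 1)) (by omega) (by omega)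
        have e2 := hk0 (N - (n + 1) - 1) (by omega)
        have e3 := (abs_le.1 (hu0 (N - (n + 1)) (by omega) (by omega))).1
        rw [h0] at e1
        linarith
      · rw [← h0, hs]
        exact ih (by omega)
  have hbd : ∀ i, 1 ≤ i → i ≤ N → |deriv (x i) t| ≤ C := by
    intro i h1 hi
    have e1 := hup (i - 1) (by omega)
    have e2 := hlow (N - i) (by omega)
    rw [show i - 1 + 1 = i by omega] at e1
    rw [show N - (N - i) = i by omega] at e2
    exact abs_le.2 ⟨e2, e1⟩
  have hksum : ∀ i, i ≤ N → k i ≤ 2 * C * i := by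
    intro i
    induction i with
    | zero => simp [hkz]
    | succ i ih =>
      intro hi
      have e1 := hvel' (i + 1) (by omega) hi
      have e2 := (abs_le.1 (hbd (i + 1) (by omega) hi)).1
      have e3 := (abs_le.1 (hu0 (i + 1) (by omega) hi)).2
      have e4 := ih (by omega)
      rw [Nat.add_sub_cancel] at e1
      push_cast
      linarith
  refine ⟨⟨fun i h1 hi => ?_, hbd, fun i h1 hi => ?_, fun i h1 hi => ?_, fun i h1 hi => ?_⟩,
    fun i hi => ⟨div_nonneg (hk0 i hi) hN0.le, ?_⟩⟩
  · rw [← hvel' i h1 hi]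
    simp only [hk]
    field_simp
  · rcases hstick i h1 hi with ⟨-, h0⟩ | ⟨-, -, h0⟩
    · simp only [hk] at h0
      simp [h0]
    · rw [h0, mul_zero]
  · rcases hstick i h1 hi with ⟨-, h0⟩ | ⟨-, h0, -⟩
    · simp only [hk] at h0
      simp [h0]
    · rw [h0, sub_self, mul_zero]
  · rcases hstick i h1 hi with ⟨hm0, h0⟩ | ⟨-, h0, hg⟩
    · have q1 := multInt_le_mul_deriv hx0 (show i + 1 ≤ N by omega) ht.1 (hmd (i + 1) (by omega))
      have q2 := multInt_le_mul_deriv hx0 (show i - 1 ≤ N by omega) ht.1 (hmd (i - 1) (by omega))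
      have hg := projPos_gap (N := N) (x0 := x0) (u0 := u0) i t
      rw [← h.eq_projPos hT hx0 (Ioo_subset_Icc_self ht) h1 hi.le,
        ← h.eq_projPos hT hx0 (Ioo_subset_Icc_self ht) (by omega) hi, hm0] at hg
      have e1 := hvel' (i + 1) (by omega) hi
      have e2 := hvel' i h1 hi.le
      rw [Nat.add_sub_cancel, h0] at e1
      rw [h0] at e2
      have e3 := hx0 i h1 hi
      have e4 : deriv (x (i + 1)) t - deriv (x i) t =
        u0 (i + 1) - u0 i - k (i + 1) - k (i - 1) := by linarith
      rw [e4]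
      change multInt N x0 u0 (i + 1) t ≤ t * k (i + 1) at q1
      change multInt N x0 u0 (i - 1) t ≤ t * k (i - 1) at q2
      nlinarith
    · rw [h0, sub_self, mul_zero]
      linarith
  · rw [div_le_iff₀ hN0]
    have hC : 0 ≤ C := (abs_nonneg _).trans (hbd 1 le_rfl (by omega))
    have : (i : ℝ) ≤ N := by exact_mod_cast hi
    have := hksum i hi
    change k i ≤ _
    nlinarith

/-- The multipliers coincide almost everywhere with nondecreasing functions of time, because their
time integrals are convex. -/
theorem IsMicroSolution.exists_monotone_multipliers (hN : 2 ≤ N) (hT : 0 < T)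
    (h : IsMicroSolution N T x0 u0 x lam)
    (hx0 : ∀ i, 1 ≤ i → i < N → 1 / (N : ℝ) ≤ x0 (i + 1) - x0 i)
    (hu0 : ∀ i, 1 ≤ i → i ≤ N → |u0 i| ≤ C) :
    ∃ l : ℕ → ℝ → ℝ, (∀ i, Monotone (l i)) ∧ (∀ i t, 0 ≤ l i t ∧ l i t ≤ 2 * C) ∧
      (∀ t, l 0 t = 0) ∧ (∀ t, l N t = 0) ∧
      ∀ᵐ t ∂(volume.restrict (Ioo 0 T)), (∀ i, i ≤ N → l i t = lam i t) ∧
        RegularTime N C u0 x l t := by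
  have hN0 : (0 : ℝ) < N := by exact_mod_cast (by omega : 0 < N)
  have hC : 0 ≤ C := (abs_nonneg _).trans (hu0 1 le_rfl (by omega))
  set k : ℕ → ℝ → ℝ := fun i s => deriv (multInt N x0 u0 i) s / N with hk
  set S : Set ℝ := {t | (∀ i, i ≤ N → DifferentiableAt ℝ (multInt N x0 u0 i) t) ∧
    ∀ i, i ≤ N → 0 ≤ k i t ∧ k i t ≤ 2 * C} with hS
  have hext : ∀ i, ∃ g : ℝ → ℝ, Monotone g ∧ (∀ t, 0 ≤ g t ∧ g t ≤ 2 * C) ∧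
      (i ≤ N → EqOn (k i) g S) ∧ (i = 0 ∨ i = N → ∀ t, g t = 0) := by
    intro i
    rcases Nat.lt_or_ge N i with hi | hi
    · exact ⟨fun _ => 0, monotone_const, fun _ => ⟨le_rfl, by positivity⟩,
        fun h' => absurd h' (by omega), fun _ _ => rfl⟩
    · by_cases hb : i = 0 ∨ i = N
      · refine ⟨fun _ => 0, monotone_const, fun _ => ⟨le_rfl, by positivity⟩,
          fun _ t _ => ?_, fun _ _ => rfl⟩
        have : deriv (multInt N x0 u0 i) t = 0 := by
          refine deriv_multInt_eq_zero hi ?_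
          rcases hb with rfl | rfl
          · exact multInt_zero t
          · exact multInt_last t
        simp [hk, this]
      · have hmono : MonotoneOn (k i) S := by
          intro s hs t ht hst
          rcases hst.eq_or_lt with rfl | hlt
          · exact le_rfl
          · have e1 := (convexOn_multInt (x0 := x0) (u0 := u0) hi).deriv_le_slope (mem_univ s)
              (mem_univ t) hlt (hs.1 i hi)
            have e2 := (convexOn_multInt (x0 := x0) (u0 := u0) hi).slope_le_deriv (mem_univ s)
              (mem_univ t) hlt (ht.1 i hi)
            exact div_le_div_of_nonneg_right (e1.trans e2) hN0.le
        obtain ⟨g, hg, hgeq⟩ := hmono.exists_monotone_extension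
          ⟨0, by rintro _ ⟨t, ht, rfl⟩; exact (ht.2 i hi).1⟩
          ⟨2 * C, by rintro _ ⟨t, ht, rfl⟩; exact (ht.2 i hi).2⟩
        refine ⟨fun t => max 0 (min (g t) (2 * C)), fun s t hst =>
          max_le_max le_rfl (min_le_min (hg hst) le_rfl), fun t => ⟨le_max_left _ _,
          max_le (by positivity) (min_le_right _ _)⟩, fun _ t ht => ?_, fun h' => absurd h' hb⟩
        simp only
        rw [← hgeq ht, min_eq_left (ht.2 i hi).2, max_eq_right (ht.2 i hi).1]
  choose l hl1 hl2 hl3 hl4 using hext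
  refine ⟨l, hl1, hl2, hl4 0 (Or.inl rfl), hl4 N (Or.inr rfl), ?_⟩
  filter_upwards [ae_differentiableAt_multInt (x0 := x0) (u0 := u0) hT,
    h.ae_deriv_multInt hT hx0, h.ae_regularTime_multInt hN hT hx0 hu0] with t hmd hlam hreg
  have hkl : ∀ i, i ≤ N → l i t = k i t := fun i hi => (hl3 i hi ⟨hmd, hreg.2⟩).symm
  refine ⟨fun i hi => ?_, ⟨fun i h1 hi => ?_, hreg.1.bound, fun i h1 hi => ?_,
    fun i h1 hi => ?_, hreg.1.oleinik⟩⟩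
  · rw [hkl i hi, hk]
    simp only
    rw [hlam i hi]
    field_simp
  · rw [hkl i hi, hkl (i - 1) (by omega)]
    exact hreg.1.velocity i h1 hi
  · rw [hkl i hi.le]
    exact hreg.1.mult_gap i h1 hi
  · rw [hkl i hi.le]
    exact hreg.1.mult_vel i h1 hi

end Micro

/-! ### Interpolation -/

section Interpolation

variable {N : ℕ} {a b : ℕ → ℝ} {w : ℝ}

lemma one_le_ceil_mul (hN : 0 < N) (hw : 0 < w) : 1 ≤ ⌈(N : ℝ) * w⌉₊ :=
  Nat.one_le_ceil_iff.2 (mul_pos (by exact_mod_cast hN) hw)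

lemma ceil_mul_le (hw : w ≤ 1) : ⌈(N : ℝ) * w⌉₊ ≤ N :=
  Nat.ceil_le.2 (by nlinarith [Nat.cast_nonneg (α := ℝ) N])

lemma ceil_mul_mono {v : ℝ} (h : v ≤ w) : ⌈(N : ℝ) * v⌉₊ ≤ ⌈(N : ℝ) * w⌉₊ :=
  Nat.ceil_mono (mul_le_mul_of_nonneg_left h (Nat.cast_nonneg N))

lemma ceil_mul_sub_one_lt (hN : 0 < N) (hw : 0 < w) : (⌈(N : ℝ) * w⌉₊ : ℝ) - 1 < N * w := by
  have := Nat.ceil_lt_add_one (mul_pos (show (0 : ℝ) < N by exact_mod_cast hN) hw).le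
  linarith

lemma ceil_eq_of_mem_cell (hN : 0 < N) {i : ℕ}
    (hw : w ∈ Ioc ((i : ℝ) / N) (((i + 1 : ℕ) : ℝ) / N)) : ⌈(N : ℝ) * w⌉₊ = i + 1 := by
  have hN0 : (0 : ℝ) < N := by exact_mod_cast hN
  have h1 := (div_lt_iff₀ hN0).1 hw.1
  have h2 := (le_div_iff₀ hN0).1 hw.2
  refine (Nat.ceil_eq_iff (by omega)).2 ⟨?_, by linarith⟩
  simpa using (by linarith : (i : ℝ) < N * w)

/-- The interpolation as a convex combination of the two adjacent nodal values. -/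
lemma affInterp_eq (hN : 0 < N) (a : ℕ → ℝ) (w : ℝ) :
    affInterp N a w = (1 - (N * w - ((⌈(N : ℝ) * w⌉₊ : ℝ) - 1))) * a (⌈(N : ℝ) * w⌉₊ - 1) +
      (N * w - ((⌈(N : ℝ) * w⌉₊ : ℝ) - 1)) * a ⌈(N : ℝ) * w⌉₊ := by
  have hN0 : (N : ℝ) ≠ 0 := by exact_mod_cast hN.ne'
  simp only [affInterp]
  field_simp
  ring

lemma affInterp_of_nonpos (hw : w ≤ 0) : affInterp N a w = a 0 := by
  have : ⌈(N : ℝ) * w⌉₊ = 0 :=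
    Nat.ceil_eq_zero.2 (mul_nonpos_of_nonneg_of_nonpos (Nat.cast_nonneg N) hw)
  simp [affInterp, this]

lemma affInterp_mem_Icc (hN : 0 < N) (hw : w ∈ Ioo (0 : ℝ) 1) {m M : ℝ}
    (h : ∀ i, i ≤ N → a i ∈ Icc m M) : affInterp N a w ∈ Icc m M := by
  rw [affInterp_eq hN]
  have h1 := ceil_mul_sub_one_lt hN hw.1
  have h2 := Nat.le_ceil ((N : ℝ) * w)
  have hc := ceil_mul_le (N := N) hw.2.le
  have h3 := h ⌈(N : ℝ) * w⌉₊ hc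
  have h4 := h (⌈(N : ℝ) * w⌉₊ - 1) (by omega)
  set s := N * w - ((⌈(N : ℝ) * w⌉₊ : ℝ) - 1) with hs
  exact convex_Icc m M h4 h3 (a := 1 - s) (b := s) (by linarith) (by linarith) (by ring)

lemma abs_affInterp_le (hN : 0 < N) (hw : w ∈ Ioo (0 : ℝ) 1) {M : ℝ}
    (h : ∀ i, i ≤ N → |a i| ≤ M) : |affInterp N a w| ≤ M :=
  abs_le.2 (affInterp_mem_Icc hN hw fun i hi => abs_le.1 (h i hi))

lemma pcInterp_monotoneOn (hN : 0 < N) (h : ∀ i, 1 ≤ i → i < N → a i ≤ a (i + 1)) :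
    MonotoneOn (pcInterp N a) (Ioo 0 1) := by
  intro v hv w hw hvw
  have hm : ∀ i j, 1 ≤ i → i ≤ j → j ≤ N → a i ≤ a j := by
    intro i j hi hij
    induction j, hij using Nat.le_induction with
    | base => exact fun _ => le_rfl
    | succ j hij ih => exact fun hj => (ih (by omega)).trans (h j (by omega) (by omega))
  exact hm _ _ (one_le_ceil_mul hN hv.1) (ceil_mul_mono hvw) (ceil_mul_le hw.2.le)

lemma affInterp_monotoneOn (hN : 0 < N) (h : ∀ i, i < N → a i ≤ a (i + 1)) :
    MonotoneOn (affInterp N a) (Ioo 0 1) := by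
  intro v hv w hw hvw
  have hm : ∀ i j, i ≤ j → j ≤ N → a i ≤ a j := by
    intro i j hij
    induction j, hij using Nat.le_induction with
    | base => exact fun _ => le_rfl
    | succ j hij ih => exact fun hj => (ih (by omega)).trans (h j (by omega))
  have v1 := ceil_mul_sub_one_lt hN hv.1
  have v2 := Nat.le_ceil ((N : ℝ) * v)
  have w1 := ceil_mul_sub_one_lt hN hw.1
  have w2 := Nat.le_ceil ((N : ℝ) * w)
  have v3 := one_le_ceil_mul hN hv.1
  have w3 := ceil_mul_le (N := N) hw.2.le
  have hvw' := mul_le_mul_of_nonneg_left hvw (Nat.cast_nonneg (α := ℝ) N)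
  rw [affInterp_eq hN, affInterp_eq hN]
  set i := ⌈(N : ℝ) * v⌉₊
  set j := ⌈(N : ℝ) * w⌉₊
  have hij : i ≤ j := ceil_mul_mono hvw
  rcases hij.eq_or_lt with heq | hlt
  · rw [← heq]
    have := hm (i - 1) i (by omega) (by omega)
    nlinarith
  · have e1 := hm (i - 1) i (by omega) (by omega)
    have e2 := hm i (j - 1) (by omega) (by omega)
    have e3 := hm (j - 1) j (by omega) (by omega)
    nlinarith

lemma measurable_pcInterp (N : ℕ) (a : ℕ → ℝ) : Measurable (pcInterp N a) :=
  (measurable_from_nat (f := a)).comp (Nat.measurable_ceil.comp (measurable_const_mul _))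

lemma measurable_pcInterp_uncurry {α : Type*} [MeasurableSpace α] (N : ℕ) {a : ℕ → α → ℝ}
    (ha : ∀ i, Measurable (a i)) :
    Measurable (fun z : α × ℝ => pcInterp N (fun i => a i z.1) z.2) := by
  have h1 : Measurable (fun p : ℕ × α => a p.1 p.2) := measurable_from_prod_countable_right ha
  have h2 : Measurable (fun z : α × ℝ => (⌈(N : ℝ) * z.2⌉₊, z.1)) :=
    (Nat.measurable_ceil.comp (measurable_snd.const_mul _)).prodMk measurable_fst
  exact h1.comp h2

lemma measurable_affInterp_uncurry {α : Type*} [MeasurableSpace α] (N : ℕ) {a : ℕ → α → ℝ}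
    (ha : ∀ i, Measurable (a i)) :
    Measurable (fun z : α × ℝ => affInterp N (fun i => a i z.1) z.2) := by
  have h1 := measurable_pcInterp_uncurry N ha
  have h2 := measurable_pcInterp_uncurry N (a := fun i => a (i - 1)) (fun i => ha (i - 1))
  have h3 : Measurable (fun z : α × ℝ => (⌈(N : ℝ) * z.2⌉₊ : ℝ)) :=
    (measurable_from_nat (f := fun n : ℕ => (n : ℝ))).comp
      (Nat.measurable_ceil.comp (measurable_snd.const_mul _))
  exact (((h1.sub h2).const_mul _).mul
    (measurable_snd.sub ((h3.sub_const 1).div_const _))).add h2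

lemma abs_pcInterp_le (hN : 0 < N) (hw : w ∈ Ioc (0 : ℝ) 1) {M : ℝ}
    (h : ∀ i, 1 ≤ i → i ≤ N → |a i| ≤ M) : |pcInterp N a w| ≤ M :=
  h _ (one_le_ceil_mul hN hw.1) (ceil_mul_le hw.2)

lemma exists_abs_pcInterp_le (N : ℕ) (a : ℕ → ℝ) :
    ∃ M, ∀ w ∈ Icc (0 : ℝ) 1, |pcInterp N a w| ≤ M :=
  ⟨∑ i ∈ Finset.range (N + 1), |a i|, fun _ hw => Finset.single_le_sum (f := fun i => |a i|)
    (fun _ _ => abs_nonneg _) (Finset.mem_range.2 (Nat.lt_succ_of_le (ceil_mul_le hw.2)))⟩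

lemma integrableOn_pcInterp (N : ℕ) (a : ℕ → ℝ) : IntegrableOn (pcInterp N a) (Icc 0 1) := by
  obtain ⟨M, hM⟩ := exists_abs_pcInterp_le N a
  exact Measure.integrableOn_of_bounded (M := M) (by simp)
    (measurable_pcInterp N a).aestronglyMeasurable
    ((ae_restrict_iff' measurableSet_Icc).2 (Eventually.of_forall hM))

lemma intervalIntegrable_of_integrableOn_Icc {f : ℝ → ℝ} (hf : IntegrableOn f (Icc 0 1)) {p q : ℝ}
    (hp : p ∈ Icc (0 : ℝ) 1) (hq : q ∈ Icc (0 : ℝ) 1) : IntervalIntegrable f volume p q :=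
  ((intervalIntegrable_iff_integrableOn_Icc_of_le zero_le_one).2 hf).mono_set (by
    rw [uIcc_of_le zero_le_one]
    exact uIcc_subset_Icc hp hq)

lemma node_mem_Icc (hN : 0 < N) {i : ℕ} (hi : i ≤ N) : (i : ℝ) / N ∈ Icc (0 : ℝ) 1 := by
  have hN0 : (0 : ℝ) < N := by exact_mod_cast hN
  exact ⟨by positivity, (div_le_one hN0).2 (by exact_mod_cast hi)⟩

lemma integral_eq_sum_cells (hN : 0 < N) {f : ℝ → ℝ} (hf : IntegrableOn f (Icc 0 1)) {n : ℕ}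
    (hn : n ≤ N) :
    ∫ w in (0 : ℝ)..(n : ℝ) / N, f w =
      ∑ i ∈ Finset.range n, ∫ w in ((i : ℝ) / N)..(((i + 1 : ℕ) : ℝ) / N), f w := by
  have := intervalIntegral.sum_integral_adjacent_intervals (μ := volume) (f := f)
    (a := fun i : ℕ => (i : ℝ) / N) (n := n) (fun k hk => intervalIntegrable_of_integrableOn_Icc hf
      (node_mem_Icc hN (by omega)) (node_mem_Icc hN (by omega)))
  rw [this]
  simp

lemma integral_Ioo_eq_sum_cells (hN : 0 < N) {f : ℝ → ℝ} (hf : IntegrableOn f (Icc 0 1)) :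
    ∫ w in Ioo (0 : ℝ) 1, f w =
      ∑ i ∈ Finset.range N, ∫ w in ((i : ℝ) / N)..(((i + 1 : ℕ) : ℝ) / N), f w := by
  have hN0 : (N : ℝ) ≠ 0 := by exact_mod_cast hN.ne'
  rw [← integral_eq_sum_cells hN hf le_rfl, div_self hN0,
    intervalIntegral.integral_of_le zero_le_one, integral_Ioc_eq_integral_Ioo]

lemma integral_pcInterp_cell (hN : 0 < N) (a : ℕ → ℝ) {i : ℕ} {v : ℝ}
    (hv : v ∈ Icc ((i : ℝ) / N) (((i + 1 : ℕ) : ℝ) / N)) :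
    ∫ w in ((i : ℝ) / N)..v, pcInterp N a w = (v - (i : ℝ) / N) * a (i + 1) := by
  rw [intervalIntegral.integral_of_le hv.1, setIntegral_congr_fun (g := fun _ => a (i + 1))
    measurableSet_Ioc]
  · rw [setIntegral_const]
    simp [hv.1]
  · intro w hw
    simp only [pcInterp]
    rw [ceil_eq_of_mem_cell hN ⟨hw.1, hw.2.trans hv.2⟩]

lemma integral_Ioo_pcInterp (hN : 0 < N) (a : ℕ → ℝ) :
    ∫ w in Ioo (0 : ℝ) 1, pcInterp N a w = (∑ i ∈ Finset.range N, a (i + 1)) / N := by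
  have hN0 : (0 : ℝ) < N := by exact_mod_cast hN
  rw [integral_Ioo_eq_sum_cells hN (integrableOn_pcInterp N a), Finset.sum_div]
  refine Finset.sum_congr rfl fun i _ => ?_
  rw [integral_pcInterp_cell hN a (right_mem_Icc.2 (by gcongr; omega))]
  push_cast
  field_simp
  ring

/-- The derivative of the piecewise affine interpolation is piecewise constant. -/
lemma affInterp_eq_integral (hN : 0 < N) (a : ℕ → ℝ) (hw : w ∈ Icc (0 : ℝ) 1) :
    affInterp N a w = a 0 + ∫ v in (0 : ℝ)..w, pcInterp N (fun i => N * (a i - a (i - 1))) v := by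
  have hN0 : (0 : ℝ) < N := by exact_mod_cast hN
  rcases hw.1.eq_or_lt with rfl | hw0
  · simp [affInterp]
  have hint := integrableOn_pcInterp N (fun i => N * (a i - a (i - 1)))
  have h1 := ceil_mul_sub_one_lt hN hw0
  have h2 := Nat.le_ceil ((N : ℝ) * w)
  have h3 := one_le_ceil_mul hN hw0
  have h4 := ceil_mul_le (N := N) hw.2
  obtain ⟨i, hi⟩ : ∃ i, ⌈(N : ℝ) * w⌉₊ = i + 1 := ⟨_, (Nat.sub_add_cancel h3).symm⟩
  rw [hi] at h1 h2 h4
  have hcell : w ∈ Icc ((i : ℝ) / N) (((i + 1 : ℕ) : ℝ) / N) := by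
    push_cast at h1
    exact ⟨(div_le_iff₀ hN0).2 (by linarith), (le_div_iff₀ hN0).2 (by linarith)⟩
  rw [← intervalIntegral.integral_add_adjacent_intervals (b := (i : ℝ) / N)
    (intervalIntegrable_of_integrableOn_Icc hint (by simp) (node_mem_Icc hN (by omega)))
    (intervalIntegrable_of_integrableOn_Icc hint (node_mem_Icc hN (by omega)) hw),
    integral_pcInterp_cell hN _ hcell, integral_eq_sum_cells hN hint (by omega)]
  have hsum : ∑ j ∈ Finset.range i, ∫ v in ((j : ℝ) / N)..(((j + 1 : ℕ) : ℝ) / N),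
      pcInterp N (fun i => N * (a i - a (i - 1))) v = a i - a 0 := by
    rw [← Finset.sum_range_sub]
    refine Finset.sum_congr rfl fun j _ => ?_
    rw [integral_pcInterp_cell hN _ (right_mem_Icc.2 (by gcongr; omega))]
    push_cast
    field_simp
    simp
  rw [hsum]
  simp only [affInterp, hi, Nat.add_sub_cancel]
  push_cast
  ring

/-- Summation by parts: if the increments of `v` vanish wherever `l` does not, then the
interpolation of `v` is orthogonal to the derivatives `∂_w (l χ)`. -/
lemma integral_pcInterp_mul_deriv_eq_zero (hN : 0 < N) {v l : ℕ → ℝ} (h0 : l 0 = 0) (hlN : l N = 0)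
    (h : ∀ i, 1 ≤ i → i < N → l i * (v (i + 1) - v i) = 0) {χ : ℝ → ℝ} (hχ : ContDiff ℝ 1 χ) :
    ∫ w in Ioo (0 : ℝ) 1, pcInterp N v w *
      (affInterp N l w * deriv χ w + pcInterp N (fun i => N * (l i - l (i - 1))) w * χ w) = 0 := by
  have hN0 : (0 : ℝ) < N := by exact_mod_cast hN
  have hχ' : Continuous (deriv χ) := hχ.continuous_deriv le_rfl
  have hLc : ContinuousOn (affInterp N l) (Icc 0 1) := by
    have : ContinuousOn
        (fun w => l 0 + ∫ s in (0 : ℝ)..w, pcInterp N (fun i => N * (l i - l (i - 1))) s)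
        (Icc 0 1) := by
      have hint := integrableOn_pcInterp N (fun i => N * (l i - l (i - 1)))
      rw [← uIcc_of_le (zero_le_one (α := ℝ))] at hint ⊢
      exact continuousOn_const.add (intervalIntegral.continuousOn_primitive_interval hint)
    exact this.congr fun w hw => affInterp_eq_integral hN l hw
  have hint : IntegrableOn (fun w => pcInterp N v w * (affInterp N l w * deriv χ w +
      pcInterp N (fun i => N * (l i - l (i - 1))) w * χ w)) (Icc 0 1) := by
    obtain ⟨M, hM⟩ := exists_abs_pcInterp_le N v
    refine Integrable.bdd_mul (c := M) (f := pcInterp N v) ?_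
      (measurable_pcInterp N v).aestronglyMeasurable
      ((ae_restrict_iff' measurableSet_Icc).2 (Eventually.of_forall hM))
    exact (hLc.mul hχ'.continuousOn).integrableOn_compact isCompact_Icc |>.add
      ((integrableOn_pcInterp N _).mul_continuousOn hχ.continuous.continuousOn isCompact_Icc)
  rw [integral_Ioo_eq_sum_cells hN hint]
  have hcell : ∀ i : ℕ, ∫ w in ((i : ℝ) / N)..(((i + 1 : ℕ) : ℝ) / N), pcInterp N v w *
      (affInterp N l w * deriv χ w + pcInterp N (fun i => N * (l i - l (i - 1))) w * χ w) =
      v (i + 1) * (l (i + 1) * χ (((i + 1 : ℕ) : ℝ) / N) - l i * χ ((i : ℝ) / N)) := by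
    intro i
    have hle : (i : ℝ) / N ≤ ((i + 1 : ℕ) : ℝ) / N := by gcongr; omega
    set L : ℝ → ℝ := fun w => N * (l (i + 1) - l i) * (w - (i : ℝ) / N) + l i with hL
    have hcongr : ∫ w in ((i : ℝ) / N)..(((i + 1 : ℕ) : ℝ) / N), pcInterp N v w *
        (affInterp N l w * deriv χ w + pcInterp N (fun i => N * (l i - l (i - 1))) w * χ w) =
        ∫ w in ((i : ℝ) / N)..(((i + 1 : ℕ) : ℝ) / N), v (i + 1) *
          (N * (l (i + 1) - l i) * χ w + L w * deriv χ w) := by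
      rw [intervalIntegral.integral_of_le hle, intervalIntegral.integral_of_le hle]
      refine setIntegral_congr_fun measurableSet_Ioc fun w hw => ?_
      simp only [pcInterp, affInterp, ceil_eq_of_mem_cell hN hw, hL, Nat.add_sub_cancel]
      push_cast
      ring
    rw [hcongr, intervalIntegral.integral_const_mul]
    have hLd : ∀ w, HasDerivAt (fun w => L w * χ w)
        (N * (l (i + 1) - l i) * χ w + L w * deriv χ w) w := by
      intro w
      have e1 : HasDerivAt L (N * (l (i + 1) - l i)) w := by
        have e2 : HasDerivAt L (N * (l (i + 1) - l i) * 1) w :=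
          (((hasDerivAt_id w).sub_const ((i : ℝ) / N)).const_mul
            (N * (l (i + 1) - l i))).add_const (l i)
        simpa using e2
      exact e1.mul (hχ.differentiable one_ne_zero w).hasDerivAt
    have hcontL : Continuous L := by fun_prop
    rw [intervalIntegral.integral_eq_sub_of_hasDerivAt (fun w _ => hLd w)
      (Continuous.intervalIntegrable (by
        exact (continuous_const.mul hχ.continuous).add (hcontL.mul hχ')) _ _)]
    simp only [hL]
    push_cast
    field_simp
    ring
  rw [Finset.sum_congr rfl fun i _ => hcell i]
  have key : ∀ n, n + 1 ≤ N → ∑ i ∈ Finset.range (n + 1),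
      v (i + 1) * (l (i + 1) * χ (((i + 1 : ℕ) : ℝ) / N) - l i * χ ((i : ℝ) / N)) =
      v (n + 1) * (l (n + 1) * χ (((n + 1 : ℕ) : ℝ) / N)) := by
    intro n
    induction n with
    | zero => intro _; simp [h0]
    | succ n ih =>
      intro hn
      rw [Finset.sum_range_succ, ih (by omega)]
      have := h (n + 1) (by omega) (by omega)
      linear_combination (-χ (((n + 1 : ℕ) : ℝ) / N)) * this
  obtain ⟨n, rfl⟩ : ∃ n, N = n + 1 := ⟨N - 1, by omega⟩
  rw [key n le_rfl, hlN]
  ring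

end Interpolation

/-! ### The interpolated microscopic dynamics -/

/-- The properties of the interpolated microscopic dynamics that the passage to the limit uses:
`ξ`, `υ` and `υ0` are the piecewise constant positions, velocities and initial velocities, `υa` and
`l` are the piecewise affine velocities and multipliers. Since `υ0 - υ` is the derivative of `l` in
`w`, the factor `l χ' + (υ0 - υ) χ` is the derivative of `l χ`; the relations `orth_one`, `orth_pos`
and `orth_vel` say that it is orthogonal to constants and to the functions that are constant on the
blocks of touching particles, where alone `l` is positive. The field `oleinik` is the Oleinik
inequality; `aff` is its consequence that `υa` is a difference of bounded monotone functions,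
together with the closeness of `υa` to `υ`. -/
structure DiscreteFlow (N : ℕ) (T C R : ℝ) (ξ υ υa l : ℝ → ℝ → ℝ) (υ0 : ℝ → ℝ) : Prop where
  meas_pos : Measurable fun z : ℝ × ℝ => ξ z.1 z.2
  meas_vel : Measurable fun z : ℝ × ℝ => υ z.1 z.2
  meas_aff : Measurable fun z : ℝ × ℝ => υa z.1 z.2
  meas_mult : Measurable fun z : ℝ × ℝ => l z.1 z.2
  meas_vel0 : Measurable υ0
  vel0_bound : ∀ w ∈ Ioo (0 : ℝ) 1, |υ0 w| ≤ C
  pos_bound : ∀ t, ∀ w ∈ Ioo (0 : ℝ) 1, |ξ t w| ≤ R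
  pos_lip : ∀ s t, ∀ w ∈ Ioo (0 : ℝ) 1, |ξ t w - ξ s w| ≤ C * |t - s|
  pos_mono : ∀ t, MonotoneOn (ξ t) (Ioo 0 1)
  pos_gap : ∀ t, ∀ v ∈ Ioo (0 : ℝ) 1, ∀ w ∈ Ioo (0 : ℝ) 1, v ≤ w →
    w - v - 1 / (N : ℝ) ≤ ξ t w - ξ t v
  pos_ftc : ∀ s ∈ Icc 0 T, ∀ t ∈ Icc 0 T, ∀ w ∈ Ioo (0 : ℝ) 1,
    ξ t w - ξ s w = ∫ r in s..t, υ r w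
  mult_mono : ∀ w, Monotone fun t => l t w
  mult_mem : ∀ t w, l t w ∈ Icc 0 (2 * C)
  vel_bound : ∀ᵐ t ∂(volume.restrict (Ioo 0 T)), ∀ w ∈ Ioo (0 : ℝ) 1, |υ t w| ≤ C
  mult_eq : ∀ᵐ t ∂(volume.restrict (Ioo 0 T)), ∀ w ∈ Ioo (0 : ℝ) 1,
    l t w = ∫ v in (0 : ℝ)..w, (υ0 v - υ t v)
  oleinik : ∀ᵐ t ∂(volume.restrict (Ioo 0 T)),
    MonotoneOn (fun w => (ξ t w - (⌈(N : ℝ) * w⌉₊ : ℝ) / N) / t - υ t w) (Ioo 0 1)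
  orth_one : ∀ᵐ t ∂(volume.restrict (Ioo 0 T)), ∀ χ : ℝ → ℝ, ContDiff ℝ 1 χ →
    ∫ w in Ioo (0 : ℝ) 1, 1 * (l t w * deriv χ w + (υ0 w - υ t w) * χ w) = 0
  orth_pos : ∀ᵐ t ∂(volume.restrict (Ioo 0 T)), ∀ χ : ℝ → ℝ, ContDiff ℝ 1 χ →
    ∫ w in Ioo (0 : ℝ) 1, (ξ t w - (⌈(N : ℝ) * w⌉₊ : ℝ) / N) *
      (l t w * deriv χ w + (υ0 w - υ t w) * χ w) = 0
  orth_vel : ∀ᵐ t ∂(volume.restrict (Ioo 0 T)), ∀ χ : ℝ → ℝ, ContDiff ℝ 1 χ →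
    ∫ w in Ioo (0 : ℝ) 1, υ t w * (l t w * deriv χ w + (υ0 w - υ t w) * χ w) = 0
  aff : ∀ᵐ t ∂(volume.restrict (Ioo 0 T)), ∃ A B : ℝ → ℝ,
    MonotoneOn A (Ioo 0 1) ∧ MonotoneOn B (Ioo 0 1) ∧
    (∀ w ∈ Ioo (0 : ℝ) 1, |A w| ≤ (R + 1) / t) ∧
    (∀ w ∈ Ioo (0 : ℝ) 1, |B w| ≤ (R + 1) / t + C) ∧
    (∀ w ∈ Ioo (0 : ℝ) 1, υa t w = A w - B w) ∧
    ∫ w in Ioo (0 : ℝ) 1, |υa t w - υ t w| ≤ 2 * (2 * ((R + 1) / t) + C) / N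

lemma integral_abs_affInterp_sub_pcInterp_le {N : ℕ} (hN : 0 < N) {e c : ℕ → ℝ}
    (h : ∀ i, i < N → |e (i + 1) - e i| ≤ c (i + 1) - c i) :
    ∫ w in Ioo (0 : ℝ) 1, |affInterp N e w - pcInterp N e w| ≤ (c N - c 0) / N := by
  have hle : ∀ w ∈ Ioo (0 : ℝ) 1, |affInterp N e w - pcInterp N e w| ≤
      pcInterp N (fun i => c i - c (i - 1)) w := by
    intro w hw
    rw [affInterp_eq hN]
    have h1 := ceil_mul_sub_one_lt hN hw.1
    have h2 := Nat.le_ceil ((N : ℝ) * w)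
    have h3 := one_le_ceil_mul hN hw.1
    have h4 := ceil_mul_le (N := N) hw.2.le
    simp only [pcInterp]
    obtain ⟨i, hi⟩ : ∃ i, ⌈(N : ℝ) * w⌉₊ = i + 1 := ⟨_, (Nat.sub_add_cancel h3).symm⟩
    rw [hi] at h1 h2 h4 ⊢
    rw [Nat.add_sub_cancel]
    push_cast at h1 h2 ⊢
    have h5 := h i (by omega)
    have h6 : (1 - ((N : ℝ) * w - ((i : ℝ) + 1 - 1))) * e i +
        ((N : ℝ) * w - ((i : ℝ) + 1 - 1)) * e (i + 1) - e (i + 1) =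
        -((1 - ((N : ℝ) * w - (i : ℝ))) * (e (i + 1) - e i)) := by ring
    rw [h6, abs_neg, abs_mul, abs_of_nonneg (by linarith)]
    have := abs_nonneg (e (i + 1) - e i)
    nlinarith
  have hint := (integrableOn_pcInterp N (fun i => c i - c (i - 1))).mono_set
    (Ioo_subset_Icc_self (a := (0 : ℝ)) (b := 1))
  calc ∫ w in Ioo (0 : ℝ) 1, |affInterp N e w - pcInterp N e w|
      ≤ ∫ w in Ioo (0 : ℝ) 1, pcInterp N (fun i => c i - c (i - 1)) w :=
        integral_mono_of_nonneg (Eventually.of_forall fun _ => abs_nonneg _) hint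
          ((ae_restrict_iff' measurableSet_Ioo).2 (Eventually.of_forall hle))
    _ = (c N - c 0) / N := by
        rw [integral_Ioo_pcInterp hN]
        simp only [Nat.add_sub_cancel]
        rw [Finset.sum_range_sub]

/-- The retraction of `ℝ` onto `[0, T]`. -/
def timeClamp (T t : ℝ) : ℝ := max 0 (min t T)

lemma timeClamp_mem {T : ℝ} (hT : 0 < T) (t : ℝ) : timeClamp T t ∈ Icc 0 T :=
  ⟨le_max_left _ _, max_le hT.le (min_le_right _ _)⟩

lemma timeClamp_of_mem {T t : ℝ} (ht : t ∈ Icc 0 T) : timeClamp T t = t := by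
  rw [timeClamp, min_eq_left ht.2, max_eq_right ht.1]

lemma abs_timeClamp_sub_le (T s t : ℝ) : |timeClamp T t - timeClamp T s| ≤ |t - s| := by
  refine (abs_max_sub_max_le_abs (min t T) (min s T) 0 |> fun h => ?_)
  simp only [timeClamp]
  rw [max_comm 0, max_comm 0]
  refine h.trans ?_
  have := abs_min_sub_min_le_max t T s T
  simpa using this

/-- The positions as a function of `(t, w)`, made constant in time outside `[0, T]`. -/
def clampedPos (N : ℕ) (T : ℝ) (x : ℕ → ℝ → ℝ) (t w : ℝ) : ℝ :=
  pcInterp N (fun i => x (max 1 (min i N)) (timeClamp T t)) w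

section Micro

variable {N : ℕ} {T C δ R : ℝ} {x0 u0 : ℕ → ℝ} {x lam l : ℕ → ℝ → ℝ}

lemma clampedPos_eq (hN : 0 < N) (t : ℝ) {w : ℝ} (hw : w ∈ Ioo (0 : ℝ) 1) :
    clampedPos N T x t w = pcInterp N (fun i => x i (timeClamp T t)) w := by
  simp only [clampedPos, pcInterp]
  rw [min_eq_left (ceil_mul_le hw.2.le), max_eq_right (one_le_ceil_mul hN hw.1)]

lemma clampedPos_eq_XN (hN : 0 < N) {t w : ℝ} (ht : t ∈ Icc 0 T) (hw : w ∈ Ioo (0 : ℝ) 1) :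
    clampedPos N T x t w = XN N x t w := by
  rw [clampedPos_eq hN t hw, timeClamp_of_mem ht, XN]

lemma velExt_eq (t : ℝ) (i : ℕ) : velExt N δ x i t = deriv (x (max i 1)) t := by
  rcases Nat.eq_zero_or_pos i with rfl | hi
  · have : posExt N δ x 0 = fun s => x 1 s - 1 / (N : ℝ) - δ := by
      funext s
      simp [posExt]
    rw [velExt, this]
    simp
  · have : posExt N δ x i = x i := by
      funext s
      simp [posExt, hi.ne']
    rw [velExt, this, max_eq_left hi]

lemma IsMicroSolution.sub_eq_integral (h : IsMicroSolution N T x0 u0 x lam) {i : ℕ} (h1 : 1 ≤ i)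
    (hi : i ≤ N) {s t : ℝ} (hs : s ∈ Icc 0 T) (ht : t ∈ Icc 0 T) :
    x i t - x i s = ∫ r in s..t, deriv (x i) r := by
  obtain ⟨K, hK⟩ := h.lipschitz
  have : AbsolutelyContinuousOnInterval (x i) s t :=
    LipschitzOnWith.absolutelyContinuousOnInterval (K := K)
      ((hK i h1 hi).mono (uIcc_subset_Icc hs ht))
  rw [this.integral_deriv_eq_sub]

lemma ae_uIoc_of_ae_Ioo {p : ℝ → Prop} (h : ∀ᵐ t ∂(volume.restrict (Ioo 0 T)), p t) {s t : ℝ}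
    (hs : s ∈ Icc 0 T) (ht : t ∈ Icc 0 T) : ∀ᵐ r, r ∈ uIoc s t → p r := by
  rw [restrict_Ioo_eq_restrict_Ioc, ae_restrict_iff' measurableSet_Ioc] at h
  filter_upwards [h] with r hr hmem
  exact hr ⟨(le_min hs.1 ht.1).trans_lt hmem.1, hmem.2.trans (max_le hs.2 ht.2)⟩

lemma IsMicroSolution.abs_sub_le (h : IsMicroSolution N T x0 u0 x lam)
    (hb : ∀ᵐ t ∂(volume.restrict (Ioo 0 T)), ∀ i, 1 ≤ i → i ≤ N → |deriv (x i) t| ≤ C)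
    {i : ℕ} (h1 : 1 ≤ i) (hi : i ≤ N) {s t : ℝ} (hs : s ∈ Icc 0 T) (ht : t ∈ Icc 0 T) :
    |x i t - x i s| ≤ C * |t - s| := by
  rw [h.sub_eq_integral h1 hi hs ht]
  refine intervalIntegral.norm_integral_le_of_norm_le_const_ae (f := deriv (x i)) ?_
  filter_upwards [ae_uIoc_of_ae_Ioo hb hs ht] with r hr hmem
  exact hr hmem i h1 hi

lemma abs_div_le_one {i : ℕ} (hi : i ≤ N) (hN : 0 < N) : |(i : ℝ) / N| ≤ 1 := by
  rw [abs_of_nonneg (by positivity)]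
  exact (div_le_one (by exact_mod_cast hN)).2 (by exact_mod_cast hi)

/-- At a regular time, the piecewise affine velocity is a difference of monotone functions. -/
lemma RegularTime.exists_monotone_decomposition (hN : 2 ≤ N) {t : ℝ} (ht : 0 < t)
    (h : RegularTime N C u0 x l t) (hR : ∀ i, 1 ≤ i → i ≤ N → |x i t| ≤ R)
    (hgap : ∀ i, 1 ≤ i → i < N → 1 / (N : ℝ) ≤ x (i + 1) t - x i t) :
    ∃ A B : ℝ → ℝ, MonotoneOn A (Ioo 0 1) ∧ MonotoneOn B (Ioo 0 1) ∧
      (∀ w ∈ Ioo (0 : ℝ) 1, |A w| ≤ (R + 1) / t) ∧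
      (∀ w ∈ Ioo (0 : ℝ) 1, |B w| ≤ (R + 1) / t + C) ∧
      (∀ w ∈ Ioo (0 : ℝ) 1, UNaff N δ x t w = A w - B w) ∧
      ∫ w in Ioo (0 : ℝ) 1, |UNaff N δ x t w - UN N x t w| ≤
        2 * (2 * ((R + 1) / t) + C) / N := by
  have hN' : 0 < N := by omega
  have hN0 : (0 : ℝ) < N := by exact_mod_cast hN'
  set a : ℕ → ℝ := fun i => (x (max i 1) t - ((max i 1 : ℕ) : ℝ) / N) / t with ha
  set e : ℕ → ℝ := fun i => deriv (x (max i 1)) t with he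
  set b : ℕ → ℝ := fun i => a i - e i with hb
  have hma : ∀ i, i < N → a i ≤ a (i + 1) := by
    intro i hi
    rcases Nat.eq_zero_or_pos i with rfl | h1
    · simp [ha]
    · replace h1 : 1 ≤ i := h1
      have := hgap i h1 hi
      simp only [ha, max_eq_left h1, max_eq_left (show 1 ≤ i + 1 by omega)]
      refine div_le_div_of_nonneg_right ?_ ht.le
      push_cast
      rw [add_div]
      linarith
  have hmb : ∀ i, i < N → b i ≤ b (i + 1) := by
    intro i hi
    rcases Nat.eq_zero_or_pos i with rfl | h1
    · simp [hb, ha, he]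
    · replace h1 : 1 ≤ i := h1
      have h2 := h.oleinik i h1 hi
      have h3 : 0 ≤ (x (i + 1) t - x i t - t * (deriv (x (i + 1)) t - deriv (x i) t) -
        1 / (N : ℝ)) / t := div_nonneg (by linarith) ht.le
      simp only [hb, ha, he, max_eq_left h1, max_eq_left (show 1 ≤ i + 1 by omega)]
      have h4 : (x (i + 1) t - x i t - t * (deriv (x (i + 1)) t - deriv (x i) t) -
          1 / (N : ℝ)) / t = ((x (i + 1) t - ((i + 1 : ℕ) : ℝ) / N) / t - deriv (x (i + 1)) t) -
          ((x i t - (i : ℝ) / N) / t - deriv (x i) t) := by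
        push_cast
        field_simp
        ring
      linarith
  have hba : ∀ i, i ≤ N → |a i| ≤ (R + 1) / t := by
    intro i hi
    simp only [ha]
    rw [abs_div, abs_of_pos ht]
    gcongr
    exact (abs_sub _ _).trans (add_le_add (hR _ (le_max_right _ _) (max_le hi (by omega)))
      (abs_div_le_one (max_le hi (by omega)) hN'))
  have hbe : ∀ i, i ≤ N → |e i| ≤ C := fun i hi =>
    h.bound _ (le_max_right _ _) (max_le hi (by omega))
  have hbb : ∀ i, i ≤ N → |b i| ≤ (R + 1) / t + C := fun i hi =>
    (abs_sub _ _).trans (add_le_add (hba i hi) (hbe i hi))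
  have hUa : ∀ w, UNaff N δ x t w = affInterp N e w := by
    intro w
    simp only [UNaff, velExt_eq]
    rfl
  have hU : ∀ w ∈ Ioo (0 : ℝ) 1, UN N x t w = pcInterp N e w := by
    intro w hw
    simp only [UN, pcInterp, he]
    rw [max_eq_left (one_le_ceil_mul hN' hw.1)]
  refine ⟨affInterp N a, affInterp N b, affInterp_monotoneOn hN' hma, affInterp_monotoneOn hN' hmb,
    fun w hw => abs_affInterp_le hN' hw hba, fun w hw => abs_affInterp_le hN' hw hbb,
    fun w _ => ?_, ?_⟩
  · rw [hUa, affInterp_eq hN', affInterp_eq hN', affInterp_eq hN']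
    simp only [hb]
    ring
  · have hcong : ∫ w in Ioo (0 : ℝ) 1, |UNaff N δ x t w - UN N x t w| =
        ∫ w in Ioo (0 : ℝ) 1, |affInterp N e w - pcInterp N e w| :=
      setIntegral_congr_fun measurableSet_Ioo fun w hw => by simp only [hUa, hU w hw]
    rw [hcong]
    refine (integral_abs_affInterp_sub_pcInterp_le hN'
      (c := fun i => a i + b i) fun i hi => ?_).trans
      ?_
    · have e1 := hma i hi
      have e2 := hmb i hi
      simp only [hb] at e2 ⊢
      exact abs_le.2 ⟨by linarith, by linarith⟩
    · have e1 := abs_le.1 (hba N le_rfl)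
      have e2 := abs_le.1 (hba 0 (Nat.zero_le _))
      have e3 := abs_le.1 (hbb N le_rfl)
      have e4 := abs_le.1 (hbb 0 (Nat.zero_le _))
      gcongr
      linarith [e1.2, e2.1, e3.2, e4.1]

/-- Position and velocity have the stated orthogonality relations by summation by parts, because a
positive multiplier makes the gaps and the velocity differences vanish. -/
theorem IsMicroSolution.discreteFlow (hN : 2 ≤ N) (hT : 0 < T)
    (h : IsMicroSolution N T x0 u0 x lam) (hu0 : ∀ i, 1 ≤ i → i ≤ N → |u0 i| ≤ C)
    (hR : ∀ i, 1 ≤ i → i ≤ N → |x0 i| + C * T ≤ R)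
    (hl1 : ∀ i, Monotone (l i)) (hl2 : ∀ i t, 0 ≤ l i t ∧ l i t ≤ 2 * C)
    (hl3 : ∀ t, l 0 t = 0) (hl4 : ∀ t, l N t = 0)
    (hreg : ∀ᵐ t ∂(volume.restrict (Ioo 0 T)), RegularTime N C u0 x l t) :
    DiscreteFlow N T C R (clampedPos N T x) (UN N x)
      (UNaff N δ x) (fun t w => affInterp N (fun i => l i t) w) (pcInterp N u0) := by
  have hN' : 0 < N := by omega
  have hN0 : (0 : ℝ) < N := by exact_mod_cast hN'
  have hC : 0 ≤ C := (abs_nonneg _).trans (hu0 1 le_rfl (by omega))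
  have hlip : ∀ i, 1 ≤ i → i ≤ N → ∀ s ∈ Icc 0 T, ∀ t ∈ Icc 0 T, |x i t - x i s| ≤ C * |t - s| :=
    fun i h1 hi s hs t ht => h.abs_sub_le (by filter_upwards [hreg] with t ht using ht.bound)
      h1 hi hs ht
  have hbd : ∀ i, 1 ≤ i → i ≤ N → ∀ t ∈ Icc 0 T, |x i t| ≤ R := by
    intro i h1 hi t ht
    have e1 := hlip i h1 hi 0 ⟨le_rfl, hT.le⟩ t ht
    rw [h.initial i h1 hi, sub_zero, abs_of_nonneg ht.1] at e1
    have e2 := abs_sub_abs_le_abs_sub (x i t) (x0 i)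
    have e3 := mul_le_mul_of_nonneg_left ht.2 hC
    have := hR i h1 hi
    linarith
  have hidx : ∀ w ∈ Ioo (0 : ℝ) 1, 1 ≤ ⌈(N : ℝ) * w⌉₊ ∧ ⌈(N : ℝ) * w⌉₊ ≤ N := fun w hw =>
    ⟨one_le_ceil_mul hN' hw.1, ceil_mul_le hw.2.le⟩
  have hgapm : ∀ t, ∀ i j, 1 ≤ i → i ≤ j → j ≤ N →
      ((j : ℝ) - i) / N ≤ x j (timeClamp T t) - x i (timeClamp T t) := by
    intro t i j h1 hij
    induction j, hij using Nat.le_induction with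
    | base => intro _; simp
    | succ j hij ih =>
      intro hj
      have e1 := ih (by omega)
      have e2 := h.nonoverlap _ (timeClamp_mem hT t) j (by omega) (by omega)
      have e3 : (((j + 1 : ℕ) : ℝ) - i) / N = ((j : ℝ) - i) / N + 1 / N := by
        push_cast
        field_simp
        ring
      linarith
  have hvelpc : ∀ᵐ t ∂(volume.restrict (Ioo 0 T)), ∀ w ∈ Ioc (0 : ℝ) 1,
      pcInterp N (fun i => N * (l i t - l (i - 1) t)) w = pcInterp N u0 w - UN N x t w := by
    filter_upwards [hreg] with t ht w hw
    have := ht.velocity _ (one_le_ceil_mul hN' hw.1) (ceil_mul_le hw.2)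
    simp only [pcInterp, UN]
    linarith
  have horth : ∀ (v : ℕ → ℝ) (t : ℝ), (∀ w ∈ Ioc (0 : ℝ) 1,
      pcInterp N (fun i => N * (l i t - l (i - 1) t)) w = pcInterp N u0 w - UN N x t w) →
      (∀ i, 1 ≤ i → i < N → l i t * (v (i + 1) - v i) = 0) → ∀ χ : ℝ → ℝ, ContDiff ℝ 1 χ →
      ∫ w in Ioo (0 : ℝ) 1, pcInterp N v w * (affInterp N (fun i => l i t) w * deriv χ w +
        (pcInterp N u0 w - UN N x t w) * χ w) = 0 := by
    intro v t h1 h2 χ hχ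
    refine Eq.trans (setIntegral_congr_fun measurableSet_Ioo fun w hw => ?_)
      (integral_pcInterp_mul_deriv_eq_zero hN' (v := v) (l := fun i => l i t) (hl3 t) (hl4 t)
        h2 hχ)
    simp only [← h1 w ⟨hw.1, hw.2.le⟩]
  refine
    { meas_pos := ?_, meas_vel := ?_, meas_aff := ?_, meas_mult := ?_,
      meas_vel0 := measurable_pcInterp N u0,
      vel0_bound := fun w hw => abs_pcInterp_le hN' ⟨hw.1, hw.2.le⟩ hu0,
      pos_bound := fun t w hw => by
        rw [clampedPos_eq hN' t hw]
        exact hbd _ (hidx w hw).1 (hidx w hw).2 _ (timeClamp_mem hT t),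
      pos_lip := ?_, pos_mono := ?_, pos_gap := ?_, pos_ftc := ?_, mult_mono := ?_,
      mult_mem := ?_,
      vel_bound := ?_, mult_eq := ?_, oleinik := ?_, orth_one := ?_, orth_pos := ?_, orth_vel := ?_,
      aff := ?_ }
  · refine measurable_pcInterp_uncurry N
      (a := fun i t => x (max 1 (min i N)) (timeClamp T t)) fun i => ?_
    have hi : 1 ≤ max 1 (min i N) ∧ max 1 (min i N) ≤ N := by omega
    have : LipschitzWith (Real.toNNReal C) (fun t => x (max 1 (min i N)) (timeClamp T t)) := by
      refine LipschitzWith.of_dist_le_mul fun t s => ?_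
      rw [Real.dist_eq, Real.dist_eq, Real.coe_toNNReal C hC]
      exact (hlip _ hi.1 hi.2 _ (timeClamp_mem hT s) _ (timeClamp_mem hT t)).trans
        (mul_le_mul_of_nonneg_left (abs_timeClamp_sub_le T s t) hC)
    exact this.continuous.measurable
  · exact measurable_pcInterp_uncurry N fun i => measurable_deriv (x i)
  · exact measurable_affInterp_uncurry N (a := fun i t => velExt N δ x i t)
      fun i => measurable_deriv _
  · exact measurable_affInterp_uncurry N fun i => (hl1 i).measurable
  · intro s t w hw
    rw [clampedPos_eq hN' t hw, clampedPos_eq hN' s hw]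
    exact (hlip _ (hidx w hw).1 (hidx w hw).2 _ (timeClamp_mem hT s) _ (timeClamp_mem hT t)).trans
      (mul_le_mul_of_nonneg_left (abs_timeClamp_sub_le T s t) hC)
  · intro t
    refine MonotoneOn.congr (pcInterp_monotoneOn hN' fun i h1 hi => ?_)
      fun w hw => (clampedPos_eq hN' t hw).symm
    have := h.nonoverlap _ (timeClamp_mem hT t) i h1 hi
    have : 0 ≤ 1 / (N : ℝ) := by positivity
    linarith
  · intro t v hv w hw hvw
    rw [clampedPos_eq hN' t hw, clampedPos_eq hN' t hv]
    refine le_trans ?_ (hgapm t _ _ (hidx v hv).1 (ceil_mul_mono hvw) (hidx w hw).2)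
    have e1 := ceil_mul_sub_one_lt hN' hv.1
    have e2 := Nat.le_ceil ((N : ℝ) * w)
    rw [le_div_iff₀ hN0]
    have e3 : (w - v - 1 / (N : ℝ)) * N = N * w - N * v - 1 := by field_simp
    linarith
  · intro s hs t ht w hw
    rw [clampedPos_eq_XN hN' ht hw, clampedPos_eq_XN hN' hs hw]
    simp only [pcInterp, XN, UN]
    exact h.sub_eq_integral (hidx w hw).1 (hidx w hw).2 hs ht
  · intro w s t hst
    rcases le_or_gt w 0 with hw | hw
    · simp only [affInterp_of_nonpos hw, hl3, le_refl]
    have e1 := ceil_mul_sub_one_lt hN' hw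
    have e2 := Nat.le_ceil ((N : ℝ) * w)
    simp only [affInterp_eq hN']
    have e3 := hl1 ⌈(N : ℝ) * w⌉₊ hst
    have e4 := hl1 (⌈(N : ℝ) * w⌉₊ - 1) hst
    exact add_le_add (mul_le_mul_of_nonneg_left e4 (by linarith))
      (mul_le_mul_of_nonneg_left e3 (by linarith))
  · intro t w
    rcases le_or_gt w 0 with hw | hw
    · simp only [affInterp_of_nonpos hw, hl3]
      exact ⟨le_rfl, by positivity⟩
    have e1 := ceil_mul_sub_one_lt hN' hw
    have e2 := Nat.le_ceil ((N : ℝ) * w)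
    set s := N * w - ((⌈(N : ℝ) * w⌉₊ : ℝ) - 1) with hs
    rw [affInterp_eq hN', ← hs]
    exact convex_Icc 0 (2 * C) (hl2 _ t) (hl2 _ t) (a := 1 - s) (b := s) (by linarith)
      (by linarith) (by ring)
  · filter_upwards [hreg] with t ht w hw
    exact abs_pcInterp_le hN' ⟨hw.1, hw.2.le⟩ ht.bound
  · filter_upwards [hvelpc] with t ht w hw
    rw [affInterp_eq_integral hN' _ (Ioo_subset_Icc_self hw), hl3, zero_add,
      intervalIntegral.integral_of_le hw.1.le, intervalIntegral.integral_of_le hw.1.le]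
    exact setIntegral_congr_fun measurableSet_Ioc fun v hv => ht v ⟨hv.1, hv.2.trans hw.2.le⟩
  · filter_upwards [hreg, ae_restrict_mem measurableSet_Ioo] with t ht htm
    have e := pcInterp_monotoneOn hN'
      (a := fun i => (x i (timeClamp T t) - (i : ℝ) / N) / t - deriv (x i) t) fun i h1 hi => ?_
    · refine e.congr fun w hw => ?_
      simp only [clampedPos_eq hN' t hw]
      rfl
    · rw [timeClamp_of_mem (Ioo_subset_Icc_self htm)]
      have h2 := ht.oleinik i h1 hi
      have h3 : 0 ≤ (x (i + 1) t - x i t - t * (deriv (x (i + 1)) t - deriv (x i) t) -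
        1 / (N : ℝ)) / t := div_nonneg (by linarith) htm.1.le
      have h4 : (x (i + 1) t - x i t - t * (deriv (x (i + 1)) t - deriv (x i) t) -
          1 / (N : ℝ)) / t = ((x (i + 1) t - ((i + 1 : ℕ) : ℝ) / N) / t - deriv (x (i + 1)) t) -
          ((x i t - (i : ℝ) / N) / t - deriv (x i) t) := by
        have := htm.1.ne'
        push_cast
        field_simp
        ring
      linarith
  · filter_upwards [hvelpc] with t hv χ hχ
    exact horth (fun _ => 1) t hv (fun i _ _ => by rw [sub_self, mul_zero]) χ hχ
  · filter_upwards [hreg, hvelpc, ae_restrict_mem measurableSet_Ioo] with t ht hv htm χ hχ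
    refine Eq.trans (setIntegral_congr_fun measurableSet_Ioo fun w hw => ?_)
      (horth (fun i => x i (timeClamp T t) - (i : ℝ) / N) t hv (fun i h1 hi => ?_) χ hχ)
    · simp only [clampedPos_eq hN' t hw]
      rfl
    rw [timeClamp_of_mem (Ioo_subset_Icc_self htm), ← ht.mult_gap i h1 hi]
    push_cast
    ring
  · filter_upwards [hreg, hvelpc] with t ht hv χ hχ
    exact horth (fun i => deriv (x i) t) t hv ht.mult_vel χ hχ
  · filter_upwards [hreg, ae_restrict_mem measurableSet_Ioo] with t ht htm
    exact ht.exists_monotone_decomposition hN htm.1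
      (fun i h1 hi => hbd i h1 hi t (Ioo_subset_Icc_self htm))
      (h.nonoverlap t (Ioo_subset_Icc_self htm))

end Micro

/-! ### Compactness for monotone and Lipschitz functions -/

lemma exists_subseq_tendsto_of_countable {ι : Type*} [Countable ι] {f : ℕ → ι → ℝ} {C : ℝ}
    (h : ∀ k i, |f k i| ≤ C) :
    ∃ σ : ℕ → ℕ, StrictMono σ ∧ ∀ i, ∃ l, Tendsto (fun k => f (σ k) i) atTop (𝓝 l) := by
  obtain ⟨l, -, σ, hσ, hl⟩ :=
    (isCompact_univ_pi fun _ : ι => isCompact_Icc (a := -C) (b := C)).tendsto_subseq (x := f)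
      (fun k => fun i _ => abs_le.1 (h k i))
  exact ⟨σ, hσ, fun i => ⟨l i, (tendsto_pi_nhds.1 hl) i⟩⟩

lemma exists_tendsto_of_lipschitz_of_dense {A D : Set ℝ} (hDA : D ⊆ A) (hD : A ⊆ closure D) {L : ℝ}
    (hL : 0 ≤ L) {f : ℕ → ℝ → ℝ} (hf : ∀ k, ∀ x ∈ A, ∀ y ∈ A, |f k x - f k y| ≤ L * |x - y|)
    (h : ∀ d ∈ D, ∃ l, Tendsto (fun k => f k d) atTop (𝓝 l)) {x : ℝ} (hx : x ∈ A) :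
    ∃ l, Tendsto (fun k => f k x) atTop (𝓝 l) := by
  refine cauchySeq_tendsto_of_complete (Metric.cauchySeq_iff.2 fun ε hε => ?_)
  obtain ⟨d, hd, hxd⟩ := Metric.mem_closure_iff.1 (hD hx) (ε / (3 * (L + 1))) (by positivity)
  obtain ⟨l, hl⟩ := h d hd
  obtain ⟨n, hn⟩ := Metric.cauchySeq_iff.1 hl.cauchySeq (ε / 3) (by positivity)
  refine ⟨n, fun i hi j hj => ?_⟩
  have h1 : ∀ k, |f k x - f k d| < ε / 3 := fun k => by
    refine (hf k x hx d (hDA hd)).trans_lt ?_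
    rw [Real.dist_eq, lt_div_iff₀ (by positivity)] at hxd
    nlinarith [abs_nonneg (x - d)]
  have h2 := hn i hi j hj
  rw [Real.dist_eq] at h2 ⊢
  have h3 := abs_lt.1 (h1 i)
  have h4 := abs_lt.1 (h1 j)
  have h5 := abs_lt.1 h2
  exact abs_lt.2 ⟨by linarith, by linarith⟩

section Limsup

variable {u v d : ℕ → ℝ} {C l : ℝ}

lemma isBoundedUnder_le_of_abs_le (h : ∀ k, |u k| ≤ C) : IsBoundedUnder (· ≤ ·) atTop u :=
  isBoundedUnder_of ⟨C, fun k => (abs_le.1 (h k)).2⟩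

lemma isBoundedUnder_ge_of_abs_le (h : ∀ k, |u k| ≤ C) : IsBoundedUnder (· ≥ ·) atTop u :=
  isBoundedUnder_of ⟨-C, fun k => (abs_le.1 (h k)).1⟩

lemma limsup_le_limsup_add (hu : ∀ k, |u k| ≤ C) (hv : ∀ k, |v k| ≤ C)
    (hd : Tendsto d atTop (𝓝 l)) (h : ∀ k, u k ≤ v k + d k) :
    limsup u atTop ≤ limsup v atTop + l := by
  refine le_of_forall_pos_le_add fun ε hε => ?_
  refine limsup_le_of_le (isBoundedUnder_ge_of_abs_le hu).isCoboundedUnder_le ?_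
  have h1 := eventually_lt_of_limsup_lt (show limsup v atTop < limsup v atTop + ε / 2 by linarith)
    (isBoundedUnder_le_of_abs_le hv)
  have h2 := hd.eventually (gt_mem_nhds (show l < l + ε / 2 by linarith))
  filter_upwards [h1, h2] with k h3 h4
  linarith [h k]

lemma abs_limsup_le (hu : ∀ k, |u k| ≤ C) : |limsup u atTop| ≤ C := by
  refine abs_le.2 ⟨?_, ?_⟩
  · exact le_limsup_of_le (isBoundedUnder_le_of_abs_le hu) fun b hb => by
      obtain ⟨k, hk⟩ := hb.exists
      exact (abs_le.1 (hu k)).1.trans hk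
  · exact limsup_le_of_le (isBoundedUnder_ge_of_abs_le hu).isCoboundedUnder_le
      (Eventually.of_forall fun k => (abs_le.1 (hu k)).2)

lemma tendsto_limsup_of_exists (h : ∃ l, Tendsto u atTop (𝓝 l)) :
    Tendsto u atTop (𝓝 (limsup u atTop)) := by
  obtain ⟨l, hl⟩ := h
  rwa [hl.limsup_eq]

end Limsup

/-- Bounded monotone functions converge almost everywhere as soon as, between any two points, a
convergent sequence separates their values. -/
lemma ae_exists_tendsto_of_monotoneOn {F : ℕ → ℝ → ℝ} {a b C : ℝ}
    (hmono : ∀ k, MonotoneOn (F k) (Ioo a b)) (hC : ∀ k, ∀ w ∈ Ioo a b, |F k w| ≤ C)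
    (h : ∀ v ∈ Ioo a b, ∀ w ∈ Ioo a b, v < w → ∃ (c : ℕ → ℝ) (l : ℝ), Tendsto c atTop (𝓝 l) ∧
      ∀ k, F k v ≤ c k ∧ c k ≤ F k w) :
    ∀ᵐ w ∂(volume.restrict (Ioo a b)), ∃ l, Tendsto (fun k => F k w) atTop (𝓝 l) := by
  set H : ℝ → ℝ := fun w => limsup (fun k => F k w) atTop with hH
  have hHmono : MonotoneOn H (Ioo a b) := fun v hv w hw hvw => by
    have := limsup_le_limsup_add (fun k => hC k v hv) (fun k => hC k w hw)
      (tendsto_const_nhds (x := (0 : ℝ))) (fun k => by simpa using hmono k hv hw hvw)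
    simpa using this
  have hcount := hHmono.countable_not_continuousWithinAt
  have hnull := hcount.ae_notMem (volume.restrict (Ioo a b))
  filter_upwards [hnull, ae_restrict_mem measurableSet_Ioo] with w hw hmem
  have hcont : ContinuousWithinAt H (Ioo a b) w := by
    by_contra hcon
    exact hw ⟨hmem, hcon⟩
  have hcont' : ContinuousAt H w := hcont.continuousAt (isOpen_Ioo.mem_nhds hmem)
  refine ⟨H w, tendsto_of_le_liminf_of_limsup_le ?_ le_rfl
    (isBoundedUnder_le_of_abs_le fun k => hC k w hmem)
    (isBoundedUnder_ge_of_abs_le fun k => hC k w hmem)⟩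
  have hlt : ∀ v ∈ Ioo a w, H v ≤ liminf (fun k => F k w) atTop := by
    intro v hv
    have hv' : v ∈ Ioo a b := ⟨hv.1, hv.2.trans hmem.2⟩
    obtain ⟨c, l, hc, hle⟩ := h v hv' w hmem hv.2
    have h1 : H v ≤ l := by
      rw [← hc.limsup_eq]
      exact limsup_le_limsup (Eventually.of_forall fun k => (hle k).1)
        (isBoundedUnder_ge_of_abs_le fun k => hC k v hv').isCoboundedUnder_le
        hc.isBoundedUnder_le
    have h2 : l ≤ liminf (fun k => F k w) atTop := by
      rw [← hc.liminf_eq]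
      exact liminf_le_liminf (Eventually.of_forall fun k => (hle k).2)
        hc.isBoundedUnder_ge
        (isBoundedUnder_le_of_abs_le fun k => hC k w hmem).isCoboundedUnder_ge
    exact h1.trans h2
  refine le_of_tendsto (hcont'.tendsto.mono_left (nhdsWithin_le_nhds (s := Iio w))) ?_
  filter_upwards [Ioo_mem_nhdsLT hmem.1] with v hv using hlt v hv

lemma ae_exists_tendsto_of_monotoneOn_of_dense {F : ℕ → ℝ → ℝ} {a b C : ℝ} {D : Set ℝ}
    (hD : ∀ v w, a < v → v < w → w < b → ∃ d ∈ D, d ∈ Ioo v w)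
    (hmono : ∀ k, MonotoneOn (F k) (Ioo a b)) (hC : ∀ k, ∀ w ∈ Ioo a b, |F k w| ≤ C)
    (h : ∀ d ∈ D, d ∈ Ioo a b → ∃ l, Tendsto (fun k => F k d) atTop (𝓝 l)) :
    ∀ᵐ w ∂(volume.restrict (Ioo a b)), ∃ l, Tendsto (fun k => F k w) atTop (𝓝 l) := by
  refine ae_exists_tendsto_of_monotoneOn hmono hC fun v hv w hw hvw => ?_
  obtain ⟨d, hd, hvd⟩ := hD v w hv.1 hvw hw.2
  have hd' : d ∈ Ioo a b := ⟨hv.1.trans hvd.1, hvd.2.trans hw.2⟩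
  obtain ⟨l, hl⟩ := h d hd hd'
  exact ⟨fun k => F k d, l, hl, fun k => ⟨hmono k hv hd' hvd.1.le, hmono k hd' hw hvd.2.le⟩⟩

/-- Bounded monotone functions whose primitives converge on a set of full measure converge almost
everywhere, because difference quotients of the primitives separate the values. -/
lemma ae_exists_tendsto_of_monotoneOn_of_primitive {F Φ : ℕ → ℝ → ℝ} {a b C : ℝ}
    (hmono : ∀ k, MonotoneOn (F k) (Ioo a b)) (hC : ∀ k, ∀ w ∈ Ioo a b, |F k w| ≤ C)
    (hΦ : ∀ k, ∀ p ∈ Ioo a b, ∀ q ∈ Ioo a b, p ≤ q → Φ k q - Φ k p = ∫ s in p..q, F k s)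
    (h : ∀ᵐ w ∂(volume.restrict (Ioo a b)), ∃ l, Tendsto (fun k => Φ k w) atTop (𝓝 l)) :
    ∀ᵐ w ∂(volume.restrict (Ioo a b)), ∃ l, Tendsto (fun k => F k w) atTop (𝓝 l) := by
  refine ae_exists_tendsto_of_monotoneOn hmono hC fun v hv w hw hvw => ?_
  have hpick : ∀ s t, a < s → s < t → t < b → ∃ p ∈ Ioo s t, ∃ l,
      Tendsto (fun k => Φ k p) atTop (𝓝 l) := by
    intro s t hs hst ht
    have h1 : ∀ᵐ w ∂(volume.restrict (Ioo s t)), ∃ l, Tendsto (fun k => Φ k w) atTop (𝓝 l) :=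
      ae_restrict_of_ae_restrict_of_subset (Ioo_subset_Ioo hs.le ht.le) h
    have hne : (ae (volume.restrict (Ioo s t))).NeBot := by
      rw [ae_neBot, Ne, Measure.restrict_eq_zero, Real.volume_Ioo, ENNReal.ofReal_eq_zero]
      linarith
    obtain ⟨p, hp1, hp2⟩ := (h1.and (ae_restrict_mem measurableSet_Ioo)).exists
    exact ⟨p, hp2, hp1⟩
  obtain ⟨p, hp, lp, hlp⟩ := hpick v ((v + w) / 2) hv.1 (by linarith) (by linarith [hw.2])
  obtain ⟨q, hq, lq, hlq⟩ := hpick ((v + w) / 2) w (by linarith [hv.1]) (by linarith) hw.2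
  have hpq : p < q := hp.2.trans hq.1
  have hp' : p ∈ Ioo a b := ⟨hv.1.trans hp.1, by linarith [hp.2, hw.2]⟩
  have hq' : q ∈ Ioo a b := ⟨hp'.1.trans hpq, hq.2.trans hw.2⟩
  refine ⟨fun k => (Φ k q - Φ k p) / (q - p), _, (hlq.sub hlp).div_const _, fun k => ?_⟩
  have hsub : Icc p q ⊆ Ioo a b := fun s hs => ⟨hp'.1.trans_le hs.1, hs.2.trans_lt hq'.2⟩
  have hint : IntervalIntegrable (F k) volume p q :=
    ((hmono k).mono (by rwa [uIcc_of_le hpq.le])).intervalIntegrable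
  simp only
  rw [hΦ k p hp' q hq' hpq.le, le_div_iff₀ (by linarith), div_le_iff₀ (by linarith)]
  constructor
  · have := intervalIntegral.integral_mono_on hpq.le
      (intervalIntegrable_const (c := F k v)) hint
      fun s hs => hmono k hv (hsub hs) (hp.1.le.trans hs.1)
    rw [intervalIntegral.integral_const, smul_eq_mul] at this
    linarith
  · have := intervalIntegral.integral_mono_on hpq.le hint
      (intervalIntegrable_const (c := F k w))
      fun s hs => hmono k (hsub hs) hw (hs.2.trans hq.2.le)
    rw [intervalIntegral.integral_const, smul_eq_mul] at this
    linarith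

/-! ### Density of test functions -/

lemma exists_contDiff_approx {E : Type*} [NormedAddCommGroup E] [NormedSpace ℝ E]
    [FiniteDimensional ℝ E] {Ω : Set E} (hbd : Bornology.IsBounded Ω)
    {g : E → ℝ} (hg : Continuous g) (h0 : ∀ z, z ∉ Ω → g z = 0) {ε : ℝ} (hε : 0 < ε) :
    ∃ φ : E → ℝ, ContDiff ℝ ∞ φ ∧ HasCompactSupport φ ∧ tsupport φ ⊆ Ω ∧
      ∀ z, |φ z - g z| ≤ 4 * ε := by
  have hgs : HasCompactSupport g :=
    HasCompactSupport.intro hbd.isCompact_closure fun z hz => h0 z fun h => hz (subset_closure h)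
  obtain ⟨f, hf, hfg⟩ := (hgs.uniformContinuous_of_continuous hg).exists_contDiff_dist_le hε
  have hfg' : ∀ z, |f z - g z| < ε := fun z => by simpa [Real.dist_eq] using hfg z
  -- Small values are removed by a smooth cutoff of the values.
  set φ : E → ℝ := fun z => f z * Real.smoothTransition (f z ^ 2 / ε ^ 2 - 4) with hφ
  have hsupp : Function.support φ ⊆ {z | 2 * ε ≤ |f z|} := by
    intro z hz
    by_contra hlt
    simp only [mem_ofPred_eq, not_le] at hlt
    refine hz ?_
    have : f z ^ 2 / ε ^ 2 - 4 ≤ 0 := by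
      rw [sub_nonpos, div_le_iff₀ (by positivity), ← sq_abs (f z)]
      nlinarith [abs_nonneg (f z)]
    simp [hφ, Real.smoothTransition.zero_of_nonpos this]
  have hclosed : IsClosed {z | 2 * ε ≤ |f z|} := isClosed_le continuous_const hf.continuous.abs
  have htsupp : tsupport φ ⊆ {z | 2 * ε ≤ |f z|} := closure_minimal hsupp hclosed
  have hΩ : {z | 2 * ε ≤ |f z|} ⊆ Ω := by
    intro z hz
    by_contra hn
    have h1 := hfg' z
    rw [h0 z hn, sub_zero] at h1
    simp only [mem_ofPred_eq] at hz
    linarith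
  refine ⟨φ, ?_, ?_, htsupp.trans hΩ, fun z => ?_⟩
  · exact hf.mul (Real.smoothTransition.contDiff.comp
      (((hf.pow 2).div_const _).sub contDiff_const))
  · exact HasCompactSupport.intro hbd.isCompact_closure fun z hz => by
      by_contra hne
      exact hz (subset_closure (hΩ (hsupp hne)))
  · have h1 : |φ z - f z| ≤ 3 * ε := by
      have e1 : φ z - f z = -(f z * (1 - Real.smoothTransition (f z ^ 2 / ε ^ 2 - 4))) := by
        simp only [hφ]
        ring
      have e2 := Real.smoothTransition.nonneg (f z ^ 2 / ε ^ 2 - 4)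
      have e3 := Real.smoothTransition.le_one (f z ^ 2 / ε ^ 2 - 4)
      rw [e1, abs_neg, abs_mul, abs_of_nonneg (a := 1 - _) (by linarith)]
      by_cases hbig : 3 * ε ≤ |f z|
      · have : 1 ≤ f z ^ 2 / ε ^ 2 - 4 := by
          rw [le_sub_iff_add_le, le_div_iff₀ (by positivity), ← sq_abs (f z)]
          nlinarith
        rw [Real.smoothTransition.one_of_one_le this]
        simp [hε.le]
      · nlinarith [abs_nonneg (f z)]
    calc |φ z - g z| = |(φ z - f z) + (f z - g z)| := by ring_nf
      _ ≤ |φ z - f z| + |f z - g z| := abs_add_le _ _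
      _ ≤ 4 * ε := by linarith [hfg' z]

/-! ### Derivatives of monotone functions as push-forwards of the Lebesgue measure -/

/-- The generalized inverse of a monotone function `f` on `(a, b)`: the first time at which `f`
exceeds the level `r`, and `b` if there is none. -/
def levelTime (a b : ℝ) (f : ℝ → ℝ) (r : ℝ) : ℝ := sInf ({t | t ∈ Ioo a b ∧ r < f t} ∪ {b})

section LevelTime

variable {a b r B : ℝ} {f : ℝ → ℝ}

lemma levelTime_bddBelow (hab : a < b) (f : ℝ → ℝ) (r : ℝ) :
    BddBelow ({t | t ∈ Ioo a b ∧ r < f t} ∪ {b}) :=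
  ⟨a, by
    rintro t (ht | rfl)
    · exact ht.1.1.le
    · exact hab.le⟩

lemma levelTime_mem (hab : a < b) (f : ℝ → ℝ) (r : ℝ) : levelTime a b f r ∈ Icc a b := by
  refine ⟨le_csInf ⟨b, Or.inr rfl⟩ ?_, csInf_le (levelTime_bddBelow hab f r) (Or.inr rfl)⟩
  rintro t (ht | rfl)
  · exact ht.1.1.le
  · exact hab.le

lemma levelTime_lt_iff (hab : a < b) {c : ℝ} :
    levelTime a b f r < c ↔ b < c ∨ ∃ t ∈ Ioo a b, r < f t ∧ t < c := by
  rw [levelTime, csInf_lt_iff (levelTime_bddBelow hab f r) ⟨b, Or.inr rfl⟩]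
  constructor
  · rintro ⟨t, ht | rfl, htc⟩
    · exact Or.inr ⟨t, ht.1, ht.2, htc⟩
    · exact Or.inl htc
  · rintro (h | ⟨t, ht, hr, htc⟩)
    · exact ⟨b, Or.inr rfl, h⟩
    · exact ⟨t, Or.inl ⟨ht, hr⟩, htc⟩

lemma levelTime_le (hab : a < b) {t : ℝ} (ht : t ∈ Ioo a b) (hr : r < f t) :
    levelTime a b f r ≤ t :=
  csInf_le (levelTime_bddBelow hab f r) (Or.inl ⟨ht, hr⟩)

lemma lt_of_levelTime_lt (hab : a < b) (hf : Monotone f) {t : ℝ} (ht : t ∈ Ioo a b)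
    (h : levelTime a b f r < t) : r < f t := by
  rcases (levelTime_lt_iff hab).1 h with h | ⟨s, -, hrs, hst⟩
  · exact absurd h (not_lt.2 ht.2.le)
  · exact hrs.trans_le (hf hst.le)

/-- By the layer cake formula, the push-forward of the Lebesgue measure under the generalized
inverse of `f` is the distributional derivative of `f`. -/
lemma integral_comp_levelTime (hab : a < b) (hf : Monotone f) (hB : ∀ t ∈ Ioo a b, |f t| ≤ B)
    {ψ ψ' : ℝ → ℝ} (hψ' : IntegrableOn ψ' (Ioo a b))
    (hψ : ∀ s ∈ Icc a b, ψ s = -∫ t in s..b, ψ' t) (hψa : ψ a = 0) :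
    ∫ r in Ioc (-B) B, ψ (levelTime a b f r) = -∫ t in Ioo a b, f t * ψ' t := by
  have h1 : ∀ r, ψ (levelTime a b f r) =
      -∫ t in Ioo a b, {t | r < f t}.indicator ψ' t := by
    intro r
    have hτ := levelTime_mem hab f r
    rw [hψ _ hτ, intervalIntegral.integral_of_le hτ.2,
      setIntegral_indicator (measurableSet_lt measurable_const hf.measurable)]
    congr 1
    refine setIntegral_congr_set ?_
    have n1 : ∀ᵐ t : ℝ, t ≠ levelTime a b f r := by simp [ae_iff]
    have n2 : ∀ᵐ t : ℝ, t ≠ b := by simp [ae_iff]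
    filter_upwards [n1, n2] with t ht1 ht2
    refine propext ⟨fun ht => ?_, fun ht => ?_⟩
    · have hmem : t ∈ Ioo a b := ⟨hτ.1.trans_lt ht.1, lt_of_le_of_ne ht.2 ht2⟩
      exact ⟨hmem, lt_of_levelTime_lt hab hf hmem ht.1⟩
    · exact ⟨lt_of_le_of_ne (levelTime_le hab ht.1 ht.2) (Ne.symm ht1), ht.1.2.le⟩
  have hmeas : MeasurableSet {z : ℝ × ℝ | z.1 < f z.2} :=
    measurableSet_lt measurable_fst (hf.measurable.comp measurable_snd)
  have hint : Integrable (Function.uncurry fun r t => {t | r < f t}.indicator ψ' t)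
      ((volume.restrict (Ioc (-B) B)).prod (volume.restrict (Ioo a b))) := by
    have e : (Function.uncurry fun r t => {t | r < f t}.indicator ψ' t) =
        {z : ℝ × ℝ | z.1 < f z.2}.indicator fun z => ψ' z.2 := by
      funext z
      rfl
    rw [e]
    exact (Integrable.comp_snd hψ' _).indicator hmeas
  have hBB : ∀ t ∈ Ioo a b, ∫ r in Ioc (-B) B, {t | r < f t}.indicator ψ' t = (f t + B) * ψ' t := by
    intro t ht
    have hft := abs_le.1 (hB t ht)
    have e : (fun r => {t | r < f t}.indicator ψ' t) = (Iio (f t)).indicator fun _ => ψ' t := by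
      funext r
      simp only [indicator, mem_ofPred_eq, mem_Iio]
    have hset : Ioc (-B) B ∩ Iio (f t) = Ioo (-B) (f t) := by
      ext r
      constructor
      · rintro ⟨h1, h2⟩
        exact ⟨h1.1, h2⟩
      · rintro ⟨h1, h2⟩
        exact ⟨⟨h1, h2.le.trans hft.2⟩, h2⟩
    rw [e, setIntegral_indicator measurableSet_Iio, hset, setIntegral_const, smul_eq_mul,
      Real.volume_real_Ioo_of_le hft.1]
    ring
  simp_rw [h1]
  rw [integral_neg, integral_integral_swap hint, setIntegral_congr_fun measurableSet_Ioo hBB]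
  have h0 : ∫ t in Ioo a b, ψ' t = 0 := by
    have := hψ a (left_mem_Icc.2 hab.le)
    rw [hψa, intervalIntegral.integral_of_le hab.le, integral_Ioc_eq_integral_Ioo] at this
    linarith
  have hfint : IntegrableOn (fun t => f t * ψ' t) (Ioo a b) :=
    Integrable.bdd_mul (c := B) hψ' hf.measurable.aestronglyMeasurable
      ((ae_restrict_iff' measurableSet_Ioo).2 (Eventually.of_forall hB))
  have e : ∀ t, (f t + B) * ψ' t = f t * ψ' t + B * ψ' t := fun t => by ring
  simp_rw [e]
  rw [integral_add hfint (hψ'.const_mul B), integral_const_mul, h0, mul_zero, add_zero]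

lemma monotone_levelTime (hab : a < b) (f : ℝ → ℝ) : Monotone (levelTime a b f) := by
  intro r s hrs
  refine le_csInf ⟨b, Or.inr rfl⟩ ?_
  rintro t (ht | rfl)
  · exact levelTime_le hab ht.1 (hrs.trans_lt ht.2)
  · exact (levelTime_mem hab f r).2

end LevelTime

section TimeDerivative

variable {T B : ℝ} {l : ℝ → ℝ → ℝ}

/-- The map whose push-forward of the Lebesgue measure is the distributional derivative `∂_t l`. -/
def levelMap (T : ℝ) (l : ℝ → ℝ → ℝ) (z : ℝ × ℝ) : ℝ × ℝ :=
  (levelTime 0 T (fun t => l t z.2) z.1, z.2)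

/-- The measure `∂_t l` on `(0,T) × (0,1)`, for a function `l` with `|l| ≤ B` that is nondecreasing
in `t`. -/
def timeDerivMeasure (T B : ℝ) (l : ℝ → ℝ → ℝ) : Measure (ℝ × ℝ) :=
  (Measure.map (levelMap T l)
    ((volume.restrict (Ioc (-B) B)).prod (volume.restrict (Ioo 0 1)))).restrict (dom T)

lemma measurableSet_dom (T : ℝ) : MeasurableSet (dom T) := measurableSet_Ioo.prod measurableSet_Ioo

lemma measurable_levelMap (hT : 0 < T) (hl : Measurable fun z : ℝ × ℝ => l z.1 z.2)
    (hmono : ∀ w, Monotone fun t => l t w) : Measurable (levelMap T l) := by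
  refine Measurable.prodMk (measurable_of_Iio fun c => ?_) measurable_snd
  have hset : (fun z : ℝ × ℝ => levelTime 0 T (fun t => l t z.2) z.1) ⁻¹' Iio c =
      {_z | T < c} ∪ ⋃ q : ℚ, {z | (q : ℝ) ∈ Ioo 0 T ∧ (q : ℝ) < c ∧ z.1 < l q z.2} := by
    ext z
    simp only [mem_preimage, mem_Iio, levelTime_lt_iff hT, mem_union, mem_ofPred_eq, mem_iUnion]
    refine or_congr_right ⟨?_, ?_⟩
    · rintro ⟨t, ht, hr, htc⟩
      obtain ⟨q, hq1, hq2⟩ := exists_rat_btwn (lt_min ht.2 htc)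
      exact ⟨q, ⟨ht.1.trans hq1, hq2.trans_le (min_le_left _ _)⟩, hq2.trans_le (min_le_right _ _),
        hr.trans_le (hmono z.2 hq1.le)⟩
    · rintro ⟨q, hq, hqc, hr⟩
      exact ⟨q, hq, hr, hqc⟩
  rw [hset]
  refine (MeasurableSet.const _).union (MeasurableSet.iUnion fun q => ?_)
  have : Measurable fun z : ℝ × ℝ => l q z.2 :=
    hl.comp (measurable_const.prodMk measurable_snd)
  exact (MeasurableSet.const _).inter
    ((MeasurableSet.const _).inter (measurableSet_lt measurable_fst this))

lemma timeDerivMeasure_univ_le (hT : 0 < T) (hl : Measurable fun z : ℝ × ℝ => l z.1 z.2)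
    (hmono : ∀ w, Monotone fun t => l t w) :
    timeDerivMeasure T B l univ ≤ ENNReal.ofReal (2 * B) := by
  refine (Measure.restrict_apply_le _ _).trans ?_
  rw [Measure.map_apply (measurable_levelMap hT hl hmono) MeasurableSet.univ, preimage_univ,
    ← univ_prod_univ, Measure.prod_prod]
  simp only [Measure.restrict_apply_univ, Real.volume_Ioc, Real.volume_Ioo, sub_zero,
    ENNReal.ofReal_one, mul_one]
  exact ENNReal.ofReal_le_ofReal (by linarith)

lemma isPosMeasure_timeDerivMeasure (hT : 0 < T) (hl : Measurable fun z : ℝ × ℝ => l z.1 z.2)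
    (hmono : ∀ w, Monotone fun t => l t w) : IsPosMeasure T (timeDerivMeasure T B l) := by
  refine ⟨⟨(timeDerivMeasure_univ_le hT hl hmono).trans_lt ENNReal.ofReal_lt_top⟩, ?_⟩
  rw [timeDerivMeasure, Measure.restrict_apply (measurableSet_dom T).compl]
  simp

/-- The measure `∂_t l` is absolutely continuous in `w`. -/
lemma timeDerivMeasure_line (hT : 0 < T) (hl : Measurable fun z : ℝ × ℝ => l z.1 z.2)
    (hmono : ∀ w, Monotone fun t => l t w) (w : ℝ) :
    timeDerivMeasure T B l (univ ×ˢ {w}) = 0 := by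
  refine le_antisymm ((Measure.restrict_apply_le _ _).trans ?_) zero_le
  rw [Measure.map_apply (measurable_levelMap hT hl hmono)
    (MeasurableSet.univ.prod (measurableSet_singleton w))]
  have : levelMap T l ⁻¹' (univ ×ˢ {w}) = univ ×ˢ {w} := by
    ext z
    simp [levelMap]
  rw [this, Measure.prod_prod]
  have h0 : (volume.restrict (Ioo (0 : ℝ) 1)) {w} = 0 :=
    le_antisymm ((Measure.restrict_apply_le _ _).trans (by simp)) zero_le
  rw [h0, mul_zero]

/-- Integration by parts in time against `∂_t l`, for functions that are absolutely continuous in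
time. -/
lemma integral_timeDerivMeasure (hT : 0 < T) (hl : Measurable fun z : ℝ × ℝ => l z.1 z.2)
    (hmono : ∀ w, Monotone fun t => l t w) (hB : ∀ t w, |l t w| ≤ B) {ψ : ℝ × ℝ → ℝ}
    (hψ : Measurable ψ) {M : ℝ} (hM : ∀ z, |ψ z| ≤ M) (h0 : ∀ z, z ∉ dom T → ψ z = 0)
    {ψ' : ℝ → ℝ → ℝ}
    (hψ' : ∀ᵐ w ∂(volume.restrict (Ioo (0 : ℝ) 1)), IntegrableOn (fun t => ψ' t w) (Ioo 0 T) ∧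
      ∀ s ∈ Icc 0 T, ψ (s, w) = -∫ t in s..T, ψ' t w) :
    ∫ z, ψ z ∂(timeDerivMeasure T B l) =
      -∫ w in Ioo (0 : ℝ) 1, ∫ t in Ioo 0 T, l t w * ψ' t w := by
  have hm := measurable_levelMap hT hl hmono
  rw [timeDerivMeasure, setIntegral_eq_integral_of_forall_compl_eq_zero h0,
    integral_map hm.aemeasurable hψ.aestronglyMeasurable]
  have hint : Integrable (fun z => ψ (levelMap T l z))
      ((volume.restrict (Ioc (-B) B)).prod (volume.restrict (Ioo 0 1))) :=
    Integrable.of_bound (hψ.comp hm).aestronglyMeasurable M (Eventually.of_forall fun z => hM _)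
  rw [integral_prod_symm _ hint, ← integral_neg]
  refine integral_congr_ae ?_
  filter_upwards [hψ'] with w hw
  exact integral_comp_levelTime hT (hmono w) (fun t _ => hB t w) (ψ := fun s => ψ (s, w)) hw.1 hw.2
    (h0 _ fun h => lt_irrefl _ h.1.1)

end TimeDerivative

/-! ### Functions of bounded variation on `(0,1)` -/

/-- The `C¹` functions with compact support in `(0,1)`. -/
structure IsTestI (φ : ℝ → ℝ) : Prop where
  contDiff : ContDiff ℝ 1 φ
  compact : HasCompactSupport φ
  support : tsupport φ ⊆ Ioo 0 1

lemma IsTestI.eq_zero {φ : ℝ → ℝ} (h : IsTestI φ) {w : ℝ} (hw : w ∉ Ioo (0 : ℝ) 1) : φ w = 0 :=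
  image_eq_zero_of_notMem_tsupport fun h' => hw (h.support h')

lemma IsTestI.continuous_deriv {φ : ℝ → ℝ} (h : IsTestI φ) : Continuous (deriv φ) :=
  h.contDiff.continuous_deriv le_rfl

lemma IsTestI.exists_bound {φ : ℝ → ℝ} (h : IsTestI φ) : ∃ M, ∀ w, |φ w| ≤ M :=
  h.compact.exists_bound_of_continuous h.contDiff.continuous

lemma IsTestI.exists_bound_deriv {φ : ℝ → ℝ} (h : IsTestI φ) : ∃ M, ∀ w, |deriv φ w| ≤ M :=
  h.compact.deriv.exists_bound_of_continuous h.continuous_deriv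

lemma continuous_extend_zeroAtInfty (g : C₀(Ioo (0 : ℝ) 1, ℝ)) :
    Continuous (Function.extend Subtype.val g (0 : ℝ → ℝ)) := by
  rw [continuous_iff_continuousAt]
  intro z
  by_cases hz : z ∈ Ioo (0 : ℝ) 1
  · have hval : Topology.IsOpenEmbedding (Subtype.val : Ioo (0 : ℝ) 1 → ℝ) :=
      isOpen_Ioo.isOpenEmbedding_subtypeVal
    rw [← hval.continuousAt_iff (x := ⟨z, hz⟩)]
    have : Function.extend Subtype.val g (0 : ℝ → ℝ) ∘ Subtype.val = g :=
      Function.extend_comp Subtype.val_injective _ _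
    rw [this]
    exact g.continuous.continuousAt
  · have h0 : ∀ y, y ∉ Ioo (0 : ℝ) 1 → Function.extend Subtype.val g (0 : ℝ → ℝ) y = 0 := by
      intro y hy
      rw [Function.extend_apply']
      · rfl
      · rintro ⟨a, rfl⟩
        exact hy a.2
    rw [ContinuousAt, h0 z hz, Metric.tendsto_nhds]
    intro ε hε
    have h1 := (Metric.tendsto_nhds.1 g.zero_at_infty') ε hε
    obtain ⟨K, hK, hKs⟩ := mem_cocompact.1 h1
    have hK' : IsCompact (Subtype.val '' K) := hK.image continuous_subtype_val
    have hzK : z ∈ (Subtype.val '' K)ᶜ := by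
      rintro ⟨a, -, rfl⟩
      exact hz a.2
    filter_upwards [hK'.isClosed.isOpen_compl.mem_nhds hzK] with y hy
    by_cases hyI : y ∈ Ioo (0 : ℝ) 1
    · have hy' : (⟨y, hyI⟩ : Ioo (0 : ℝ) 1) ∈ Kᶜ := fun h => hy ⟨_, h, rfl⟩
      have e : Function.extend Subtype.val g (0 : ℝ → ℝ) y = g ⟨y, hyI⟩ :=
        Subtype.val_injective.extend_apply (g := g) _ (⟨y, hyI⟩ : Ioo (0 : ℝ) 1)
      rw [e]
      exact hKs hy'
    · rw [h0 y hyI]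
      simpa using hε

lemma exists_isTestI_approx (g : C₀(Ioo (0 : ℝ) 1, ℝ)) {ε : ℝ} (hε : 0 < ε) :
    ∃ φ, IsTestI φ ∧ ∀ w : Ioo (0 : ℝ) 1, |φ w - g w| ≤ ε := by
  obtain ⟨φ, h1, h2, h3, h4⟩ := exists_contDiff_approx (Metric.isBounded_Ioo (0 : ℝ) 1)
    (continuous_extend_zeroAtInfty g) (fun z hz => by
      rw [Function.extend_apply']
      · rfl
      · rintro ⟨a, rfl⟩
        exact hz a.2) (show 0 < ε / 4 by linarith)
  refine ⟨φ, ⟨h1.of_le (by simp), h2, h3⟩, fun w => ?_⟩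
  have := h4 w
  rw [Subtype.val_injective.extend_apply] at this
  linarith

lemma integrable_zeroAtInfty (μ : Measure (Ioo (0 : ℝ) 1)) [IsFiniteMeasure μ]
    (g : C₀(Ioo (0 : ℝ) 1, ℝ)) : Integrable g μ :=
  Integrable.of_bound g.continuous.aestronglyMeasurable ‖g‖
    (Eventually.of_forall fun w => g.toBCF.norm_coe_le_norm w)

lemma IsTestI.integrable {φ : ℝ → ℝ} (h : IsTestI φ) (μ : Measure (Ioo (0 : ℝ) 1))
    [IsFiniteMeasure μ] : Integrable (fun w : Ioo (0 : ℝ) 1 => φ w) μ := by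
  obtain ⟨M, hM⟩ := h.exists_bound
  exact Integrable.of_bound (h.contDiff.continuous.comp continuous_subtype_val).aestronglyMeasurable
    M (Eventually.of_forall fun w => hM w)

lemma abs_integral_sub_le (μ : Measure (Ioo (0 : ℝ) 1)) [IsFiniteMeasure μ]
    {f g : Ioo (0 : ℝ) 1 → ℝ} (hf : Integrable f μ) (hg : Integrable g μ) {ε : ℝ}
    (h : ∀ w, |f w - g w| ≤ ε) : |∫ w, f w ∂μ - ∫ w, g w ∂μ| ≤ ε * μ.real univ := by
  rw [← integral_sub hf hg]
  exact norm_integral_le_of_norm_le_const (f := fun w => f w - g w) (Eventually.of_forall h)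

/-- Finite measures on `(0,1)` are determined by their integrals of test functions. -/
lemma measure_ext_of_isTestI {μ ν : Measure (Ioo (0 : ℝ) 1)} [IsFiniteMeasure μ] [IsFiniteMeasure ν]
    (h : ∀ φ, IsTestI φ → ∫ w : Ioo (0 : ℝ) 1, φ w ∂μ = ∫ w : Ioo (0 : ℝ) 1, φ w ∂ν) : μ = ν := by
  have : LocallyCompactSpace (Ioo (0 : ℝ) 1) := isOpen_Ioo.locallyCompactSpace
  refine Measure.ext_of_integral_eq_on_compactlySupported fun f => ?_
  set g : C₀(Ioo (0 : ℝ) 1, ℝ) := ⟨f.toContinuousMap, zero_at_infty f⟩ with hg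
  change ∫ w, g w ∂μ = ∫ w, g w ∂ν
  refine eq_of_abs_sub_nonpos (le_of_forall_pos_le_add fun ε hε => ?_)
  set K := μ.real univ + ν.real univ + 1 with hK
  have hK0 : 0 < K := by positivity
  obtain ⟨φ, hφ, hφg⟩ := exists_isTestI_approx g (show 0 < ε / K by positivity)
  have h1 := abs_integral_sub_le μ (hφ.integrable μ) (integrable_zeroAtInfty μ g) hφg
  have h2 := abs_integral_sub_le ν (hφ.integrable ν) (integrable_zeroAtInfty ν g) hφg
  rw [h φ hφ] at h1
  have h3 : ε / K * μ.real univ + ε / K * ν.real univ ≤ ε := by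
    rw [← mul_add, div_mul_eq_mul_div, div_le_iff₀ hK0]
    nlinarith
  rw [zero_add]
  have h4 := abs_le.1 h1
  have h5 := abs_le.1 h2
  exact abs_le.2 ⟨by linarith, by linarith⟩

section Pairing

variable {ν₁ ν₂ : Measure (Ioo (0 : ℝ) 1)} [IsFiniteMeasure ν₁] [IsFiniteMeasure ν₂]
  {m : SignedMeasure (Ioo (0 : ℝ) 1)}

lemma posPart_add_eq_negPart_add (hm : m = ν₁.toSignedMeasure - ν₂.toSignedMeasure) :
    m.toJordanDecomposition.posPart + ν₂ = m.toJordanDecomposition.negPart + ν₁ := by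
  have hJ := m.toSignedMeasure_toJordanDecomposition
  ext A hA
  have h1 : m A = m.toJordanDecomposition.posPart.real A -
      m.toJordanDecomposition.negPart.real A := by
    conv_lhs => rw [← hJ]
    rw [JordanDecomposition.toSignedMeasure, _root_.sub_apply,
      Measure.toSignedMeasure_apply_measurable hA, Measure.toSignedMeasure_apply_measurable hA]
  have h2 : m A = ν₁.real A - ν₂.real A := by
    rw [hm, _root_.sub_apply,
      Measure.toSignedMeasure_apply_measurable hA, Measure.toSignedMeasure_apply_measurable hA]
  have h3 : (m.toJordanDecomposition.posPart + ν₂).real A =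
      (m.toJordanDecomposition.negPart + ν₁).real A := by
    rw [measureReal_add_apply, measureReal_add_apply]
    linarith
  exact (measureReal_eq_measureReal_iff).1 h3

lemma pairing_eq (hm : m = ν₁.toSignedMeasure - ν₂.toSignedMeasure) {g : Ioo (0 : ℝ) 1 → ℝ}
    (hg : ∀ (μ : Measure (Ioo (0 : ℝ) 1)) [IsFiniteMeasure μ], Integrable g μ) :
    pairing m g = ∫ w, g w ∂ν₁ - ∫ w, g w ∂ν₂ := by
  have h := congrArg (fun μ => ∫ w, g w ∂μ) (posPart_add_eq_negPart_add hm)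
  rw [integral_add_measure (hg _) (hg _), integral_add_measure (hg _) (hg _)] at h
  simp only [pairing]
  linarith

lemma totalVariation_univ_le (hm : m = ν₁.toSignedMeasure - ν₂.toSignedMeasure) :
    m.totalVariation univ ≤ ν₁ univ + ν₂ univ := by
  have h := posPart_add_eq_negPart_add hm
  obtain ⟨S, hS, h1, h2⟩ := m.toJordanDecomposition.mutuallySingular
  have e1 : m.toJordanDecomposition.posPart univ ≤ ν₁ Sᶜ := by
    calc m.toJordanDecomposition.posPart univ
        = m.toJordanDecomposition.posPart S + m.toJordanDecomposition.posPart Sᶜ :=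
          (measure_add_measure_compl hS).symm
      _ ≤ (m.toJordanDecomposition.posPart + ν₂) Sᶜ := by
          rw [h1, zero_add, Measure.add_apply]
          exact le_self_add
      _ = ν₁ Sᶜ := by rw [h, Measure.add_apply, h2, zero_add]
  have e2 : m.toJordanDecomposition.negPart univ ≤ ν₂ S := by
    calc m.toJordanDecomposition.negPart univ
        = m.toJordanDecomposition.negPart S + m.toJordanDecomposition.negPart Sᶜ :=
          (measure_add_measure_compl hS).symm
      _ ≤ (m.toJordanDecomposition.negPart + ν₁) S := by
          rw [h2, add_zero, Measure.add_apply]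
          exact le_self_add
      _ = ν₂ S := by rw [← h, Measure.add_apply, h1, zero_add]
  rw [SignedMeasure.totalVariation, Measure.add_apply]
  exact add_le_add (e1.trans (measure_mono (subset_univ _)))
    (e2.trans (measure_mono (subset_univ _)))

end Pairing

lemma abs_pairing_sub_le (m : SignedMeasure (Ioo (0 : ℝ) 1)) {f g : Ioo (0 : ℝ) 1 → ℝ}
    (hf : ∀ (μ : Measure (Ioo (0 : ℝ) 1)) [IsFiniteMeasure μ], Integrable f μ)
    (hg : ∀ (μ : Measure (Ioo (0 : ℝ) 1)) [IsFiniteMeasure μ], Integrable g μ) {ε : ℝ}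
    (h : ∀ w, |f w - g w| ≤ ε) :
    |pairing m f - pairing m g| ≤ ε * (m.totalVariation univ).toReal := by
  have h1 := abs_le.1 (abs_integral_sub_le m.toJordanDecomposition.posPart (hf _) (hg _) h)
  have h2 := abs_le.1 (abs_integral_sub_le m.toJordanDecomposition.negPart (hf _) (hg _) h)
  have h3 : (m.totalVariation univ).toReal = m.toJordanDecomposition.posPart.real univ +
      m.toJordanDecomposition.negPart.real univ := by
    rw [SignedMeasure.totalVariation, Measure.add_apply, ENNReal.toReal_add (measure_ne_top _ _)
      (measure_ne_top _ _)]
    rfl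
  rw [h3]
  simp only [pairing]
  exact abs_le.2 ⟨by linarith, by linarith⟩

/-- The distributional derivative is unique. -/
lemma HasDerivMeasure.unique {u : ℝ → ℝ} {m m' : SignedMeasure (Ioo (0 : ℝ) 1)}
    (h : HasDerivMeasure u m) (h' : HasDerivMeasure u m') : m = m' := by
  set j := m.toJordanDecomposition
  set j' := m'.toJordanDecomposition
  have key : j.posPart + j'.negPart = j'.posPart + j.negPart := by
    refine measure_ext_of_isTestI fun φ hφ => ?_
    have e1 := h.2 φ hφ.contDiff hφ.compact hφ.support
    have e2 := h'.2 φ hφ.contDiff hφ.compact hφ.support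
    rw [integral_add_measure (hφ.integrable _) (hφ.integrable _),
      integral_add_measure (hφ.integrable _) (hφ.integrable _)]
    have e3 : pairing m (fun w => φ w) = pairing m' (fun w => φ w) := by linarith
    simp only [pairing] at e3
    linarith
  ext A hA
  rw [← m.toSignedMeasure_toJordanDecomposition, ← m'.toSignedMeasure_toJordanDecomposition,
    JordanDecomposition.toSignedMeasure, JordanDecomposition.toSignedMeasure,
    _root_.sub_apply, _root_.sub_apply,
    Measure.toSignedMeasure_apply_measurable hA, Measure.toSignedMeasure_apply_measurable hA,
    Measure.toSignedMeasure_apply_measurable hA, Measure.toSignedMeasure_apply_measurable hA]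
  have : (j.posPart + j'.negPart).real A = (j'.posPart + j.negPart).real A := by rw [key]
  rw [measureReal_add_apply, measureReal_add_apply] at this
  linarith

lemma IsBV.hasDerivMeasure {u : ℝ → ℝ} (h : IsBV u) : HasDerivMeasure u (derivMeasure u) := by
  rw [derivMeasure, dif_pos h]
  exact h.choose_spec

lemma HasDerivMeasure.derivMeasure_eq {u : ℝ → ℝ} {m : SignedMeasure (Ioo (0 : ℝ) 1)}
    (h : HasDerivMeasure u m) : derivMeasure u = m :=
  (IsBV.hasDerivMeasure ⟨m, h⟩).unique h

lemma integrableOn_of_monotoneOn {f : ℝ → ℝ} (hf : MonotoneOn f (Ioo 0 1)) {B : ℝ}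
    (hB : ∀ w ∈ Ioo (0 : ℝ) 1, |f w| ≤ B) : IntegrableOn f (Ioo 0 1) :=
  Integrable.of_bound
    (aemeasurable_restrict_of_monotoneOn measurableSet_Ioo hf).aestronglyMeasurable B
    ((ae_restrict_iff' measurableSet_Ioo).2 (Eventually.of_forall hB))

/-- The distributional derivative of a bounded monotone function is a finite measure. -/
lemma exists_derivMeasure_of_monotoneOn {f : ℝ → ℝ} (hf : MonotoneOn f (Ioo 0 1)) {B : ℝ}
    (hB : ∀ w ∈ Ioo (0 : ℝ) 1, |f w| ≤ B) :
    ∃ ν : Measure (Ioo (0 : ℝ) 1), IsFiniteMeasure ν ∧ ν univ ≤ ENNReal.ofReal (2 * B) ∧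
      ∀ φ, IsTestI φ → ∫ w in Ioo (0 : ℝ) 1, f w * deriv φ w = -∫ w : Ioo (0 : ℝ) 1, φ w ∂ν := by
  obtain ⟨g, hg, hfg⟩ := hf.exists_monotone_extension
    ⟨-B, by rintro _ ⟨t, ht, rfl⟩; exact (abs_le.1 (hB t ht)).1⟩
    ⟨B, by rintro _ ⟨t, ht, rfl⟩; exact (abs_le.1 (hB t ht)).2⟩
  have hgB : ∀ w ∈ Ioo (0 : ℝ) 1, |g w| ≤ B := fun w hw => by rw [← hfg hw]; exact hB w hw
  have hm : Measurable (levelTime 0 1 g) := (monotone_levelTime one_pos g).measurable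
  set μ := Measure.map (levelTime 0 1 g) (volume.restrict (Ioc (-B) B)) with hμ
  have hν : (Measure.comap (Subtype.val : Ioo (0 : ℝ) 1 → ℝ) μ) univ ≤ ENNReal.ofReal (2 * B) := by
    rw [(MeasurableEmbedding.subtype_coe measurableSet_Ioo).comap_apply]
    refine (measure_mono (subset_univ _)).trans ?_
    rw [hμ, Measure.map_apply hm MeasurableSet.univ, preimage_univ, Measure.restrict_apply_univ,
      Real.volume_Ioc]
    exact ENNReal.ofReal_le_ofReal (by linarith)
  refine ⟨Measure.comap Subtype.val μ, ⟨hν.trans_lt ENNReal.ofReal_lt_top⟩, hν, fun φ hφ => ?_⟩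
  rw [integral_subtype_comap measurableSet_Ioo,
    setIntegral_eq_integral_of_forall_compl_eq_zero fun w hw => hφ.eq_zero hw, hμ,
    integral_map hm.aemeasurable hφ.contDiff.continuous.aestronglyMeasurable,
    integral_comp_levelTime (ψ' := deriv φ) one_pos hg hgB
      (hφ.continuous_deriv.integrableOn_Icc.mono_set Ioo_subset_Icc_self) (fun s _ => ?_)
      (hφ.eq_zero fun h => lt_irrefl _ h.1), neg_neg]
  · exact setIntegral_congr_fun measurableSet_Ioo fun w hw => by rw [hfg hw]
  · rw [intervalIntegral.integral_deriv_eq_sub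
      (fun w _ => (hφ.contDiff.differentiable one_ne_zero) w)
      (hφ.continuous_deriv.intervalIntegrable _ _), hφ.eq_zero (w := 1) fun h => lt_irrefl _ h.2]
    ring

lemma integral_mul_deriv_nonpos_of_monotoneOn {f : ℝ → ℝ} (hf : MonotoneOn f (Ioo 0 1)) {B : ℝ}
    (hB : ∀ w ∈ Ioo (0 : ℝ) 1, |f w| ≤ B) {φ : ℝ → ℝ} (hφ : IsTestI φ) (h0 : ∀ w, 0 ≤ φ w) :
    ∫ w in Ioo (0 : ℝ) 1, f w * deriv φ w ≤ 0 := by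
  obtain ⟨ν, -, -, hν⟩ := exists_derivMeasure_of_monotoneOn hf hB
  rw [hν φ hφ, neg_nonpos]
  exact integral_nonneg fun w => h0 w

/-- A difference of bounded monotone functions has bounded variation. -/
lemma isBV_of_ae_eq_sub {u f g : ℝ → ℝ} {A B : ℝ} (hA : 0 ≤ A) (hf : MonotoneOn f (Ioo 0 1))
    (hg : MonotoneOn g (Ioo 0 1)) (hfA : ∀ w ∈ Ioo (0 : ℝ) 1, |f w| ≤ A)
    (hgB : ∀ w ∈ Ioo (0 : ℝ) 1, |g w| ≤ B)
    (hu : ∀ᵐ w ∂(volume.restrict (Ioo 0 1)), u w = f w - g w) :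
    IsBV u ∧ ((derivMeasure u).totalVariation univ).toReal ≤ 2 * A + 2 * B := by
  have hB : 0 ≤ B := (abs_nonneg _).trans (hgB (1 / 2) ⟨by norm_num, by norm_num⟩)
  obtain ⟨ν₁, _, h1, h1'⟩ := exists_derivMeasure_of_monotoneOn hf hfA
  obtain ⟨ν₂, _, h2, h2'⟩ := exists_derivMeasure_of_monotoneOn hg hgB
  have hfi := integrableOn_of_monotoneOn hf hfA
  have hgi := integrableOn_of_monotoneOn hg hgB
  have hd : HasDerivMeasure u (ν₁.toSignedMeasure - ν₂.toSignedMeasure) := by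
    refine ⟨(hfi.sub hgi).congr (by filter_upwards [hu] with w hw using hw.symm),
      fun φ a1 a2 a3 => ?_⟩
    have hφ : IsTestI φ := ⟨a1, a2, a3⟩
    obtain ⟨M, hM⟩ := hφ.exists_bound_deriv
    have hmul : ∀ {k : ℝ → ℝ}, IntegrableOn k (Ioo 0 1) →
        IntegrableOn (fun w => k w * deriv φ w) (Ioo 0 1) := fun hk =>
      Integrable.mul_bdd (c := M) hk hφ.continuous_deriv.aestronglyMeasurable
        (Eventually.of_forall hM)
    have e : ∫ w in Ioo (0 : ℝ) 1, u w * deriv φ w =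
        ∫ w in Ioo (0 : ℝ) 1, (f w * deriv φ w - g w * deriv φ w) :=
      integral_congr_ae (by filter_upwards [hu] with w hw; rw [hw]; ring)
    rw [e, integral_sub (hmul hfi) (hmul hgi), h1' φ hφ, h2' φ hφ,
      pairing_eq rfl fun μ _ => hφ.integrable μ]
    ring
  refine ⟨⟨_, hd⟩, ?_⟩
  rw [hd.derivMeasure_eq]
  refine ENNReal.toReal_le_of_le_ofReal (by linarith)
    ((totalVariation_univ_le rfl).trans ?_)
  rw [ENNReal.ofReal_add (by linarith) (by linarith)]
  exact add_le_add h1 h2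

lemma exists_isTestI_seq (g : C₀(Ioo (0 : ℝ) 1, ℝ)) : ∃ φ : ℕ → ℝ → ℝ, (∀ n, IsTestI (φ n)) ∧
    ∀ n, ∀ w : Ioo (0 : ℝ) 1, |φ n w - g w| ≤ 1 / ((n : ℝ) + 1) := by
  choose φ h1 h2 using fun n : ℕ => exists_isTestI_approx g
    (Nat.one_div_pos_of_nat (α := ℝ) (n := n))
  exact ⟨φ, h1, h2⟩

/-- Derivative measures of bounded mass converge on `C₀` as soon as they converge on test
functions. -/
lemma tendsto_pairing {u : ℕ → ℝ → ℝ} {v : ℝ → ℝ} {K : ℝ} (hu : ∀ k, IsBV (u k)) (hv : IsBV v)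
    (huK : ∀ k, ((derivMeasure (u k)).totalVariation univ).toReal ≤ K)
    (hvK : ((derivMeasure v).totalVariation univ).toReal ≤ K)
    (h : ∀ φ, IsTestI φ → Tendsto (fun k => ∫ w in Ioo (0 : ℝ) 1, u k w * deriv φ w) atTop
      (𝓝 (∫ w in Ioo (0 : ℝ) 1, v w * deriv φ w))) (g : C₀(Ioo (0 : ℝ) 1, ℝ)) :
    Tendsto (fun k => pairing (derivMeasure (u k)) g) atTop (𝓝 (pairing (derivMeasure v) g)) := by
  have hK : 0 ≤ K := ENNReal.toReal_nonneg.trans hvK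
  rw [Metric.tendsto_atTop]
  intro ε hε
  obtain ⟨φ, hφ, hφg⟩ := exists_isTestI_approx g (show 0 < ε / (3 * (K + 1)) by positivity)
  have hsmall : ∀ m : SignedMeasure (Ioo (0 : ℝ) 1), (m.totalVariation univ).toReal ≤ K →
      |pairing m (fun w => φ w) - pairing m g| < ε / 3 := by
    intro m hm
    refine (abs_pairing_sub_le m (fun μ _ => hφ.integrable μ)
      (fun μ _ => integrable_zeroAtInfty μ g) hφg).trans_lt ?_
    rw [div_mul_eq_mul_div, div_lt_iff₀ (by positivity)]
    nlinarith
  obtain ⟨n, hn⟩ := (Metric.tendsto_atTop.1 (h φ hφ)) (ε / 3) (by positivity)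
  refine ⟨n, fun k hk => ?_⟩
  have e1 := hn k hk
  rw [(hu k).hasDerivMeasure.2 φ hφ.contDiff hφ.compact hφ.support,
    hv.hasDerivMeasure.2 φ hφ.contDiff hφ.compact hφ.support, Real.dist_eq] at e1
  have e2 := abs_lt.1 e1
  have e3 := abs_lt.1 (hsmall _ (huK k))
  have e4 := abs_lt.1 (hsmall _ hvK)
  rw [Real.dist_eq]
  exact abs_lt.2 ⟨by linarith, by linarith⟩

/-- A function that is measurable in its first and continuous in its second variable can be
composed with a strongly measurable function. -/
lemma aestronglyMeasurable_of_continuous_right {E : Type*} [NormedAddCommGroup E] {μ : Measure ℝ}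
    {L : ℝ → E → ℝ} (hL : ∀ e, AEStronglyMeasurable (fun t => L t e) μ)
    (hc : ∀ᵐ t ∂μ, Continuous (L t)) {g : ℝ → E} (hg : AEStronglyMeasurable g μ) :
    AEStronglyMeasurable (fun t => L t (g t)) μ := by
  obtain ⟨g', hg', hgg'⟩ := hg
  have hsimple : ∀ s : SimpleFunc ℝ E, AEStronglyMeasurable (fun t => L t (s t)) μ := by
    intro s
    have e : (fun t => L t (s t)) =
        fun t => ∑ v ∈ s.range, (s ⁻¹' {v}).indicator (fun t => L t v) t := by
      funext t
      rw [Finset.sum_eq_single (s t)]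
      · simp [indicator]
      · intro v _ hv
        exact indicator_of_notMem (fun h => hv h.symm) _
      · intro h
        exact absurd (SimpleFunc.mem_range_self s t) h
    rw [e]
    exact Finset.aestronglyMeasurable_fun_sum _ fun v _ =>
      (hL v).indicator (s.measurableSet_preimage _)
  refine (aestronglyMeasurable_of_tendsto_ae (f := fun n t => L t (hg'.approx n t)) atTop
    (g := fun t => L t (g' t)) (fun n => hsimple _) ?_).congr ?_
  · filter_upwards [hc] with t ht
    exact (ht.tendsto _).comp (hg'.tendsto_approx t)
  · filter_upwards [hgg'] with t ht
    rw [ht]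

/-! ### Compactness of the interpolated dynamics -/

lemma tendsto_ceil_mul_div {n : ℕ → ℕ} (hn : Tendsto n atTop atTop) (h0 : ∀ k, 0 < n k) {w : ℝ}
    (hw : w ∈ Ioo (0 : ℝ) 1) :
    Tendsto (fun k => (⌈(n k : ℝ) * w⌉₊ : ℝ) / n k) atTop (𝓝 w) := by
  have h1 : Tendsto (fun k => 1 / (n k : ℝ)) atTop (𝓝 0) :=
    tendsto_one_div_atTop_nhds_zero_nat.comp hn
  have h2 : Tendsto (fun k => w + 1 / (n k : ℝ)) atTop (𝓝 w) := by
    simpa using h1.const_add w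
  refine tendsto_of_tendsto_of_tendsto_of_le_of_le tendsto_const_nhds h2 (fun k => ?_) fun k => ?_
  · have hk : (0 : ℝ) < n k := by exact_mod_cast h0 k
    simp only
    rw [le_div_iff₀ hk]
    have := Nat.le_ceil ((n k : ℝ) * w)
    linarith
  · have hk : (0 : ℝ) < n k := by exact_mod_cast h0 k
    simp only
    rw [div_le_iff₀ hk, add_mul, one_div, inv_mul_cancel₀ hk.ne']
    have := ceil_mul_sub_one_lt (h0 k) hw.1
    linarith

lemma abs_ceil_mul_div_le {N : ℕ} (hN : 0 < N) {w : ℝ} (hw : w ∈ Ioo (0 : ℝ) 1) :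
    |(⌈(N : ℝ) * w⌉₊ : ℝ) / N| ≤ 1 :=
  abs_div_le_one (ceil_mul_le hw.2.le) hN

lemma measurable_ceil_mul_div (N : ℕ) : Measurable fun w : ℝ => (⌈(N : ℝ) * w⌉₊ : ℝ) / N :=
  ((measurable_from_nat (f := fun n : ℕ => (n : ℝ))).comp
    (Nat.measurable_ceil.comp (measurable_const_mul _))).div_const _

lemma integrableOn_Ioo_of_bound {f : ℝ → ℝ} (hf : Measurable f) {M : ℝ}
    (hM : ∀ w ∈ Ioo (0 : ℝ) 1, |f w| ≤ M) : IntegrableOn f (Ioo 0 1) :=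
  Integrable.of_bound hf.aestronglyMeasurable M
    ((ae_restrict_iff' measurableSet_Ioo).2 (Eventually.of_forall hM))

lemma intervalIntegrable_of_integrableOn_Ioo {f : ℝ → ℝ} (hf : IntegrableOn f (Ioo 0 1)) {p q : ℝ}
    (hp : p ∈ Icc (0 : ℝ) 1) (hq : q ∈ Icc (0 : ℝ) 1) : IntervalIntegrable f volume p q :=
  intervalIntegrable_of_integrableOn_Icc (by rwa [integrableOn_Icc_iff_integrableOn_Ioo]) hp hq

lemma tendsto_primitive {f : ℕ → ℝ → ℝ} {M : ℝ} (hf : ∀ k, Measurable (f k))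
    (hM : ∀ k, ∀ w ∈ Ioo (0 : ℝ) 1, |f k w| ≤ M) {g : ℝ → ℝ}
    (h : ∀ᵐ w ∂(volume.restrict (Ioo (0 : ℝ) 1)), Tendsto (fun k => f k w) atTop (𝓝 (g w)))
    {w : ℝ} (hw : w ∈ Ioo (0 : ℝ) 1) :
    Tendsto (fun k => ∫ v in (0 : ℝ)..w, f k v) atTop (𝓝 (∫ v in (0 : ℝ)..w, g v)) := by
  have hsub : Ioo 0 w ⊆ Ioo (0 : ℝ) 1 := Ioo_subset_Ioo_right hw.2.le
  simp only [intervalIntegral.integral_of_le hw.1.le, integral_Ioc_eq_integral_Ioo]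
  refine tendsto_integral_of_dominated_convergence (fun _ => M)
    (fun k => (hf k).aestronglyMeasurable) (integrable_const _)
    (fun k => (ae_restrict_iff' measurableSet_Ioo).2 (Eventually.of_forall fun v hv =>
      hM k v (hsub hv))) (ae_restrict_of_ae_restrict_of_subset hsub h)

section Flow

variable {N : ℕ} {T C R : ℝ} {ξ υ υa l : ℝ → ℝ → ℝ} {υ0 : ℝ → ℝ}

lemma DiscreteFlow.measurable_pos_slice (h : DiscreteFlow N T C R ξ υ υa l υ0) (t : ℝ) :
    Measurable (ξ t) := h.meas_pos.comp measurable_prodMk_left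

lemma DiscreteFlow.measurable_vel_slice (h : DiscreteFlow N T C R ξ υ υa l υ0) (t : ℝ) :
    Measurable (υ t) := h.meas_vel.comp measurable_prodMk_left

lemma DiscreteFlow.measurable_mult_slice (h : DiscreteFlow N T C R ξ υ υa l υ0) (t : ℝ) :
    Measurable (l t) := h.meas_mult.comp measurable_prodMk_left

lemma DiscreteFlow.mult_sub_eq (h : DiscreteFlow N T C R ξ υ υa l υ0) {t : ℝ}
    (hb : ∀ w ∈ Ioo (0 : ℝ) 1, |υ t w| ≤ C)
    (he : ∀ w ∈ Ioo (0 : ℝ) 1, l t w = ∫ v in (0 : ℝ)..w, (υ0 v - υ t v)) {v w : ℝ}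
    (hv : v ∈ Ioo (0 : ℝ) 1) (hw : w ∈ Ioo (0 : ℝ) 1) :
    l t w - l t v = ∫ s in v..w, (υ0 s - υ t s) := by
  have hi : IntegrableOn (fun s => υ0 s - υ t s) (Ioo 0 1) :=
    (integrableOn_Ioo_of_bound h.meas_vel0 h.vel0_bound).sub
      (integrableOn_Ioo_of_bound (h.measurable_vel_slice t) hb)
  rw [he w hw, he v hv, intervalIntegral.integral_interval_sub_left]
  · exact intervalIntegrable_of_integrableOn_Ioo hi (by simp) (Ioo_subset_Icc_self hw)
  · exact intervalIntegrable_of_integrableOn_Ioo hi (by simp) (Ioo_subset_Icc_self hv)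

lemma DiscreteFlow.abs_mult_sub_le (h : DiscreteFlow N T C R ξ υ υa l υ0) {t : ℝ}
    (hb : ∀ w ∈ Ioo (0 : ℝ) 1, |υ t w| ≤ C)
    (he : ∀ w ∈ Ioo (0 : ℝ) 1, l t w = ∫ v in (0 : ℝ)..w, (υ0 v - υ t v)) {v w : ℝ}
    (hv : v ∈ Ioo (0 : ℝ) 1) (hw : w ∈ Ioo (0 : ℝ) 1) : |l t w - l t v| ≤ 2 * C * |w - v| := by
  rw [h.mult_sub_eq hb he hv hw]
  refine intervalIntegral.norm_integral_le_of_norm_le_const (f := fun s => υ0 s - υ t s)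
    fun s hs => ?_
  have hs' : s ∈ Ioo (0 : ℝ) 1 := ⟨(lt_min hv.1 hw.1).trans hs.1, hs.2.trans_lt (max_lt hv.2 hw.2)⟩
  have h1 := h.vel0_bound s hs'
  have h2 := hb s hs'
  exact (norm_sub_le _ _).trans (by simp only [Real.norm_eq_abs]; linarith)

end Flow

section Sequence

variable {T C R : ℝ} {n : ℕ → ℕ} {ξ υ υa l : ℕ → ℝ → ℝ → ℝ} {υ0 : ℕ → ℝ → ℝ}

/-- Positions and multipliers converge along a subsequence: the former are monotone in `w` and
Lipschitz in `t`, the latter monotone in `t` and Lipschitz in `w`. -/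
lemma exists_subseq_tendsto_pos_mult (hC : 0 ≤ C)
    (h : ∀ k, DiscreteFlow (n k) T C R (ξ k) (υ k) (υa k) (l k) (υ0 k)) :
    ∃ σ : ℕ → ℕ, StrictMono σ ∧
      (∀ t, ∀ᵐ w ∂(volume.restrict (Ioo (0 : ℝ) 1)),
        ∃ a, Tendsto (fun k => ξ (σ k) t w) atTop (𝓝 a)) ∧
      (∀ w ∈ Ioo (0 : ℝ) 1, ∀ᵐ t ∂(volume.restrict (Ioo 0 T)),
        ∃ a, Tendsto (fun k => l (σ k) t w) atTop (𝓝 a)) := by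
  have hgood : ∀ᵐ t ∂(volume.restrict (Ioo 0 T)), ∀ k, (∀ w ∈ Ioo (0 : ℝ) 1, |υ k t w| ≤ C) ∧
      ∀ w ∈ Ioo (0 : ℝ) 1, l k t w = ∫ v in (0 : ℝ)..w, (υ0 k v - υ k t v) :=
    ae_all_iff.2 fun k => (h k).vel_bound.and (h k).mult_eq
  have hpick : ∀ q : ℚ × ℚ, ∃ t : ℝ, 0 < (q.1 : ℝ) → (q.1 : ℝ) < q.2 → (q.2 : ℝ) < T →
      t ∈ Ioo (q.1 : ℝ) q.2 ∧ ∀ k, (∀ w ∈ Ioo (0 : ℝ) 1, |υ k t w| ≤ C) ∧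
      ∀ w ∈ Ioo (0 : ℝ) 1, l k t w = ∫ v in (0 : ℝ)..w, (υ0 k v - υ k t v) := by
    intro q
    by_cases hq : 0 < (q.1 : ℝ) ∧ (q.1 : ℝ) < q.2 ∧ (q.2 : ℝ) < T
    · have h1 := ae_restrict_of_ae_restrict_of_subset
        (Ioo_subset_Ioo hq.1.le hq.2.2.le) hgood
      have hne : (ae (volume.restrict (Ioo (q.1 : ℝ) q.2))).NeBot := by
        rw [ae_neBot, Ne, Measure.restrict_eq_zero, Real.volume_Ioo, ENNReal.ofReal_eq_zero]
        linarith [hq.2.1]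
      obtain ⟨t, ht1, ht2⟩ := (h1.and (ae_restrict_mem measurableSet_Ioo)).exists
      exact ⟨t, fun _ _ _ => ⟨ht2, ht1⟩⟩
    · exact ⟨0, fun h1 h2 h3 => absurd ⟨h1, h2, h3⟩ hq⟩
  choose pick hpick using hpick
  set f : ℕ → ((ℚ × ℚ) ⊕ ((ℚ × ℚ) × ℚ)) → ℝ := fun k i =>
    i.elim (fun p => if (p.2 : ℝ) ∈ Ioo (0 : ℝ) 1 then ξ k p.1 p.2 else 0)
      (fun p => l k (pick p.1) p.2) with hf
  have hfb : ∀ k i, |f k i| ≤ max R (2 * C) := by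
    rintro k (p | p)
    · simp only [hf, Sum.elim_inl]
      split_ifs with hp
      · exact ((h k).pos_bound _ _ hp).trans (le_max_left _ _)
      · rw [abs_zero]
        exact le_max_of_le_right (by positivity)
    · have := (h k).mult_mem (pick p.1) p.2
      simp only [hf, Sum.elim_inr]
      rw [abs_of_nonneg this.1]
      exact this.2.trans (le_max_right _ _)
  obtain ⟨σ, hσ, hlim⟩ := exists_subseq_tendsto_of_countable hfb
  refine ⟨σ, hσ, fun t => ?_, fun w hw => ?_⟩
  · refine ae_exists_tendsto_of_monotoneOn_of_dense (D := range ((↑) : ℚ → ℝ)) (C := R) ?_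
      (fun k => (h (σ k)).pos_mono t) (fun k => (h (σ k)).pos_bound t) ?_
    · intro v w _ hvw _
      obtain ⟨q, hq⟩ := exists_rat_btwn hvw
      exact ⟨q, ⟨q, rfl⟩, hq⟩
    · rintro _ ⟨p, rfl⟩ hp
      refine exists_tendsto_of_lipschitz_of_dense (A := univ) (D := range ((↑) : ℚ → ℝ))
        (f := fun k s => ξ (σ k) s p) (subset_univ _) (Rat.denseRange_cast.closure_range.ge) hC
        (fun k s _ r _ => (h (σ k)).pos_lip r s p hp) ?_ (mem_univ t)
      rintro _ ⟨q, rfl⟩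
      have := hlim (Sum.inl (q, p))
      simpa only [hf, Sum.elim_inl, hp, if_true] using this
  · refine ae_exists_tendsto_of_monotoneOn_of_dense (C := 2 * C) (F := fun k t => l (σ k) t w)
      (D := {d | ∃ q : ℚ × ℚ, (0 < (q.1 : ℝ) ∧ (q.1 : ℝ) < q.2 ∧ (q.2 : ℝ) < T) ∧ d = pick q}) ?_
      (fun k => ((h (σ k)).mult_mono w).monotoneOn _) (fun k t _ => ?_) ?_
    · intro v w hv hvw hw
      obtain ⟨q1, h1, h2⟩ := exists_rat_btwn hvw
      obtain ⟨q2, h3, h4⟩ := exists_rat_btwn h2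
      have hq : 0 < (q1 : ℝ) ∧ (q1 : ℝ) < q2 ∧ (q2 : ℝ) < T := ⟨hv.trans h1, h3, h4.trans hw⟩
      have hp := (hpick (q1, q2) hq.1 hq.2.1 hq.2.2).1
      exact ⟨pick (q1, q2), ⟨(q1, q2), hq, rfl⟩, h1.trans hp.1, hp.2.trans h4⟩
    · have := (h (σ k)).mult_mem t w
      rw [abs_of_nonneg this.1]
      exact this.2
    · rintro _ ⟨q, hq, rfl⟩ -
      have hg := (hpick q hq.1 hq.2.1 hq.2.2).2
      refine exists_tendsto_of_lipschitz_of_dense (A := Ioo 0 1)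
        (D := Ioo 0 1 ∩ range ((↑) : ℚ → ℝ)) (L := 2 * C)
        (f := fun k v => l (σ k) (pick q) v) inter_subset_left ?_ (by positivity)
        (fun k s hs r hr => (h (σ k)).abs_mult_sub_le (hg (σ k)).1 (hg (σ k)).2 hr hs) ?_ hw
      · exact (Rat.denseRange_cast (𝕜 := ℝ)).open_subset_closure_inter isOpen_Ioo
      · rintro _ ⟨-, p, rfl⟩
        exact hlim (Sum.inr (q, p))

/-- The velocities converge almost everywhere if positions and multipliers do: up to the positions
they are monotone in `w`, and their primitives are given by the multipliers. -/
lemma ae_exists_tendsto_vel (hn : Tendsto n atTop atTop) (hn0 : ∀ k, 0 < n k)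
    (h : ∀ k, DiscreteFlow (n k) T C R (ξ k) (υ k) (υa k) (l k) (υ0 k))
    (h0 : ∀ᵐ w ∂(volume.restrict (Ioo (0 : ℝ) 1)), ∃ a, Tendsto (fun k => υ0 k w) atTop (𝓝 a))
    (hξ : ∀ t, ∀ᵐ w ∂(volume.restrict (Ioo (0 : ℝ) 1)),
      ∃ a, Tendsto (fun k => ξ k t w) atTop (𝓝 a))
    (hl : ∀ᵐ t ∂(volume.restrict (Ioo 0 T)), ∀ᵐ w ∂(volume.restrict (Ioo (0 : ℝ) 1)),
      ∃ a, Tendsto (fun k => l k t w) atTop (𝓝 a)) :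
    ∀ᵐ t ∂(volume.restrict (Ioo 0 T)), ∀ᵐ w ∂(volume.restrict (Ioo (0 : ℝ) 1)),
      ∃ a, Tendsto (fun k => υ k t w) atTop (𝓝 a) := by
  have hb : ∀ᵐ t ∂(volume.restrict (Ioo 0 T)), ∀ k, ∀ w ∈ Ioo (0 : ℝ) 1, |υ k t w| ≤ C :=
    ae_all_iff.2 fun k => (h k).vel_bound
  have he : ∀ᵐ t ∂(volume.restrict (Ioo 0 T)), ∀ k, ∀ w ∈ Ioo (0 : ℝ) 1,
      l k t w = ∫ v in (0 : ℝ)..w, (υ0 k v - υ k t v) := ae_all_iff.2 fun k => (h k).mult_eq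
  have ho : ∀ᵐ t ∂(volume.restrict (Ioo 0 T)), ∀ k, MonotoneOn
      (fun w => (ξ k t w - (⌈(n k : ℝ) * w⌉₊ : ℝ) / n k) / t - υ k t w) (Ioo 0 1) :=
    ae_all_iff.2 fun k => (h k).oleinik
  filter_upwards [hb, he, ho, hl, ae_restrict_mem measurableSet_Ioo] with t hb he ho hl ht
  set c : ℕ → ℝ → ℝ := fun k w => (⌈(n k : ℝ) * w⌉₊ : ℝ) / n k with hc
  set G : ℕ → ℝ → ℝ := fun k w => (ξ k t w - c k w) / t with hG
  have hGm : ∀ k, Measurable (G k) := fun k =>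
    (((h k).measurable_pos_slice t).sub (measurable_ceil_mul_div (n k))).div_const _
  have hGb : ∀ k, ∀ w ∈ Ioo (0 : ℝ) 1, |G k w| ≤ (R + 1) / t := fun k w hw => by
    simp only [hG]
    rw [abs_div, abs_of_pos ht.1]
    refine div_le_div_of_nonneg_right ((abs_sub _ _).trans ?_) ht.1.le
    exact add_le_add ((h k).pos_bound t w hw) (abs_ceil_mul_div_le (hn0 k) hw)
  have hGlim : ∀ᵐ w ∂(volume.restrict (Ioo (0 : ℝ) 1)),
      ∃ a, Tendsto (fun k => G k w) atTop (𝓝 a) := by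
    filter_upwards [hξ t, ae_restrict_mem measurableSet_Ioo] with w ⟨a, ha⟩ hw
    exact ⟨_, (ha.sub (tendsto_ceil_mul_div hn hn0 hw)).div_const t⟩
  have hHlim : ∀ᵐ w ∂(volume.restrict (Ioo (0 : ℝ) 1)),
      Tendsto (fun k => G k w - υ0 k w) atTop (𝓝 (limsup (fun k => G k w - υ0 k w) atTop)) := by
    filter_upwards [hGlim, h0] with w ⟨a, ha⟩ ⟨b, hb⟩
    exact tendsto_limsup_of_exists ⟨_, ha.sub hb⟩
  have hF := ae_exists_tendsto_of_monotoneOn_of_primitive (F := fun k w => G k w - υ k t w)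
    (Φ := fun k w => (∫ v in (0 : ℝ)..w, (G k v - υ0 k v)) + l k t w) (C := (R + 1) / t + C)
    (fun k => ho k)
    (fun k w hw => (abs_sub _ _).trans (add_le_add (hGb k w hw) (hb k w hw)))
    (fun k p hp q hq hpq => ?_) ?_
  · filter_upwards [hF, hGlim] with w ⟨a, ha⟩ ⟨b, hb⟩
    exact ⟨b - a, by simpa using hb.sub ha⟩
  · have i1 : IntegrableOn (fun v => G k v - υ0 k v) (Ioo 0 1) :=
      (integrableOn_Ioo_of_bound (hGm k) (hGb k)).sub
        (integrableOn_Ioo_of_bound (h k).meas_vel0 (h k).vel0_bound)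
    have i2 : IntegrableOn (fun v => υ0 k v - υ k t v) (Ioo 0 1) :=
      (integrableOn_Ioo_of_bound (h k).meas_vel0 (h k).vel0_bound).sub
        (integrableOn_Ioo_of_bound ((h k).measurable_vel_slice t) (hb k))
    have hp' := Ioo_subset_Icc_self hp
    have hq' := Ioo_subset_Icc_self hq
    have e1 := (h k).mult_sub_eq (hb k) (he k) hp hq
    have e2 := intervalIntegral.integral_interval_sub_left
      (intervalIntegrable_of_integrableOn_Ioo i1 (left_mem_Icc.2 zero_le_one) hq')
      (intervalIntegrable_of_integrableOn_Ioo i1 (left_mem_Icc.2 zero_le_one) hp')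
    have e3 := intervalIntegral.integral_add (intervalIntegrable_of_integrableOn_Ioo i1 hp' hq')
      (intervalIntegrable_of_integrableOn_Ioo i2 hp' hq')
    have e4 : ∫ v in p..q, ((G k v - υ0 k v) + (υ0 k v - υ k t v)) =
        ∫ v in p..q, (G k v - υ k t v) :=
      intervalIntegral.integral_congr fun v _ => by ring
    rw [← e4, e3, ← e1, ← e2]
    ring
  · filter_upwards [hl, ae_restrict_mem measurableSet_Ioo] with w ⟨a, ha⟩ hw
    refine ⟨_, (tendsto_primitive (M := (R + 1) / t + C) (fun k => (hGm k).sub (h k).meas_vel0)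
      (fun k w hw => (abs_sub _ _).trans (add_le_add (hGb k w hw) ((h k).vel0_bound w hw)))
      hHlim hw).add ha⟩

end Sequence

/-! ### Passage to the limit in the dynamics -/

/-- The properties of the limits `X`, `U`, `l` of positions, velocities and multipliers from which
the limit system is derived; `V0` is the limit of the initial velocities. -/
structure LimitFlow (T C R : ℝ) (X U l : ℝ → ℝ → ℝ) (V0 : ℝ → ℝ) : Prop where
  meas_pos : Measurable fun z : ℝ × ℝ => X z.1 z.2
  meas_vel : Measurable fun z : ℝ × ℝ => U z.1 z.2
  meas_mult : Measurable fun z : ℝ × ℝ => l z.1 z.2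
  meas_vel0 : Measurable V0
  vel0_bound : ∀ w ∈ Ioo (0 : ℝ) 1, |V0 w| ≤ C
  pos_bound : ∀ t, ∀ w ∈ Ioo (0 : ℝ) 1, |X t w| ≤ R
  pos_lip : ∀ s t, ∀ w ∈ Ioo (0 : ℝ) 1, |X t w - X s w| ≤ C * |t - s|
  pos_sub_mono : ∀ t, MonotoneOn (fun w => X t w - w) (Ioo 0 1)
  pos_ftc : ∀ᵐ w ∂(volume.restrict (Ioo (0 : ℝ) 1)), ∀ s ∈ Icc 0 T, ∀ t ∈ Icc 0 T,
    X t w - X s w = ∫ r in s..t, U r w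
  mult_mono : ∀ w, Monotone fun t => l t w
  mult_mem : ∀ t w, l t w ∈ Icc 0 (2 * C)
  vel_bound : ∀ᵐ t ∂(volume.restrict (Ioo 0 T)), ∀ w ∈ Ioo (0 : ℝ) 1, |U t w| ≤ C
  mult_weak : ∀ᵐ t ∂(volume.restrict (Ioo 0 T)), ∀ χ : ℝ → ℝ, ContDiff ℝ 1 χ →
    ∫ w in Ioo (0 : ℝ) 1, 1 * (l t w * deriv χ w + (V0 w - U t w) * χ w) = 0
  oleinik : ∀ᵐ t ∂(volume.restrict (Ioo 0 T)), ∃ F : ℝ → ℝ, MonotoneOn F (Ioo 0 1) ∧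
    (∀ w ∈ Ioo (0 : ℝ) 1, |F w| ≤ (R + 1) / t + C) ∧
    ∀ᵐ w ∂(volume.restrict (Ioo (0 : ℝ) 1)), U t w = (X t w - w) / t - F w
  orth_pos : ∀ᵐ t ∂(volume.restrict (Ioo 0 T)), ∀ χ : ℝ → ℝ, ContDiff ℝ 1 χ →
    ∫ w in Ioo (0 : ℝ) 1, (X t w - w) * (l t w * deriv χ w + (V0 w - U t w) * χ w) = 0
  orth_vel : ∀ᵐ t ∂(volume.restrict (Ioo 0 T)), ∀ χ : ℝ → ℝ, ContDiff ℝ 1 χ →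
    ∫ w in Ioo (0 : ℝ) 1, U t w * (l t w * deriv χ w + (V0 w - U t w) * χ w) = 0

lemma exists_bound_Icc {χ : ℝ → ℝ} (hχ : Continuous χ) : ∃ M, ∀ w ∈ Ioo (0 : ℝ) 1, |χ w| ≤ M := by
  obtain ⟨M, hM⟩ := isCompact_Icc.exists_bound_of_continuousOn (s := Icc (0 : ℝ) 1) hχ.continuousOn
  exact ⟨M, fun w hw => hM w (Ioo_subset_Icc_self hw)⟩

/-- The quadratic expressions in the orthogonality relations pass to the limit. -/
lemma integral_eq_zero_of_tendsto {v l d : ℕ → ℝ → ℝ} {v' l' d' χ : ℝ → ℝ} {A L D : ℝ}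
    (hv : ∀ k, Measurable (v k)) (hl : ∀ k, Measurable (l k)) (hd : ∀ k, Measurable (d k))
    (hvA : ∀ k, ∀ w ∈ Ioo (0 : ℝ) 1, |v k w| ≤ A) (hlL : ∀ k, ∀ w ∈ Ioo (0 : ℝ) 1, |l k w| ≤ L)
    (hdD : ∀ k, ∀ w ∈ Ioo (0 : ℝ) 1, |d k w| ≤ D) (hχ : ContDiff ℝ 1 χ)
    (hv' : ∀ᵐ w ∂(volume.restrict (Ioo (0 : ℝ) 1)), Tendsto (fun k => v k w) atTop (𝓝 (v' w)))
    (hl' : ∀ᵐ w ∂(volume.restrict (Ioo (0 : ℝ) 1)), Tendsto (fun k => l k w) atTop (𝓝 (l' w)))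
    (hd' : ∀ᵐ w ∂(volume.restrict (Ioo (0 : ℝ) 1)), Tendsto (fun k => d k w) atTop (𝓝 (d' w)))
    (h : ∀ k, ∫ w in Ioo (0 : ℝ) 1, v k w * (l k w * deriv χ w + d k w * χ w) = 0) :
    ∫ w in Ioo (0 : ℝ) 1, v' w * (l' w * deriv χ w + d' w * χ w) = 0 := by
  have hχ' := hχ.continuous_deriv le_rfl
  obtain ⟨M, hM⟩ := exists_bound_Icc hχ.continuous
  obtain ⟨M', hM'⟩ := exists_bound_Icc hχ'
  have hlim := tendsto_integral_of_dominated_convergence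
    (μ := volume.restrict (Ioo (0 : ℝ) 1))
    (F := fun k w => v k w * (l k w * deriv χ w + d k w * χ w))
    (f := fun w => v' w * (l' w * deriv χ w + d' w * χ w))
    (fun _ => A * (L * M' + D * M))
    (fun k => ((hv k).mul (((hl k).mul hχ'.measurable).add
      ((hd k).mul hχ.continuous.measurable))).aestronglyMeasurable) (integrable_const _)
    (fun k => (ae_restrict_iff' measurableSet_Ioo).2 (Eventually.of_forall fun w hw => ?_)) ?_
  · simp only [h] at hlim
    exact tendsto_nhds_unique hlim tendsto_const_nhds
  · have h1 := hvA k w hw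
    have h2 := hlL k w hw
    have h3 := hdD k w hw
    have h4 := hM w hw
    have h5 := hM' w hw
    rw [Real.norm_eq_abs, abs_mul]
    refine mul_le_mul h1 ((abs_add_le _ _).trans ?_) (abs_nonneg _) ((abs_nonneg _).trans h1)
    rw [abs_mul, abs_mul]
    exact add_le_add (mul_le_mul h2 h5 (abs_nonneg _) ((abs_nonneg _).trans h2))
      (mul_le_mul h3 h4 (abs_nonneg _) ((abs_nonneg _).trans h3))
  · filter_upwards [hv', hl', hd'] with w a b c
    exact a.mul ((b.mul_const _).add (c.mul_const _))

lemma ae_ae_comm_exists_tendsto {f : ℕ → ℝ → ℝ → ℝ}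
    (hf : ∀ k, Measurable fun z : ℝ × ℝ => f k z.1 z.2) {A B : Set ℝ} :
    (∀ᵐ t ∂(volume.restrict A), ∀ᵐ w ∂(volume.restrict B),
      ∃ a, Tendsto (fun k => f k t w) atTop (𝓝 a)) ↔
    ∀ᵐ w ∂(volume.restrict B), ∀ᵐ t ∂(volume.restrict A),
      ∃ a, Tendsto (fun k => f k t w) atTop (𝓝 a) :=
  Measure.ae_ae_comm (measurableSet_exists_tendsto hf)

section Sequence

variable {T C R : ℝ} {n : ℕ → ℕ} {ξ υ υa l : ℕ → ℝ → ℝ → ℝ} {υ0 : ℕ → ℝ → ℝ}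

lemma ae_forall_tendsto_pos (hC : 0 ≤ C)
    (h : ∀ k, DiscreteFlow (n k) T C R (ξ k) (υ k) (υa k) (l k) (υ0 k))
    (hξ : ∀ t, ∀ᵐ w ∂(volume.restrict (Ioo (0 : ℝ) 1)),
      ∃ a, Tendsto (fun k => ξ k t w) atTop (𝓝 a)) :
    ∀ᵐ w ∂(volume.restrict (Ioo (0 : ℝ) 1)), ∀ t,
      Tendsto (fun k => ξ k t w) atTop (𝓝 (limsup (fun k => ξ k t w) atTop)) := by
  have h1 : ∀ᵐ w ∂(volume.restrict (Ioo (0 : ℝ) 1)), ∀ q : ℚ,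
      ∃ a, Tendsto (fun k => ξ k q w) atTop (𝓝 a) := ae_all_iff.2 fun q => hξ q
  filter_upwards [h1, ae_restrict_mem measurableSet_Ioo] with w hw hmem t
  refine tendsto_limsup_of_exists
    (exists_tendsto_of_lipschitz_of_dense (A := univ) (D := range ((↑) : ℚ → ℝ))
      (f := fun k s => ξ k s w) (subset_univ _) (Rat.denseRange_cast.closure_range.ge) hC
      (fun k s _ r _ => (h k).pos_lip r s w hmem) ?_ (mem_univ t))
  rintro _ ⟨q, rfl⟩
  exact hw q

/-- The limits exist almost everywhere, and the upper limits represent them. -/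
theorem limitFlow_of_tendsto (hC : 0 ≤ C) (hn : Tendsto n atTop atTop) (hn0 : ∀ k, 0 < n k)
    (h : ∀ k, DiscreteFlow (n k) T C R (ξ k) (υ k) (υa k) (l k) (υ0 k))
    (h0 : ∀ᵐ w ∂(volume.restrict (Ioo (0 : ℝ) 1)), ∃ a, Tendsto (fun k => υ0 k w) atTop (𝓝 a))
    (hξ : ∀ t, ∀ᵐ w ∂(volume.restrict (Ioo (0 : ℝ) 1)),
      ∃ a, Tendsto (fun k => ξ k t w) atTop (𝓝 a))
    (hl : ∀ᵐ t ∂(volume.restrict (Ioo 0 T)), ∀ᵐ w ∂(volume.restrict (Ioo (0 : ℝ) 1)),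
      ∃ a, Tendsto (fun k => l k t w) atTop (𝓝 a))
    (hυ : ∀ᵐ t ∂(volume.restrict (Ioo 0 T)), ∀ᵐ w ∂(volume.restrict (Ioo (0 : ℝ) 1)),
      ∃ a, Tendsto (fun k => υ k t w) atTop (𝓝 a)) :
    LimitFlow T C R (fun t w => limsup (fun k => ξ k t w) atTop)
      (fun t w => limsup (fun k => υ k t w) atTop) (fun t w => limsup (fun k => l k t w) atTop)
      (fun w => limsup (fun k => υ0 k w) atTop) := by
  have hb : ∀ᵐ t ∂(volume.restrict (Ioo 0 T)), ∀ k, ∀ w ∈ Ioo (0 : ℝ) 1, |υ k t w| ≤ C :=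
    ae_all_iff.2 fun k => (h k).vel_bound
  have hlb : ∀ k t w, |l k t w| ≤ 2 * C := fun k t w => by
    have := (h k).mult_mem t w
    rw [abs_of_nonneg this.1]
    exact this.2
  have hn1 : Tendsto (fun k => 1 / (n k : ℝ)) atTop (𝓝 0) :=
    tendsto_one_div_atTop_nhds_zero_nat.comp hn
  have hdb : ∀ t k, (∀ w ∈ Ioo (0 : ℝ) 1, |υ k t w| ≤ C) →
      ∀ w ∈ Ioo (0 : ℝ) 1, |υ0 k w - υ k t w| ≤ C + C := fun t k hk w hw =>
    (abs_sub _ _).trans (add_le_add ((h k).vel0_bound w hw) (hk w hw))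
  have hgb : ∀ t k, ∀ w ∈ Ioo (0 : ℝ) 1, |ξ k t w - (⌈(n k : ℝ) * w⌉₊ : ℝ) / n k| ≤ R + 1 :=
    fun t k w hw => (abs_sub _ _).trans
      (add_le_add ((h k).pos_bound t w hw) (abs_ceil_mul_div_le (hn0 k) hw))
  refine
    { meas_pos := Measurable.limsup fun k => (h k).meas_pos
      meas_vel := Measurable.limsup fun k => (h k).meas_vel
      meas_mult := Measurable.limsup fun k => (h k).meas_mult
      meas_vel0 := Measurable.limsup fun k => (h k).meas_vel0
      vel0_bound := fun w hw => abs_limsup_le fun k => (h k).vel0_bound w hw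
      pos_bound := fun t w hw => abs_limsup_le fun k => (h k).pos_bound t w hw
      pos_lip := fun s t w hw => ?_, pos_sub_mono := fun t v hv w hw hvw => ?_, pos_ftc := ?_
      mult_mono := fun w s t hst => ?_, mult_mem := fun t w => ?_, vel_bound := ?_, mult_weak := ?_
      oleinik := ?_, orth_pos := ?_, orth_vel := ?_ }
  · have key : ∀ s t, limsup (fun k => ξ k t w) atTop ≤
        limsup (fun k => ξ k s w) atTop + C * |t - s| := fun s t =>
      limsup_le_limsup_add (fun k => (h k).pos_bound t w hw) (fun k => (h k).pos_bound s w hw)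
        tendsto_const_nhds fun k => by
          have := (abs_le.1 ((h k).pos_lip s t w hw)).2
          linarith
    have h1 := key s t
    have h2 := key t s
    rw [abs_sub_comm s t] at h2
    exact abs_le.2 ⟨by linarith, by linarith⟩
  · have := limsup_le_limsup_add (fun k => (h k).pos_bound t v hv)
      (fun k => (h k).pos_bound t w hw) (d := fun k => v - w + 1 / (n k : ℝ))
      (hn1.const_add (v - w)) fun k => by
        have := (h k).pos_gap t v hv w hw hvw
        linarith
    simp only
    linarith
  · filter_upwards [ae_forall_tendsto_pos hC h hξ,
      (ae_ae_comm_exists_tendsto fun k => (h k).meas_vel).1 hυ,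
      ae_restrict_mem measurableSet_Ioo] with w hw1 hw2 hw s hs t ht
    have e1 : Tendsto (fun k => ∫ r in s..t, υ k r w) atTop
        (𝓝 (∫ r in s..t, limsup (fun k => υ k r w) atTop)) := by
      refine intervalIntegral.tendsto_integral_filter_of_dominated_convergence (fun _ => C)
        (Eventually.of_forall fun k => ?_) (Eventually.of_forall fun k => ?_)
        intervalIntegrable_const ?_
      · exact ((h k).meas_vel.comp (measurable_id.prodMk measurable_const)).aestronglyMeasurable
      · filter_upwards [ae_uIoc_of_ae_Ioo hb hs ht] with r hr hmem using hr hmem k w hw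
      · filter_upwards [ae_uIoc_of_ae_Ioo hw2 hs ht] with r hr hmem
        exact tendsto_limsup_of_exists (hr hmem)
    have e2 : (fun k => ∫ r in s..t, υ k r w) = fun k => ξ k t w - ξ k s w :=
      funext fun k => ((h k).pos_ftc s hs t ht w hw).symm
    rw [e2] at e1
    exact tendsto_nhds_unique ((hw1 t).sub (hw1 s)) e1
  · have := limsup_le_limsup_add (fun k => hlb k s w) (fun k => hlb k t w)
      (tendsto_const_nhds (x := (0 : ℝ))) fun k => by
        have := (h k).mult_mono w hst
        simp only at this
        linarith
    simpa using this
  · have h1 := abs_limsup_le fun k => hlb k t w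
    have h2 := limsup_le_limsup_add (u := fun _ : ℕ => (0 : ℝ)) (C := 2 * C)
      (fun k => by rw [abs_zero]; positivity)
      (fun k => hlb k t w) (tendsto_const_nhds (x := (0 : ℝ)))
      fun k => by simpa using ((h k).mult_mem t w).1
    rw [limsup_const, add_zero] at h2
    exact ⟨h2, (abs_le.1 h1).2⟩
  · filter_upwards [hb] with t ht w hw
    exact abs_limsup_le fun k => ht k w hw
  · filter_upwards [hb, ae_all_iff.2 fun k => (h k).orth_one, hl, hυ] with t hb ho hl hυ χ hχ
    refine integral_eq_zero_of_tendsto (v := fun _ _ => 1) (A := 1)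
      (fun _ => measurable_const)
      (fun k => (h k).measurable_mult_slice t)
      (fun k => (h k).meas_vel0.sub ((h k).measurable_vel_slice t)) (fun _ _ _ => by simp)
      (fun k w _ => hlb k t w) (fun k => hdb t k (hb k)) hχ
      (Eventually.of_forall fun _ => tendsto_const_nhds) ?_ ?_ fun k => ho k χ hχ
    · filter_upwards [hl] with w a using tendsto_limsup_of_exists a
    · filter_upwards [h0, hυ] with v a b
      exact (tendsto_limsup_of_exists a).sub (tendsto_limsup_of_exists b)
  · have ho : ∀ᵐ t ∂(volume.restrict (Ioo 0 T)), ∀ k, MonotoneOn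
        (fun w => (ξ k t w - (⌈(n k : ℝ) * w⌉₊ : ℝ) / n k) / t - υ k t w) (Ioo 0 1) :=
      ae_all_iff.2 fun k => (h k).oleinik
    filter_upwards [hb, ho, hυ, ae_restrict_mem measurableSet_Ioo] with t hb ho hυ ht
    have hFb : ∀ k, ∀ w ∈ Ioo (0 : ℝ) 1,
        |(ξ k t w - (⌈(n k : ℝ) * w⌉₊ : ℝ) / n k) / t - υ k t w| ≤ (R + 1) / t + C := by
      intro k w hw
      refine (abs_sub _ _).trans (add_le_add ?_ (hb k w hw))
      rw [abs_div, abs_of_pos ht.1]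
      exact div_le_div_of_nonneg_right (hgb t k w hw) ht.1.le
    refine ⟨fun w => limsup (fun k => (ξ k t w - (⌈(n k : ℝ) * w⌉₊ : ℝ) / n k) / t - υ k t w) atTop,
      fun v hv w hw hvw => ?_, fun w hw => abs_limsup_le fun k => hFb k w hw, ?_⟩
    · have := limsup_le_limsup_add (fun k => hFb k v hv) (fun k => hFb k w hw)
        (tendsto_const_nhds (x := (0 : ℝ))) fun k => by simpa using ho k hv hw hvw
      simpa using this
    · filter_upwards [hυ, hξ t, ae_restrict_mem measurableSet_Ioo] with w a b hw
      have e1 := tendsto_limsup_of_exists a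
      have e2 := ((tendsto_limsup_of_exists b).sub (tendsto_ceil_mul_div hn hn0 hw)).div_const t
      rw [(e2.sub e1).limsup_eq]
      ring
  · filter_upwards [hb, ae_all_iff.2 fun k => (h k).orth_pos, hl, hυ] with t hb ho hl hυ χ hχ
    refine integral_eq_zero_of_tendsto
      (fun k => ((h k).measurable_pos_slice t).sub (measurable_ceil_mul_div (n k)))
      (fun k => (h k).measurable_mult_slice t)
      (fun k => (h k).meas_vel0.sub ((h k).measurable_vel_slice t)) (hgb t)
      (fun k w _ => hlb k t w) (fun k => hdb t k (hb k)) hχ ?_ ?_ ?_ fun k => ho k χ hχ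
    · filter_upwards [hξ t, ae_restrict_mem measurableSet_Ioo] with w a hw
      exact (tendsto_limsup_of_exists a).sub (tendsto_ceil_mul_div hn hn0 hw)
    · filter_upwards [hl] with w a using tendsto_limsup_of_exists a
    · filter_upwards [h0, hυ] with v a b
      exact (tendsto_limsup_of_exists a).sub (tendsto_limsup_of_exists b)
  · filter_upwards [hb, ae_all_iff.2 fun k => (h k).orth_vel, hl, hυ] with t hb ho hl hυ χ hχ
    refine integral_eq_zero_of_tendsto
      (fun k => (h k).measurable_vel_slice t)
      (fun k => (h k).measurable_mult_slice t)
      (fun k => (h k).meas_vel0.sub ((h k).measurable_vel_slice t)) hb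
      (fun k w _ => hlb k t w) (fun k => hdb t k (hb k)) hχ ?_ ?_ ?_ fun k => ho k χ hχ
    · filter_upwards [hυ] with w a using tendsto_limsup_of_exists a
    · filter_upwards [hl] with w a using tendsto_limsup_of_exists a
    · filter_upwards [h0, hυ] with v a b
      exact (tendsto_limsup_of_exists a).sub (tendsto_limsup_of_exists b)

end Sequence

/-! ### Test functions on the space-time domain -/

section Test

variable {T : ℝ} {ψ : ℝ × ℝ → ℝ}

lemma IsTest.eq_zero (h : IsTest T ψ) {z : ℝ × ℝ} (hz : z ∉ dom T) : ψ z = 0 :=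
  image_eq_zero_of_notMem_tsupport fun h' => hz (h.support h')

lemma IsTest.exists_bound (h : IsTest T ψ) : ∃ M, 0 ≤ M ∧ ∀ z, |ψ z| ≤ M := by
  obtain ⟨M, hM⟩ := h.compact.exists_bound_of_continuous h.smooth.continuous
  exact ⟨M, (norm_nonneg _).trans (hM 0), hM⟩

lemma IsTest.hasDerivAt_dt (h : IsTest T ψ) (t w : ℝ) :
    HasDerivAt (fun s => ψ (s, w)) (dt ψ (t, w)) t := by
  have : DifferentiableAt ℝ (fun s : ℝ => ψ (s, w)) t :=
    ((h.smooth.differentiable (by simp)).comp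
      (differentiable_id.prodMk (differentiable_const w))) t
  exact this.hasDerivAt

lemma IsTest.dt_eq_fderiv (h : IsTest T ψ) : dt ψ = fun z => fderiv ℝ ψ z (1, 0) := by
  funext z
  have h1 : HasDerivAt (fun s : ℝ => (s, z.2)) ((1 : ℝ), (0 : ℝ)) z.1 :=
    (hasDerivAt_id z.1).prodMk (hasDerivAt_const z.1 z.2)
  have h2 := ((h.smooth.differentiable (by simp)) z).hasFDerivAt
  exact (h2.comp_hasDerivAt z.1 (f := fun s : ℝ => (s, z.2)) h1).deriv

lemma IsTest.dw_eq_fderiv (h : IsTest T ψ) : dw ψ = fun z => fderiv ℝ ψ z (0, 1) := by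
  funext z
  have h1 : HasDerivAt (fun v : ℝ => (z.1, v)) ((0 : ℝ), (1 : ℝ)) z.2 :=
    (hasDerivAt_const z.2 z.1).prodMk (hasDerivAt_id z.2)
  have h2 := ((h.smooth.differentiable (by simp)) z).hasFDerivAt
  exact (h2.comp_hasDerivAt z.2 (f := fun v : ℝ => (z.1, v)) h1).deriv

lemma IsTest.fderiv_apply (h : IsTest T ψ) (v : ℝ × ℝ) :
    IsTest T fun z => fderiv ℝ ψ z v where
  smooth := (h.smooth.fderiv_right (m := ∞) (by simp)).clm_apply contDiff_const
  compact := h.compact.fderiv_apply ℝ v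
  support := (tsupport_fderiv_apply_subset ℝ v).trans h.support

lemma IsTest.dt (h : IsTest T ψ) : IsTest T (dt ψ) := by
  rw [h.dt_eq_fderiv]
  exact h.fderiv_apply _

lemma IsTest.dw (h : IsTest T ψ) : IsTest T (dw ψ) := by
  rw [h.dw_eq_fderiv]
  exact h.fderiv_apply _

lemma IsTest.dt_dw (h : IsTest T ψ) :
    LagrangianCongestion.dt (LagrangianCongestion.dw ψ) =
      LagrangianCongestion.dw (LagrangianCongestion.dt ψ) := by
  rw [h.dw.dt_eq_fderiv, h.dt.dw_eq_fderiv, h.dt_eq_fderiv, h.dw_eq_fderiv]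
  funext z
  have hd : DifferentiableAt ℝ (fderiv ℝ ψ) z :=
    ((h.smooth.fderiv_right (m := ∞) (by simp)).differentiable (by simp)) z
  have hs : IsSymmSndFDerivAt ℝ ψ z :=
    h.smooth.contDiffAt.isSymmSndFDerivAt
      (by simpa using WithTop.coe_le_coe.2 (le_top : (2 : ℕ∞) ≤ ⊤))
  rw [fderiv_clm_apply hd (differentiableAt_const _),
    fderiv_clm_apply hd (differentiableAt_const _)]
  simpa using hs (1, 0) (0, 1)

/-- The slices of test functions at fixed times are test functions. -/
lemma IsTest.slice (h : IsTest T ψ) (t : ℝ) : IsTestI fun w => ψ (t, w) where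
  contDiff := (h.smooth.comp (contDiff_const.prodMk contDiff_id)).of_le (by simp)
  compact := HasCompactSupport.intro isCompact_Icc fun w hw =>
    h.eq_zero fun h' => hw (Ioo_subset_Icc_self h'.2)
  support := fun w hw => (h.support (tsupport_comp_subset_preimage (f := fun v : ℝ => (t, v)) ψ
    (by fun_prop) hw)).2

lemma IsTest.deriv_slice (t : ℝ) : deriv (fun w => ψ (t, w)) = fun w =>
    LagrangianCongestion.dw ψ (t, w) := rfl

/-- Test functions vanish for small times. -/
lemma IsTest.exists_pos_time (h : IsTest T ψ) : ∃ a > 0, ∀ z, ψ z ≠ 0 → a ≤ z.1 := by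
  rcases (tsupport ψ).eq_empty_or_nonempty with he | hne
  · exact ⟨1, one_pos, fun z hz => absurd (subset_tsupport ψ hz) (by rw [he]; exact notMem_empty z)⟩
  · obtain ⟨y, hy, hmin⟩ := IsCompact.exists_isMinOn h.compact hne continuous_fst.continuousOn
    exact ⟨y.1, (h.support hy).1.1, fun z hz => hmin (subset_tsupport ψ hz)⟩

lemma IsTestI.integral_id_mul_deriv {φ : ℝ → ℝ} (h : IsTestI φ) :
    ∫ w in Ioo (0 : ℝ) 1, w * deriv φ w = -∫ w in Ioo (0 : ℝ) 1, φ w := by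
  have hd : ∀ w, HasDerivAt φ (deriv φ w) w := fun w =>
    ((h.contDiff.differentiable one_ne_zero) w).hasDerivAt
  have := intervalIntegral.integral_mul_deriv_eq_deriv_mul (a := 0) (b := 1) (u := fun w : ℝ => w)
    (u' := fun _ => 1) (v := φ) (v' := deriv φ) (fun w _ => hasDerivAt_id w) (fun w _ => hd w)
    intervalIntegrable_const (h.continuous_deriv.intervalIntegrable _ _)
  rw [h.eq_zero (w := 1) (fun h => lt_irrefl _ h.2), h.eq_zero (w := 0) (fun h => lt_irrefl _ h.1)]
    at this
  simpa [intervalIntegral.integral_of_le, integral_Ioc_eq_integral_Ioo] using this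

end Test

/-! ### Integration over the space-time domain -/

section Domain

variable {T : ℝ}

lemma volume_restrict_dom (T : ℝ) : (volume : Measure (ℝ × ℝ)).restrict (dom T) =
    (volume.restrict (Ioo 0 T)).prod (volume.restrict (Ioo 0 1)) := by
  rw [dom, Measure.prod_restrict, Measure.volume_eq_prod]

lemma isFiniteMeasure_dom (T : ℝ) :
    IsFiniteMeasure ((volume : Measure (ℝ × ℝ)).restrict (dom T)) := by
  rw [volume_restrict_dom]
  infer_instance

lemma ae_dom_iff {p : ℝ × ℝ → Prop} (hp : MeasurableSet {z | p z}) :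
    (∀ᵐ z ∂(volume.restrict (dom T)), p z) ↔
      ∀ᵐ t ∂(volume.restrict (Ioo 0 T)), ∀ᵐ w ∂(volume.restrict (Ioo (0 : ℝ) 1)), p (t, w) := by
  rw [volume_restrict_dom, Measure.ae_prod_iff_ae_ae hp]

lemma integrableOn_dom_of_bound {f : ℝ × ℝ → ℝ} (hf : Measurable f) {M : ℝ}
    (hM : ∀ᵐ z ∂(volume.restrict (dom T)), |f z| ≤ M) : IntegrableOn f (dom T) := by
  have := isFiniteMeasure_dom T
  exact Integrable.of_bound hf.aestronglyMeasurable M hM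

lemma integral_dom {f : ℝ × ℝ → ℝ} (hf : IntegrableOn f (dom T)) :
    ∫ z in dom T, f z = ∫ t in Ioo 0 T, ∫ w in Ioo (0 : ℝ) 1, f (t, w) := by
  rw [IntegrableOn, volume_restrict_dom] at hf
  rw [volume_restrict_dom, integral_prod _ hf]

lemma integral_dom_symm {f : ℝ × ℝ → ℝ} (hf : IntegrableOn f (dom T)) :
    ∫ z in dom T, f z = ∫ w in Ioo (0 : ℝ) 1, ∫ t in Ioo 0 T, f (t, w) := by
  rw [IntegrableOn, volume_restrict_dom] at hf
  rw [volume_restrict_dom, integral_prod_symm _ hf]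

lemma integrableOn_integral_slice {f : ℝ × ℝ → ℝ} (hf : IntegrableOn f (dom T)) :
    IntegrableOn (fun t => ∫ w in Ioo (0 : ℝ) 1, f (t, w)) (Ioo 0 T) := by
  rw [IntegrableOn, volume_restrict_dom] at hf
  exact hf.integral_prod_left

lemma IsTest.integrableOn {ψ : ℝ × ℝ → ℝ} (h : IsTest T ψ) : IntegrableOn ψ (dom T) := by
  obtain ⟨M, -, hM⟩ := h.exists_bound
  exact integrableOn_dom_of_bound h.smooth.continuous.measurable (Eventually.of_forall hM)

lemma integrableOn_mul_test {f ψ : ℝ × ℝ → ℝ} (hf : Measurable f) {M : ℝ}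
    (hM : ∀ᵐ z ∂(volume.restrict (dom T)), |f z| ≤ M) (h : IsTest T ψ) :
    IntegrableOn (fun z => f z * ψ z) (dom T) :=
  Integrable.bdd_mul (c := M) h.integrableOn hf.aestronglyMeasurable hM

end Domain

/-! ### The limit system -/

/-- Measurable functions that are bounded almost everywhere on the space-time domain. -/
def BoundedMeasurable (T : ℝ) (f : ℝ × ℝ → ℝ) : Prop :=
  Measurable f ∧ ∃ M, ∀ᵐ z ∂(volume.restrict (dom T)), |f z| ≤ M

section BoundedMeasurable

variable {T : ℝ} {f g : ℝ × ℝ → ℝ}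

lemma BoundedMeasurable.integrableOn (hf : BoundedMeasurable T f) : IntegrableOn f (dom T) := by
  obtain ⟨h1, M, hM⟩ := hf
  exact integrableOn_dom_of_bound h1 hM

lemma BoundedMeasurable.add (hf : BoundedMeasurable T f) (hg : BoundedMeasurable T g) :
    BoundedMeasurable T fun z => f z + g z := by
  obtain ⟨h1, M, hM⟩ := hf
  obtain ⟨h2, K, hK⟩ := hg
  refine ⟨h1.add h2, M + K, ?_⟩
  filter_upwards [hM, hK] with z a b using (abs_add_le _ _).trans (add_le_add a b)

lemma BoundedMeasurable.mul (hf : BoundedMeasurable T f) (hg : BoundedMeasurable T g) :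
    BoundedMeasurable T fun z => f z * g z := by
  obtain ⟨h1, M, hM⟩ := hf
  obtain ⟨h2, K, hK⟩ := hg
  refine ⟨h1.mul h2, M * K, ?_⟩
  filter_upwards [hM, hK] with z a b
  rw [abs_mul]
  exact mul_le_mul a b (abs_nonneg _) ((abs_nonneg _).trans a)

lemma BoundedMeasurable.neg (hf : BoundedMeasurable T f) : BoundedMeasurable T fun z => -f z := by
  obtain ⟨h1, M, hM⟩ := hf
  exact ⟨h1.neg, M, by simpa only [abs_neg] using hM⟩

lemma BoundedMeasurable.sub (hf : BoundedMeasurable T f) (hg : BoundedMeasurable T g) :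
    BoundedMeasurable T fun z => f z - g z := by
  simpa only [sub_eq_add_neg] using hf.add hg.neg

lemma IsTest.boundedMeasurable (h : IsTest T f) : BoundedMeasurable T f := by
  obtain ⟨M, -, hM⟩ := h.exists_bound
  exact ⟨h.smooth.continuous.measurable, M, Eventually.of_forall hM⟩

lemma ae_dom_of_forall {p : ℝ × ℝ → Prop} (h : ∀ z ∈ dom T, p z) :
    ∀ᵐ z ∂(volume.restrict (dom T)), p z :=
  (ae_restrict_iff' (measurableSet_dom T)).2 (Eventually.of_forall h)

lemma integral_dom_eq_zero (hf : IntegrableOn f (dom T))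
    (h : ∀ᵐ t ∂(volume.restrict (Ioo 0 T)), ∫ w in Ioo (0 : ℝ) 1, f (t, w) = 0) :
    ∫ z in dom T, f z = 0 := by
  rw [integral_dom hf]
  exact (integral_congr_ae h).trans (by simp)

lemma integral_dom_symm_eq_zero (hf : IntegrableOn f (dom T))
    (h : ∀ᵐ w ∂(volume.restrict (Ioo (0 : ℝ) 1)), ∫ t in Ioo 0 T, f (t, w) = 0) :
    ∫ z in dom T, f z = 0 := by
  rw [integral_dom_symm hf]
  exact (integral_congr_ae h).trans (by simp)

end BoundedMeasurable

/-- For continuous functions, differentiability is a countable condition. -/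
lemma hasDerivAt_iff_forall_rat {f : ℝ → ℝ} (hf : Continuous f) (d t : ℝ) :
    HasDerivAt f d t ↔ ∀ n : ℕ, ∃ m : ℕ, ∀ q : ℚ, |(q : ℝ)| < 1 / ((m : ℝ) + 1) →
      |f (t + q) - f t - q * d| ≤ 1 / ((n : ℝ) + 1) * |(q : ℝ)| := by
  rw [hasDerivAt_iff_isLittleO_nhds_zero, Asymptotics.isLittleO_iff]
  constructor
  · intro h n
    obtain ⟨ε, hε, hb⟩ := Metric.eventually_nhds_iff.1
      (h (Nat.one_div_pos_of_nat (α := ℝ) (n := n)))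
    obtain ⟨m, hm⟩ := exists_nat_one_div_lt hε
    refine ⟨m, fun q hq => ?_⟩
    have := hb (y := (q : ℝ)) (by rw [Real.dist_eq, sub_zero]; exact hq.trans hm)
    simpa only [Real.norm_eq_abs, smul_eq_mul] using this
  · intro h c hc
    obtain ⟨n, hn⟩ := exists_nat_one_div_lt hc
    obtain ⟨m, hm⟩ := h n
    refine Metric.eventually_nhds_iff.2 ⟨1 / ((m : ℝ) + 1), by positivity, fun y hy => ?_⟩
    have hclosed : IsClosed {r : ℝ | |f (t + r) - f t - r * d| ≤ 1 / ((n : ℝ) + 1) * |r|} :=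
      isClosed_le (by fun_prop) (by fun_prop)
    have hsub : Metric.ball (0 : ℝ) (1 / ((m : ℝ) + 1)) ⊆
        {r : ℝ | |f (t + r) - f t - r * d| ≤ 1 / ((n : ℝ) + 1) * |r|} := by
      refine ((Rat.denseRange_cast (𝕜 := ℝ)).open_subset_closure_inter Metric.isOpen_ball).trans
        (closure_minimal ?_ hclosed)
      rintro _ ⟨hr, q, rfl⟩
      rw [Metric.mem_ball, Real.dist_eq, sub_zero] at hr
      exact hm q hr
    have := hsub hy
    simp only [mem_ofPred_eq] at this
    simp only [Real.norm_eq_abs, smul_eq_mul]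
    exact this.trans (mul_le_mul_of_nonneg_right hn.le (abs_nonneg _))

section Limit

variable {T C R : ℝ} {X U l : ℝ → ℝ → ℝ} {V0 : ℝ → ℝ}

lemma LimitFlow.bm_vel (h : LimitFlow T C R X U l V0) :
    BoundedMeasurable T fun z => U z.1 z.2 := by
  refine ⟨h.meas_vel, C, (ae_dom_iff (measurableSet_le h.meas_vel.abs measurable_const)).2 ?_⟩
  filter_upwards [h.vel_bound] with t ht
  exact (ae_restrict_iff' measurableSet_Ioo).2 (Eventually.of_forall ht)

lemma LimitFlow.bm_pos (h : LimitFlow T C R X U l V0) : BoundedMeasurable T fun z => X z.1 z.2 :=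
  ⟨h.meas_pos, R, ae_dom_of_forall fun _ hz => h.pos_bound _ _ hz.2⟩

lemma bm_snd : BoundedMeasurable T fun z => z.2 :=
  ⟨measurable_snd, 1, ae_dom_of_forall fun z hz => by
    rw [abs_of_pos hz.2.1]
    exact hz.2.2.le⟩

lemma LimitFlow.bm_mult (h : LimitFlow T C R X U l V0) : BoundedMeasurable T fun z => l z.1 z.2 :=
  ⟨h.meas_mult, 2 * C, Eventually.of_forall fun z => by
    rw [abs_of_nonneg (h.mult_mem _ _).1]
    exact (h.mult_mem _ _).2⟩

lemma LimitFlow.bm_vel0 (h : LimitFlow T C R X U l V0) : BoundedMeasurable T fun z => V0 z.2 :=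
  ⟨h.meas_vel0.comp measurable_snd, C, ae_dom_of_forall fun _ hz => h.vel0_bound _ hz.2⟩

lemma LimitFlow.abs_mult_le (h : LimitFlow T C R X U l V0) (t w : ℝ) : |l t w| ≤ 2 * C := by
  rw [abs_of_nonneg (h.mult_mem _ _).1]
  exact (h.mult_mem _ _).2

lemma LimitFlow.abs_gap_le (h : LimitFlow T C R X U l V0) (t : ℝ) {w : ℝ}
    (hw : w ∈ Ioo (0 : ℝ) 1) : |X t w - w| ≤ R + 1 :=
  (abs_sub _ _).trans (add_le_add (h.pos_bound t w hw) (by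
    rw [abs_of_pos hw.1]
    exact hw.2.le))

lemma LimitFlow.ae_ae_vel_bound (h : LimitFlow T C R X U l V0) :
    ∀ᵐ w ∂(volume.restrict (Ioo (0 : ℝ) 1)), ∀ᵐ t ∂(volume.restrict (Ioo 0 T)), |U t w| ≤ C := by
  refine (Measure.ae_ae_comm (p := fun t w => |U t w| ≤ C)
    (measurableSet_le h.meas_vel.abs measurable_const)).1 ?_
  filter_upwards [h.vel_bound] with t ht
  exact (ae_restrict_iff' measurableSet_Ioo).2 (Eventually.of_forall ht)

lemma LimitFlow.lipschitzWith (h : LimitFlow T C R X U l V0) {w : ℝ} (hw : w ∈ Ioo (0 : ℝ) 1) :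
    LipschitzWith C.toNNReal fun t => X t w :=
  LipschitzWith.of_dist_le_mul fun t s =>
    (h.pos_lip s t w hw).trans (mul_le_mul_of_nonneg_right (Real.le_coe_toNNReal C) (abs_nonneg _))

lemma LimitFlow.ae_ae_hasDerivAt (hT : 0 < T) (h : LimitFlow T C R X U l V0) :
    ∀ᵐ w ∂(volume.restrict (Ioo (0 : ℝ) 1)), ∀ᵐ t ∂(volume.restrict (Ioo 0 T)),
      HasDerivAt (fun s => X s w) (U t w) t := by
  filter_upwards [h.ae_ae_vel_bound, h.pos_ftc] with w hb hftc
  have hm : Measurable fun t => U t w := h.meas_vel.comp (measurable_id.prodMk measurable_const)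
  have hi : IntervalIntegrable (fun t => U t w) volume 0 T := by
    rw [intervalIntegrable_iff_integrableOn_Ioo_of_le hT.le]
    exact Integrable.of_bound hm.aestronglyMeasurable C hb
  rw [ae_restrict_iff' measurableSet_Ioo]
  filter_upwards [hi.ae_hasDerivAt_integral] with t ht hmem
  rw [uIcc_of_le hT.le] at ht
  have h1 := (ht (Ioo_subset_Icc_self hmem) 0 (left_mem_Icc.2 hT.le)).const_add (X 0 w)
  refine h1.congr_of_eventuallyEq ?_
  filter_upwards [isOpen_Ioo.mem_nhds hmem] with s hs
  have := hftc 0 (left_mem_Icc.2 hT.le) s (Ioo_subset_Icc_self hs)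
  linarith

theorem LimitFlow.ae_hasDerivAt (hT : 0 < T) (h : LimitFlow T C R X U l V0) :
    ∀ᵐ z ∂(volume.restrict (dom T)), HasDerivAt (fun s => X s z.2) (U z.1 z.2) z.1 := by
  set S : ℝ × ℝ → Prop := fun z => ∀ n : ℕ, ∃ m : ℕ, ∀ q : ℚ, |(q : ℝ)| < 1 / ((m : ℝ) + 1) →
      |X (z.1 + q) z.2 - X z.1 z.2 - q * U z.1 z.2| ≤ 1 / ((n : ℝ) + 1) * |(q : ℝ)| with hS
  have hmeas : MeasurableSet {z | S z} := by
    have hq : ∀ n m : ℕ, ∀ q : ℚ, MeasurableSet {z : ℝ × ℝ | |(q : ℝ)| < 1 / ((m : ℝ) + 1) →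
        |X (z.1 + q) z.2 - X z.1 z.2 - q * U z.1 z.2| ≤ 1 / ((n : ℝ) + 1) * |(q : ℝ)|} := by
      intro n m q
      have h1 : Measurable fun z : ℝ × ℝ => X (z.1 + q) z.2 :=
        h.meas_pos.comp ((measurable_fst.add_const _).prodMk measurable_snd)
      exact (MeasurableSet.const _).imp
        (measurableSet_le ((h1.sub h.meas_pos).sub (h.meas_vel.const_mul _)).abs measurable_const)
    have e : {z | S z} = ⋂ n : ℕ, ⋃ m : ℕ, ⋂ q : ℚ, {z : ℝ × ℝ | |(q : ℝ)| < 1 / ((m : ℝ) + 1) →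
        |X (z.1 + q) z.2 - X z.1 z.2 - q * U z.1 z.2| ≤ 1 / ((n : ℝ) + 1) * |(q : ℝ)|} := by
      ext z
      simp only [hS, mem_ofPred_eq, mem_iInter, mem_iUnion]
    rw [e]
    exact MeasurableSet.iInter fun n => MeasurableSet.iUnion fun m => MeasurableSet.iInter fun q =>
      hq n m q
  have h1 : ∀ᵐ z ∂(volume.restrict (dom T)), S z := by
    rw [ae_dom_iff hmeas]
    refine (Measure.ae_ae_comm (p := fun t w => S (t, w)) hmeas).2 ?_
    filter_upwards [h.ae_ae_hasDerivAt hT, ae_restrict_mem measurableSet_Ioo] with w hw hmem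
    filter_upwards [hw] with t ht
    exact (hasDerivAt_iff_forall_rat (h.lipschitzWith hmem).continuous _ _).1 ht
  filter_upwards [h1, ae_restrict_mem (measurableSet_dom T)] with z hz hmem
  exact (hasDerivAt_iff_forall_rat (h.lipschitzWith hmem.2).continuous _ _).2 hz

lemma IsTest.eq_neg_integral_dt {ψ : ℝ × ℝ → ℝ} (hψ : IsTest T ψ) (s w : ℝ) :
    ψ (s, w) = -∫ t in s..T, LagrangianCongestion.dt ψ (t, w) := by
  have hc : Continuous fun t => LagrangianCongestion.dt ψ (t, w) :=
    hψ.dt.smooth.continuous.comp (continuous_id.prodMk continuous_const)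
  rw [intervalIntegral.integral_eq_sub_of_hasDerivAt (fun t _ => hψ.hasDerivAt_dt t w)
    (hc.intervalIntegrable _ _), hψ.eq_zero (z := (T, w)) fun h' => lt_irrefl _ h'.1.2]
  ring

lemma IsTest.integrableOn_slice_time {ψ : ℝ × ℝ → ℝ} (hψ : IsTest T ψ) (w : ℝ) :
    IntegrableOn (fun t => ψ (t, w)) (Ioo 0 T) :=
  ((hψ.smooth.continuous.comp (continuous_id.prodMk continuous_const)).integrableOn_Icc
    (a := 0) (b := T)).mono_set Ioo_subset_Icc_self

/-- The product rule in time for `(X - w) ψ`, in integrated form. -/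
lemma LimitFlow.ae_gap_mul_eq (hT : 0 < T) (h : LimitFlow T C R X U l V0) {ψ : ℝ × ℝ → ℝ}
    (hψ : IsTest T ψ) : ∀ᵐ w ∂(volume.restrict (Ioo (0 : ℝ) 1)),
      IntegrableOn (fun t => U t w * ψ (t, w) + (X t w - w) * dt ψ (t, w)) (Ioo 0 T) ∧
      ∀ s ∈ Icc 0 T, (X s w - w) * ψ (s, w) =
        -∫ t in s..T, (U t w * ψ (t, w) + (X t w - w) * dt ψ (t, w)) := by
  filter_upwards [h.ae_ae_vel_bound, h.ae_ae_hasDerivAt hT, ae_restrict_mem measurableSet_Ioo]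
    with w hb hd hw
  have hm : ∀ {f : ℝ → ℝ → ℝ}, (Measurable fun z : ℝ × ℝ => f z.1 z.2) →
      Measurable fun t => f t w := fun hf => hf.comp (measurable_id.prodMk measurable_const)
  refine ⟨(Integrable.bdd_mul (c := C) (hψ.integrableOn_slice_time w)
    (hm h.meas_vel).aestronglyMeasurable hb).add (Integrable.bdd_mul (c := R + 1)
      (hψ.dt.integrableOn_slice_time w) ((hm h.meas_pos).sub_const w).aestronglyMeasurable
      (Eventually.of_forall fun t => h.abs_gap_le t hw)), fun s hs => ?_⟩
  have h1 : AbsolutelyContinuousOnInterval (fun t => X t w - w) s T := by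
    refine LipschitzOnWith.absolutelyContinuousOnInterval (K := C.toNNReal) ?_
    refine LipschitzOnWith.of_dist_le_mul fun t _ r _ => ?_
    rw [Real.dist_eq, sub_sub_sub_cancel_right]
    exact (h.lipschitzWith hw).dist_le_mul t r
  have h2 : AbsolutelyContinuousOnInterval (fun t => ψ (t, w)) s T :=
    ContDiffOn.absolutelyContinuousOnInterval
      ((hψ.smooth.comp (contDiff_id.prodMk contDiff_const)).of_le (by simp)).contDiffOn
  have h3 := h1.integral_deriv_mul_eq_sub h2
  rw [hψ.eq_zero (z := (T, w)) fun h' => lt_irrefl _ h'.1.2, mul_zero, zero_sub] at h3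
  rw [← neg_eq_iff_eq_neg, ← h3]
  refine intervalIntegral.integral_congr_ae ?_
  filter_upwards [ae_uIoc_of_ae_Ioo hd hs (right_mem_Icc.2 hT.le)] with t ht hmem
  rw [((ht hmem).sub_const w).deriv]
  rfl

/-- The momentum equation is the time derivative of the velocity equation `U + ∂_w l = V0`. -/
theorem LimitFlow.momentumEq (hT : 0 < T) (h : LimitFlow T C R X U l V0) :
    MomentumEq T U (timeDerivMeasure T (2 * C) l) := by
  intro ψ hψ
  obtain ⟨M, -, hM⟩ := hψ.dw.exists_bound
  have e1 := integral_timeDerivMeasure hT h.meas_mult h.mult_mono h.abs_mult_le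
    hψ.dw.smooth.continuous.measurable hM (fun z hz => hψ.dw.eq_zero hz)
    (ψ' := fun t w => dt (dw ψ) (t, w))
    (Eventually.of_forall fun w => ⟨hψ.dw.dt.integrableOn_slice_time w,
      fun s _ => hψ.dw.eq_neg_integral_dt s w⟩)
  have b1 := h.bm_mult.mul hψ.dw.dt.boundedMeasurable
  have b2 := h.bm_vel0.mul hψ.dt.boundedMeasurable
  have b3 := h.bm_vel.mul hψ.dt.boundedMeasurable
  -- The time-dependent test function `∂_t ψ` is inserted in the velocity equation at each time.
  have e2 : ∫ z in dom T,
      (l z.1 z.2 * dt (dw ψ) z + (V0 z.2 * dt ψ z - U z.1 z.2 * dt ψ z)) = 0 := by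
    refine integral_dom_eq_zero (b1.add (b2.sub b3)).integrableOn ?_
    filter_upwards [h.mult_weak] with t ht
    refine Eq.trans ?_ (ht _ (hψ.dt.slice t).contDiff)
    refine setIntegral_congr_fun measurableSet_Ioo fun w _ => ?_
    simp only [IsTest.deriv_slice, hψ.dt_dw]
    ring
  have e3 : ∫ z in dom T, V0 z.2 * dt ψ z = 0 := by
    refine integral_dom_symm_eq_zero b2.integrableOn (Eventually.of_forall fun w => ?_)
    have e4 := hψ.eq_neg_integral_dt 0 w
    rw [hψ.eq_zero (z := (0, w)) fun h' => lt_irrefl _ h'.1.1,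
      intervalIntegral.integral_of_le hT.le, integral_Ioc_eq_integral_Ioo] at e4
    simp only
    rw [integral_const_mul, show ∫ t in Ioo 0 T, dt ψ (t, w) = 0 by linarith, mul_zero]
  rw [integral_add b1.integrableOn (b2.sub b3).integrableOn,
    integral_sub b2.integrableOn b3.integrableOn, e3] at e2
  rw [e1, ← integral_dom_symm b1.integrableOn]
  linarith

theorem LimitFlow.congestionConstraint (h : LimitFlow T C R X U l V0) :
    CongestionConstraint T X := by
  intro ψ hψ h0
  have b1 := h.bm_pos.mul hψ.dw.boundedMeasurable
  have b2 := bm_snd.mul hψ.dw.boundedMeasurable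
  have e1 : ∫ z in dom T, (X z.1 z.2 * dw ψ z - z.2 * dw ψ z) ≤ 0 := by
    rw [integral_dom (b1.sub b2).integrableOn]
    refine integral_nonpos fun t => ?_
    have := integral_mul_deriv_nonpos_of_monotoneOn (h.pos_sub_mono t)
      (fun w hw => h.abs_gap_le t hw) (hψ.slice t) fun w => h0 _
    refine le_trans (le_of_eq ?_) this
    refine setIntegral_congr_fun measurableSet_Ioo fun w _ => ?_
    simp only [IsTest.deriv_slice]
    ring
  have e2 : ∫ z in dom T, z.2 * dw ψ z = -∫ z in dom T, ψ z := by
    rw [integral_dom b2.integrableOn, integral_dom hψ.integrableOn, ← integral_neg]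
    exact integral_congr_ae (Eventually.of_forall fun t => (hψ.slice t).integral_id_mul_deriv)
  rw [integral_sub b1.integrableOn b2.integrableOn, e2] at e1
  linarith

/-- Integration by parts in time turns `∫ (X - w) ∂_w ψ d(∂_t l)` into an integral of
`l ∂_t ((X - w) ∂_w ψ)`. The exclusion relation is then the sum of `LimitFlow.orth_pos`, tested with
`∂_t ψ`, and `LimitFlow.orth_vel`, tested with `ψ`. -/
theorem LimitFlow.exclusionRelation (hT : 0 < T) (h : LimitFlow T C R X U l V0) :
    ExclusionRelation T X U (timeDerivMeasure T (2 * C) l) := by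
  intro ψ hψ
  obtain ⟨M, hM0, hM⟩ := hψ.dw.exists_bound
  have e1 := integral_timeDerivMeasure hT h.meas_mult h.mult_mono h.abs_mult_le
    (ψ := fun z => (X z.1 z.2 - z.2) * dw ψ z) (M := |R + 1| * M)
    ((h.meas_pos.sub measurable_snd).mul hψ.dw.smooth.continuous.measurable)
    (fun z => by
      by_cases hz : z ∈ dom T
      · rw [abs_mul]
        exact mul_le_mul ((h.abs_gap_le _ hz.2).trans (le_abs_self _)) (hM z) (abs_nonneg _)
          (abs_nonneg _)
      · rw [hψ.dw.eq_zero hz, mul_zero, abs_zero]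
        positivity)
    (fun z hz => by rw [hψ.dw.eq_zero hz, mul_zero])
    (h.ae_gap_mul_eq hT hψ.dw)
  have bg := h.bm_pos.sub (bm_snd (T := T))
  have bV := h.bm_vel0.sub h.bm_vel
  have bD := (h.bm_vel.mul hψ.boundedMeasurable).add (bg.mul hψ.dt.boundedMeasurable)
  have bE := (h.bm_vel.mul hψ.dw.boundedMeasurable).add (bg.mul hψ.dw.dt.boundedMeasurable)
  have b1 := bg.mul ((h.bm_mult.mul hψ.dw.dt.boundedMeasurable).add
    (bV.mul hψ.dt.boundedMeasurable))
  have b2 := h.bm_vel.mul ((h.bm_mult.mul hψ.dw.boundedMeasurable).add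
    (bV.mul hψ.boundedMeasurable))
  have e2 := integral_dom_eq_zero b1.integrableOn (by
    filter_upwards [h.orth_pos] with t ht
    refine Eq.trans ?_ (ht _ (hψ.dt.slice t).contDiff)
    simp only [IsTest.deriv_slice, hψ.dt_dw])
  have e3 := integral_dom_eq_zero b2.integrableOn (by
    filter_upwards [h.orth_vel] with t ht
    refine Eq.trans ?_ (ht _ (hψ.slice t).contDiff)
    simp only [IsTest.deriv_slice])
  -- The initial velocity contributes nothing, being constant in time while `(X - w) ψ` vanishes at
  -- both end times.
  have e4 := integral_dom_symm_eq_zero (h.bm_vel0.mul bD).integrableOn (by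
    filter_upwards [h.ae_gap_mul_eq hT hψ] with w hw
    have e := hw.2 0 (left_mem_Icc.2 hT.le)
    rw [hψ.eq_zero (z := (0, w)) fun h' => lt_irrefl _ h'.1.1, mul_zero,
      intervalIntegral.integral_of_le hT.le, integral_Ioc_eq_integral_Ioo] at e
    rw [integral_const_mul, show ∫ t in Ioo 0 T, (U t w * ψ (t, w) + (X t w - w) * dt ψ (t, w)) = 0
      by linarith, mul_zero])
  have e5 : ∫ z in dom T, U z.1 z.2 * dt (fun y => (X y.1 y.2 - y.2) * ψ y) z =
      ∫ z in dom T, U z.1 z.2 * (U z.1 z.2 * ψ z + (X z.1 z.2 - z.2) * dt ψ z) := by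
    refine integral_congr_ae ?_
    filter_upwards [h.ae_hasDerivAt hT] with z hz
    congr 1
    exact ((hz.sub_const z.2).mul (hψ.hasDerivAt_dt z.1 z.2)).deriv
  have e6 := integral_add b1.integrableOn b2.integrableOn
  have e7 := integral_add (h.bm_mult.mul bE).integrableOn
    ((h.bm_vel0.mul bD).sub (h.bm_vel.mul bD)).integrableOn
  have e8 := integral_sub (h.bm_vel0.mul bD).integrableOn (h.bm_vel.mul bD).integrableOn
  have e9 : ∀ z : ℝ × ℝ, (X z.1 z.2 - z.2) * (l z.1 z.2 * dt (dw ψ) z +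
      (V0 z.2 - U z.1 z.2) * dt ψ z) + U z.1 z.2 * (l z.1 z.2 * dw ψ z +
      (V0 z.2 - U z.1 z.2) * ψ z) =
      l z.1 z.2 * (U z.1 z.2 * dw ψ z + (X z.1 z.2 - z.2) * dt (dw ψ) z) +
      (V0 z.2 * (U z.1 z.2 * ψ z + (X z.1 z.2 - z.2) * dt ψ z) -
        U z.1 z.2 * (U z.1 z.2 * ψ z + (X z.1 z.2 - z.2) * dt ψ z)) := fun z => by ring
  simp only [e9] at e6
  have e10 := integral_dom_symm (h.bm_mult.mul bE).integrableOn
  simp only at e10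
  rw [e5, e1, ← e10]
  linarith

/-- Since `(X - w) / t - U` is nondecreasing in `w`, the distribution `∂_w X / t - ∂_w U` is at
least `1 / t`, which is at least `1 / T`: hence the strict sign. -/
theorem LimitFlow.oleinikStrict (hT : 0 < T) (h : LimitFlow T C R X U l V0) :
    OleinikStrict T X U := by
  intro ψ hψ h0 ⟨z0, hz0⟩
  obtain ⟨a, ha, hat⟩ := hψ.dw.exists_pos_time
  obtain ⟨M, hM0, hM⟩ := hψ.dw.exists_bound
  have b1 : BoundedMeasurable T fun z => X z.1 z.2 / z.1 * dw ψ z := by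
    refine ⟨(h.meas_pos.div measurable_fst).mul hψ.dw.smooth.continuous.measurable, R / a * M,
      ae_dom_of_forall fun z hz => ?_⟩
    have hR := (abs_nonneg _).trans (h.pos_bound z.1 _ hz.2)
    by_cases hne : dw ψ z = 0
    · simp only [hne, mul_zero, abs_zero]
      positivity
    · rw [abs_mul, abs_div, abs_of_pos hz.1.1]
      exact mul_le_mul (div_le_div₀ hR (h.pos_bound _ _ hz.2) ha (hat z hne)) (hM z) (abs_nonneg _)
        (by positivity)
  have b2 := h.bm_vel.mul hψ.dw.boundedMeasurable
  have hpos : 0 < ∫ z in dom T, ψ z := by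
    rw [setIntegral_eq_integral_of_forall_compl_eq_zero fun z hz => hψ.eq_zero hz]
    exact hψ.smooth.continuous.integral_pos_of_hasCompactSupport_nonneg_nonzero hψ.compact h0 hz0
  have key : 1 / T * ∫ z in dom T, ψ z ≤
      ∫ z in dom T, (U z.1 z.2 * dw ψ z - X z.1 z.2 / z.1 * dw ψ z) := by
    rw [integral_dom (b2.sub b1).integrableOn, integral_dom hψ.integrableOn, ← integral_const_mul]
    refine integral_mono_ae ((integrableOn_integral_slice hψ.integrableOn).const_mul _)
      (integrableOn_integral_slice (b2.sub b1).integrableOn) ?_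
    filter_upwards [h.oleinik, ae_restrict_mem measurableSet_Ioo] with t ⟨F, hF, hFb, hU⟩ ht
    have hφ := hψ.slice t
    have hle := integral_mul_deriv_nonpos_of_monotoneOn hF hFb hφ fun w => h0 _
    have hψ0 : 0 ≤ ∫ w in Ioo (0 : ℝ) 1, ψ (t, w) := integral_nonneg fun w => h0 _
    have i1 : IntegrableOn (fun w => F w * deriv (fun w => ψ (t, w)) w) (Ioo 0 1) := by
      obtain ⟨K, hK⟩ := hφ.exists_bound_deriv
      exact Integrable.mul_bdd (c := K) (integrableOn_of_monotoneOn hF hFb)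
        hφ.continuous_deriv.aestronglyMeasurable (Eventually.of_forall hK)
    have i2 : IntegrableOn (fun w => w * deriv (fun w => ψ (t, w)) w) (Ioo 0 1) :=
      ((continuous_id.mul hφ.continuous_deriv).integrableOn_Icc).mono_set Ioo_subset_Icc_self
    have e1 : ∫ w in Ioo (0 : ℝ) 1, (U t w * dw ψ (t, w) - X t w / t * dw ψ (t, w)) =
        ∫ w in Ioo (0 : ℝ) 1, (-(1 / t) * (w * deriv (fun w => ψ (t, w)) w) -
          F w * deriv (fun w => ψ (t, w)) w) := by
      refine integral_congr_ae ?_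
      filter_upwards [hU] with w hw
      rw [hw, IsTest.deriv_slice]
      ring
    rw [e1, integral_sub (i2.const_mul _) i1, integral_const_mul, hφ.integral_id_mul_deriv]
    have h2 : 1 / T ≤ 1 / t := one_div_le_one_div_of_le ht.1 ht.2.le
    have h3 := mul_le_mul_of_nonneg_right h2 hψ0
    linarith
  rw [integral_sub b2.integrableOn b1.integrableOn] at key
  have : 0 < 1 / T * ∫ z in dom T, ψ z := by positivity
  linarith

/-! ### Function spaces for the limit velocity -/

theorem LimitFlow.memLinfty (h : LimitFlow T C R X U l V0) : MemLinfty T U := by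
  obtain ⟨h1, M, hM⟩ := h.bm_vel
  exact memLp_top_of_bound h1.aestronglyMeasurable M hM

/-- The bound for the total variations of the velocities at time `t` that results from the Oleinik
inequality. -/
def variationBound (C R t : ℝ) : ℝ := 2 * ((R + 1) / t) + 2 * ((R + 1) / t + C)

lemma antitoneOn_variationBound {C R : ℝ} (hR : 0 ≤ R) :
    AntitoneOn (variationBound C R) (Ioi 0) := by
  intro s hs t ht hst
  have : (R + 1) / t ≤ (R + 1) / s := div_le_div_of_nonneg_left (by linarith) hs hst
  simp only [variationBound]
  linarith

lemma LimitFlow.ae_isBV (h : LimitFlow T C R X U l V0) (hR : 0 ≤ R) :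
    ∀ᵐ t ∂(volume.restrict (Ioo 0 T)), IsBV (U t) ∧
      ((derivMeasure (U t)).totalVariation univ).toReal ≤ variationBound C R t := by
  filter_upwards [h.oleinik, ae_restrict_mem measurableSet_Ioo] with t ⟨F, hF, hFb, hU⟩ ht
  have h1 : 0 ≤ (R + 1) / t := div_nonneg (by linarith) ht.1.le
  refine isBV_of_ae_eq_sub h1 (f := fun w => (X t w - w) / t) ?_ hF (fun w hw => ?_) hFb hU
  · exact fun v hv w hw hvw => div_le_div_of_nonneg_right (h.pos_sub_mono t hv hw hvw) ht.1.le
  · rw [abs_div, abs_of_pos ht.1]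
    exact div_le_div_of_nonneg_right (h.abs_gap_le t hw) ht.1.le

/-- A velocity field whose values and total variations are bounded by a function that is decreasing
in time belongs to `L^∞(α, T; BV)`. -/
lemma memLinftyBV_of_ae {α : ℝ} (hα : 0 < α) {u : ℝ → ℝ → ℝ} {K : ℝ → ℝ}
    (hK : AntitoneOn K (Ioi 0)) (hm : Measurable fun z : ℝ × ℝ => u z.1 z.2)
    (h : ∀ᵐ t ∂(volume.restrict (Ioo 0 T)), (∀ w ∈ Ioo (0 : ℝ) 1, |u t w| ≤ K t) ∧ IsBV (u t) ∧
      ((derivMeasure (u t)).totalVariation univ).toReal ≤ K t) : MemLinftyBV α T u := by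
  refine ⟨hm.aestronglyMeasurable, K α + K α, ?_⟩
  have hsub : Ioo α T ⊆ Ioo 0 T := Ioo_subset_Ioo_left hα.le
  filter_upwards [ae_restrict_of_ae_restrict_of_subset hsub h, ae_restrict_mem measurableSet_Ioo]
    with t ht hmem
  have hKt : K t ≤ K α := hK hα (hα.trans hmem.1) hmem.1.le
  refine ⟨ht.2.1, add_le_add (le_trans ?_ hKt) (ht.2.2.trans hKt)⟩
  have := norm_integral_le_of_norm_le_const (f := fun w => |u t w|) (C := K t)
    (μ := volume.restrict (Ioo (0 : ℝ) 1))
    ((ae_restrict_iff' measurableSet_Ioo).2 (Eventually.of_forall fun w hw => by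
      rw [Real.norm_eq_abs, abs_abs]
      exact ht.1 w hw))
  refine (le_abs_self _).trans (this.trans_eq ?_)
  simp [Measure.real]

theorem LimitFlow.memLinftyBV (h : LimitFlow T C R X U l V0) (hR : 0 ≤ R) (hC : 0 ≤ C) {α : ℝ}
    (hα : 0 < α) : MemLinftyBV α T U := by
  refine memLinftyBV_of_ae (K := variationBound C R) hα (antitoneOn_variationBound hR) h.meas_vel ?_
  filter_upwards [h.vel_bound, h.ae_isBV hR, ae_restrict_mem measurableSet_Ioo] with t h1 h2 ht
  refine ⟨fun w hw => (h1 w hw).trans ?_, h2⟩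
  have : 0 ≤ (R + 1) / t := div_nonneg (by linarith) ht.1.le
  simp only [variationBound]
  linarith

end Limit

/-! ### Convergence of the interpolations -/

lemma tendstoUniformlyOn_of_lipschitz {g : ℕ → ℝ → ℝ} {T L : ℝ} (hL : 0 ≤ L)
    (hg : ∀ k s t, |g k t - g k s| ≤ L * |t - s|)
    (h : ∀ t, Tendsto (fun k => g k t) atTop (𝓝 0)) :
    TendstoUniformlyOn g (fun _ => 0) atTop (Icc 0 T) := by
  rw [Metric.tendstoUniformlyOn_iff]
  intro ε hε
  obtain ⟨F, -, hF, hcov⟩ := (isCompact_Icc (a := (0 : ℝ)) (b := T)).finite_cover_balls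
    (show 0 < ε / (2 * (L + 1)) by positivity)
  have h1 : ∀ᶠ k in atTop, ∀ s ∈ F, |g k s| < ε / 2 := by
    refine (eventually_all_finite hF).2 fun s _ => ?_
    filter_upwards [(Metric.tendsto_nhds.1 (h s)) (ε / 2) (by positivity)] with k hk
    rwa [Real.dist_eq, sub_zero] at hk
  filter_upwards [h1] with k hk t ht
  obtain ⟨s, hs, hts⟩ := mem_iUnion₂.1 (hcov ht)
  rw [Metric.mem_ball, Real.dist_eq, lt_div_iff₀ (by positivity)] at hts
  have h2 := hg k s t
  have h3 := hk s hs
  have h4 := abs_sub_abs_le_abs_sub (g k t) (g k s)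
  rw [Real.dist_eq, zero_sub, abs_neg]
  nlinarith [abs_nonneg (t - s)]

lemma tendstoUniformlyOn_of_le_add {g g' : ℕ → ℝ → ℝ} {A : Set ℝ}
    (hg : TendstoUniformlyOn g (fun _ => 0) atTop A) {e : ℕ → ℝ} (he : Tendsto e atTop (𝓝 0))
    (h : ∀ k, ∀ t ∈ A, 0 ≤ g' k t ∧ g' k t ≤ e k + g k t) :
    TendstoUniformlyOn g' (fun _ => 0) atTop A := by
  rw [Metric.tendstoUniformlyOn_iff] at hg ⊢
  intro ε hε
  filter_upwards [hg (ε / 2) (by positivity), (Metric.tendsto_nhds.1 he) (ε / 2) (by positivity)]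
    with k h1 h2 t ht
  have h3 := h1 t ht
  rw [Real.dist_eq, zero_sub, abs_neg] at h3 ⊢
  rw [Real.dist_eq, sub_zero] at h2
  have h4 := h k t ht
  rw [abs_of_nonneg h4.1]
  linarith [le_abs_self (g k t), le_abs_self (e k)]

section BVPairing

/-- The extension by zero of a function on `(0,1)`. -/
def zeroExtend (f : C₀(Ioo (0 : ℝ) 1, ℝ)) : ℝ → ℝ := Function.extend Subtype.val f 0

lemma zeroExtend_coe (f : C₀(Ioo (0 : ℝ) 1, ℝ)) (w : Ioo (0 : ℝ) 1) : zeroExtend f w = f w :=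
  Subtype.val_injective.extend_apply _ _ _

lemma measurable_zeroExtend (f : C₀(Ioo (0 : ℝ) 1, ℝ)) : Measurable (zeroExtend f) :=
  (continuous_extend_zeroAtInfty f).measurable

lemma abs_zeroAtInfty_le (f : C₀(Ioo (0 : ℝ) 1, ℝ)) (w : Ioo (0 : ℝ) 1) : |f w| ≤ ‖f‖ :=
  f.toBCF.norm_coe_le_norm w

lemma abs_zeroExtend_le (f : C₀(Ioo (0 : ℝ) 1, ℝ)) {w : ℝ} (hw : w ∈ Ioo (0 : ℝ) 1) :
    |zeroExtend f w| ≤ ‖f‖ := by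
  have := zeroExtend_coe f ⟨w, hw⟩
  simp only at this
  rw [this]
  exact abs_zeroAtInfty_le f _

lemma integral_lebI (u : ℝ → ℝ) (f : C₀(Ioo (0 : ℝ) 1, ℝ)) :
    ∫ w, u w * f w ∂lebI = ∫ w in Ioo (0 : ℝ) 1, u w * zeroExtend f w := by
  rw [lebI, ← integral_subtype_comap measurableSet_Ioo]
  simp only [zeroExtend_coe]

lemma abs_integral_mul_le {u F : ℝ → ℝ} {M K : ℝ} (hM : ∀ w ∈ Ioo (0 : ℝ) 1, |u w| ≤ M)
    (hK : ∀ w ∈ Ioo (0 : ℝ) 1, |F w| ≤ K) : |∫ w in Ioo (0 : ℝ) 1, u w * F w| ≤ M * K := by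
  have := norm_integral_le_of_norm_le_const (f := fun w => u w * F w) (C := M * K)
    (μ := volume.restrict (Ioo (0 : ℝ) 1))
    ((ae_restrict_iff' measurableSet_Ioo).2 (Eventually.of_forall fun w hw => by
      rw [Real.norm_eq_abs, abs_mul]
      exact mul_le_mul (hM w hw) (hK w hw) (abs_nonneg _) ((abs_nonneg _).trans (hM w hw))))
  refine this.trans_eq ?_
  simp [Measure.real]

lemma integrableOn_mul_of_bound {u F : ℝ → ℝ} {M K : ℝ} (hu : Measurable u)
    (hM : ∀ w ∈ Ioo (0 : ℝ) 1, |u w| ≤ M) (hF : Measurable F)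
    (hK : ∀ w ∈ Ioo (0 : ℝ) 1, |F w| ≤ K) : IntegrableOn (fun w => u w * F w) (Ioo 0 1) :=
  integrableOn_Ioo_of_bound (M := M * K) (hu.mul hF) fun w hw => by
    rw [abs_mul]
    exact mul_le_mul (hM w hw) (hK w hw) (abs_nonneg _) ((abs_nonneg _).trans (hM w hw))

lemma abs_pairing_le (m : SignedMeasure (Ioo (0 : ℝ) 1)) (g : C₀(Ioo (0 : ℝ) 1, ℝ)) :
    |pairing m g| ≤ ‖g‖ * (m.totalVariation univ).toReal := by
  have := abs_pairing_sub_le m (f := g) (g := fun _ => 0)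
    (fun μ _ => integrable_zeroAtInfty μ g) (fun μ _ => integrable_zero _ _ _) (ε := ‖g‖)
    fun w => by
      rw [sub_zero]
      exact abs_zeroAtInfty_le g w
  simpa [pairing] using this

lemma continuous_pairing (m : SignedMeasure (Ioo (0 : ℝ) 1)) :
    Continuous fun g : C₀(Ioo (0 : ℝ) 1, ℝ) => pairing m g := by
  refine (LipschitzWith.of_dist_le_mul (K := ((m.totalVariation univ).toReal).toNNReal)
    fun f g => ?_).continuous
  rw [Real.dist_eq, Real.coe_toNNReal _ ENNReal.toReal_nonneg, mul_comm, dist_eq_norm]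
  refine abs_pairing_sub_le m (fun μ _ => integrable_zeroAtInfty μ f)
    (fun μ _ => integrable_zeroAtInfty μ g) fun w => ?_
  exact abs_zeroAtInfty_le (f - g) w

lemma continuous_integral_lebI {u : ℝ → ℝ} {M : ℝ} (hu : Measurable u)
    (hM : ∀ w ∈ Ioo (0 : ℝ) 1, |u w| ≤ M) :
    Continuous fun f : C₀(Ioo (0 : ℝ) 1, ℝ) => ∫ w, u w * f w ∂lebI := by
  have hM0 : 0 ≤ M := (abs_nonneg _).trans (hM (1 / 2) ⟨by norm_num, by norm_num⟩)
  refine (LipschitzWith.of_dist_le_mul (K := M.toNNReal) fun f g => ?_).continuous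
  have hi : ∀ f, IntegrableOn (fun w => u w * zeroExtend f w) (Ioo 0 1) := fun f =>
    integrableOn_mul_of_bound hu hM (measurable_zeroExtend f) fun w hw => abs_zeroExtend_le f hw
  rw [Real.dist_eq, Real.coe_toNNReal _ hM0, dist_eq_norm, integral_lebI, integral_lebI,
    ← integral_sub (hi f) (hi g)]
  have e : ∀ w, u w * zeroExtend f w - u w * zeroExtend g w =
      u w * (zeroExtend f w - zeroExtend g w) := fun w => by ring
  simp only [e]
  refine abs_integral_mul_le hM fun w hw => ?_
  have h1 := zeroExtend_coe f ⟨w, hw⟩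
  have h2 := zeroExtend_coe g ⟨w, hw⟩
  simp only at h1 h2
  rw [h1, h2]
  exact abs_zeroAtInfty_le (f - g) _

/-- The functionals that define weak-* convergence in `L^∞(a, b; BV)` have measurable
integrands. -/
lemma aestronglyMeasurable_bvPairing {A : Set ℝ} {u : ℝ → ℝ → ℝ}
    (hm : Measurable fun z : ℝ × ℝ => u z.1 z.2)
    (h : ∀ᵐ t ∂(volume.restrict A), (∃ M, ∀ w ∈ Ioo (0 : ℝ) 1, |u t w| ≤ M) ∧ IsBV (u t))
    {f g : ℝ → C₀(Ioo (0 : ℝ) 1, ℝ)} (hf : AEStronglyMeasurable f (volume.restrict A))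
    (hg : AEStronglyMeasurable g (volume.restrict A)) :
    AEStronglyMeasurable
      (fun t => (∫ w, u t w * f t w ∂lebI) + pairing (derivMeasure (u t)) (g t))
      (volume.restrict A) := by
  have hint : ∀ F : ℝ → ℝ, Measurable F → Measurable fun t => ∫ w in Ioo (0 : ℝ) 1, u t w * F w :=
    fun F hF => (StronglyMeasurable.integral_prod_right
      (f := fun t w => u t w * F w) (hm.mul (hF.comp measurable_snd)).stronglyMeasurable).measurable
  refine AEStronglyMeasurable.add
    (aestronglyMeasurable_of_continuous_right
      (L := fun t (e : C₀(Ioo (0 : ℝ) 1, ℝ)) => ∫ w, u t w * e w ∂lebI) (fun e => ?_) ?_ hf)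
    (aestronglyMeasurable_of_continuous_right
      (L := fun t (e : C₀(Ioo (0 : ℝ) 1, ℝ)) => pairing (derivMeasure (u t)) e) (fun e => ?_)
      (Eventually.of_forall fun t => continuous_pairing _) hg)
  · simp only [integral_lebI]
    exact (hint _ (measurable_zeroExtend e)).aestronglyMeasurable
  · filter_upwards [h] with t ⟨⟨M, hM⟩, _⟩
    exact continuous_integral_lebI (hm.comp measurable_prodMk_left) hM
  · obtain ⟨φ, hφ, hφe⟩ := exists_isTestI_seq e
    refine aestronglyMeasurable_of_tendsto_ae atTop
      (f := fun n t => -∫ w in Ioo (0 : ℝ) 1, u t w * deriv (φ n) w)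
      (fun n => (hint _ (hφ n).continuous_deriv.measurable).neg.aestronglyMeasurable) ?_
    filter_upwards [h] with t ⟨_, ht⟩
    have e1 : ∀ n, -∫ w in Ioo (0 : ℝ) 1, u t w * deriv (φ n) w =
        pairing (derivMeasure (u t)) (fun w => φ n w) := fun n => by
      rw [ht.hasDerivMeasure.2 _ (hφ n).contDiff (hφ n).compact (hφ n).support, neg_neg]
    simp only [e1]
    rw [tendsto_iff_dist_tendsto_zero]
    refine squeeze_zero (fun n => dist_nonneg) (fun n => abs_pairing_sub_le _
      (fun μ _ => (hφ n).integrable μ) (fun μ _ => integrable_zeroAtInfty μ e) (hφe n)) ?_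
    simpa using tendsto_one_div_add_atTop_nhds_zero_nat.mul_const
      ((derivMeasure (u t)).totalVariation univ).toReal

end BVPairing

section Flow

variable {N : ℕ} {T C R : ℝ} {ξ υ υa l : ℝ → ℝ → ℝ} {υ0 : ℝ → ℝ}

lemma DiscreteFlow.ae_aff_bound (h : DiscreteFlow N T C R ξ υ υa l υ0) (hR : 0 ≤ R) (hC : 0 ≤ C) :
    ∀ᵐ t ∂(volume.restrict (Ioo 0 T)), (∀ w ∈ Ioo (0 : ℝ) 1, |υa t w| ≤ variationBound C R t) ∧
      IsBV (υa t) ∧ ((derivMeasure (υa t)).totalVariation univ).toReal ≤ variationBound C R t := by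
  filter_upwards [h.aff, ae_restrict_mem measurableSet_Ioo]
    with t ⟨A, B, hA, hB, hAb, hBb, hAB, _⟩ ht
  have h0 : 0 ≤ (R + 1) / t := div_nonneg (by linarith) ht.1.le
  refine ⟨fun w hw => ?_, isBV_of_ae_eq_sub h0 hA hB hAb hBb
    ((ae_restrict_iff' measurableSet_Ioo).2 (Eventually.of_forall hAB))⟩
  rw [hAB w hw, variationBound]
  have := (abs_sub (A w) (B w)).trans (add_le_add (hAb w hw) (hBb w hw))
  linarith

theorem DiscreteFlow.memLinftyBV (h : DiscreteFlow N T C R ξ υ υa l υ0) (hR : 0 ≤ R) (hC : 0 ≤ C)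
    {α : ℝ} (hα : 0 < α) : MemLinftyBV α T υa :=
  memLinftyBV_of_ae hα (antitoneOn_variationBound hR) h.meas_aff (h.ae_aff_bound hR hC)

lemma DiscreteFlow.ae_dom_vel_bound (h : DiscreteFlow N T C R ξ υ υa l υ0) :
    ∀ᵐ z ∂(volume.restrict (dom T)), |υ z.1 z.2| ≤ C := by
  refine (ae_dom_iff (measurableSet_le h.meas_vel.abs measurable_const)).2 ?_
  filter_upwards [h.vel_bound] with t ht
  exact (ae_restrict_iff' measurableSet_Ioo).2 (Eventually.of_forall ht)

theorem DiscreteFlow.memLinfty (h : DiscreteFlow N T C R ξ υ υa l υ0) : MemLinfty T υ :=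
  memLp_top_of_bound h.meas_vel.aestronglyMeasurable C h.ae_dom_vel_bound

end Flow

section Sequence

variable {T C R : ℝ} {n : ℕ → ℕ} {ξ υ υa l : ℕ → ℝ → ℝ → ℝ} {υ0 : ℕ → ℝ → ℝ}
  {X U L : ℝ → ℝ → ℝ} {V0 : ℝ → ℝ}

lemma ae_dom_tendsto {f : ℕ → ℝ → ℝ → ℝ} {g : ℝ → ℝ → ℝ}
    (hf : ∀ k, Measurable fun z : ℝ × ℝ => f k z.1 z.2) (hg : Measurable fun z : ℝ × ℝ => g z.1 z.2)
    (h : ∀ᵐ t ∂(volume.restrict (Ioo 0 T)), ∀ᵐ w ∂(volume.restrict (Ioo (0 : ℝ) 1)),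
      Tendsto (fun k => f k t w) atTop (𝓝 (g t w))) :
    ∀ᵐ z ∂(volume.restrict (dom T)), Tendsto (fun k => f k z.1 z.2) atTop (𝓝 (g z.1 z.2)) :=
  (ae_dom_iff (measurableSet_tendsto_fun hf hg)).2 h

/-- Pointwise convergence in time is uniform because the positions are equi-Lipschitz in time. -/
theorem tendstoUniformlyOn_pos (hC : 0 ≤ C)
    (h : ∀ k, DiscreteFlow (n k) T C R (ξ k) (υ k) (υa k) (l k) (υ0 k))
    (hlim : LimitFlow T C R X U L V0)
    (hX : ∀ t, ∀ᵐ w ∂(volume.restrict (Ioo (0 : ℝ) 1)),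
      Tendsto (fun k => ξ k t w) atTop (𝓝 (X t w))) :
    TendstoUniformlyOn (fun k t => ∫ w in Ioo (0 : ℝ) 1, |ξ k t w - X t w|) (fun _ => 0) atTop
      (Icc 0 T) := by
  have hm : ∀ k t, Measurable fun w => |ξ k t w - X t w| := fun k t =>
    (((h k).measurable_pos_slice t).sub (hlim.meas_pos.comp measurable_prodMk_left)).abs
  have hb : ∀ k t, ∀ w ∈ Ioo (0 : ℝ) 1, |ξ k t w - X t w| ≤ R + R := fun k t w hw =>
    (abs_sub _ _).trans (add_le_add ((h k).pos_bound t w hw) (hlim.pos_bound t w hw))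
  have hi : ∀ k t, IntegrableOn (fun w => |ξ k t w - X t w|) (Ioo 0 1) := fun k t =>
    integrableOn_Ioo_of_bound (hm k t) fun w hw => by
      rw [abs_abs]
      exact hb k t w hw
  refine tendstoUniformlyOn_of_lipschitz (L := C + C) (by positivity) (fun k s t => ?_) fun t => ?_
  · rw [← integral_sub (hi k t) (hi k s)]
    have := norm_integral_le_of_norm_le_const (C := (C + C) * |t - s|)
      (f := fun w => |ξ k t w - X t w| - |ξ k s w - X s w|)
      (μ := volume.restrict (Ioo (0 : ℝ) 1))
      ((ae_restrict_iff' measurableSet_Ioo).2 (Eventually.of_forall fun w hw => by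
        have h1 := (h k).pos_lip s t w hw
        have h2 := hlim.pos_lip s t w hw
        rw [Real.norm_eq_abs]
        refine (abs_abs_sub_abs_le_abs_sub _ _).trans ?_
        rw [show ξ k t w - X t w - (ξ k s w - X s w) =
          (ξ k t w - ξ k s w) - (X t w - X s w) by ring]
        refine (abs_sub _ _).trans ?_
        linarith))
    refine this.trans_eq ?_
    simp [Measure.real]
  · have := tendsto_integral_of_dominated_convergence (μ := volume.restrict (Ioo (0 : ℝ) 1))
      (F := fun k w => |ξ k t w - X t w|) (f := fun _ => 0) (fun _ => R + R)
      (fun k => (hm k t).aestronglyMeasurable) (integrable_const _)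
      (fun k => (ae_restrict_iff' measurableSet_Ioo).2 (Eventually.of_forall fun w hw => by
        rw [Real.norm_eq_abs, abs_abs]
        exact hb k t w hw)) (by
        filter_upwards [hX t] with w hw
        simpa using (hw.sub_const (X t w)).abs)
    simpa using this

theorem weakStarLinfty_vel
    (h : ∀ k, DiscreteFlow (n k) T C R (ξ k) (υ k) (υa k) (l k) (υ0 k))
    (hlim : LimitFlow T C R X U L V0)
    (hU : ∀ᵐ t ∂(volume.restrict (Ioo 0 T)), ∀ᵐ w ∂(volume.restrict (Ioo (0 : ℝ) 1)),
      Tendsto (fun k => υ k t w) atTop (𝓝 (U t w))) : WeakStarLinfty T υ U := by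
  intro f hf
  refine tendsto_integral_of_dominated_convergence (fun z => C * |f z|)
    (fun k => ((h k).meas_vel.aestronglyMeasurable).mul hf.aestronglyMeasurable)
    (hf.abs.const_mul C) (fun k => ?_) ?_
  · filter_upwards [(h k).ae_dom_vel_bound] with z hz
    rw [Real.norm_eq_abs, abs_mul]
    exact mul_le_mul_of_nonneg_right hz (abs_nonneg _)
  · filter_upwards [ae_dom_tendsto (fun k => (h k).meas_vel) hlim.meas_vel hU] with z hz
    exact hz.mul_const _

/-- The piecewise affine and the piecewise constant velocities have the same limit. -/
lemma ae_tendsto_integral_aff_mul (hn : Tendsto n atTop atTop)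
    (h : ∀ k, DiscreteFlow (n k) T C R (ξ k) (υ k) (υa k) (l k) (υ0 k)) (hR : 0 ≤ R) (hC : 0 ≤ C)
    (hU : ∀ᵐ t ∂(volume.restrict (Ioo 0 T)), ∀ᵐ w ∂(volume.restrict (Ioo (0 : ℝ) 1)),
      Tendsto (fun k => υ k t w) atTop (𝓝 (U t w))) :
    ∀ᵐ t ∂(volume.restrict (Ioo 0 T)), ∀ (F : ℝ → ℝ) (K : ℝ), Measurable F →
      (∀ w ∈ Ioo (0 : ℝ) 1, |F w| ≤ K) →
      Tendsto (fun k => ∫ w in Ioo (0 : ℝ) 1, υa k t w * F w) atTop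
        (𝓝 (∫ w in Ioo (0 : ℝ) 1, U t w * F w)) := by
  filter_upwards [ae_all_iff.2 fun k => (h k).aff, ae_all_iff.2 fun k => (h k).vel_bound,
    ae_all_iff.2 fun k => (h k).ae_aff_bound hR hC, hU] with t haff hvel hb hU F K hF hK
  have hma : ∀ k, Measurable (υa k t) := fun k => (h k).meas_aff.comp measurable_prodMk_left
  have hm := fun k => (h k).measurable_vel_slice t
  have h1 : Tendsto (fun k => ∫ w in Ioo (0 : ℝ) 1, υ k t w * F w) atTop
      (𝓝 (∫ w in Ioo (0 : ℝ) 1, U t w * F w)) := by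
    refine tendsto_integral_of_dominated_convergence (fun _ => C * K)
      (fun k => ((hm k).mul hF).aestronglyMeasurable) (integrable_const _)
      (fun k => (ae_restrict_iff' measurableSet_Ioo).2 (Eventually.of_forall fun w hw => ?_)) ?_
    · rw [Real.norm_eq_abs, abs_mul]
      exact mul_le_mul (hvel k w hw) (hK w hw) (abs_nonneg _) hC
    · filter_upwards [hU] with w hw using hw.mul_const _
  have hdiff : ∀ k, |∫ w in Ioo (0 : ℝ) 1, (υa k t w - υ k t w) * F w| ≤
      2 * (2 * ((R + 1) / t) + C) / n k * K := by
    intro k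
    obtain ⟨-, -, -, -, -, -, -, hk⟩ := haff k
    have hK0 : 0 ≤ K := (abs_nonneg _).trans (hK (1 / 2) ⟨by norm_num, by norm_num⟩)
    have hi : IntegrableOn (fun w => |υa k t w - υ k t w|) (Ioo 0 1) :=
      ((integrableOn_Ioo_of_bound (hma k) (hb k).1).sub
        (integrableOn_Ioo_of_bound (hm k) (hvel k))).abs
    rw [← Real.norm_eq_abs]
    refine (norm_integral_le_integral_norm _).trans
      (le_trans ?_ (mul_le_mul_of_nonneg_right hk hK0))
    rw [← integral_mul_const]
    refine integral_mono_of_nonneg (Eventually.of_forall fun _ => norm_nonneg _) (hi.mul_const K)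
      ((ae_restrict_iff' measurableSet_Ioo).2 (Eventually.of_forall fun w hw => ?_))
    simp only [Real.norm_eq_abs, abs_mul]
    exact mul_le_mul_of_nonneg_left (hK w hw) (abs_nonneg _)
  have h2 : Tendsto (fun k => ∫ w in Ioo (0 : ℝ) 1, (υa k t w - υ k t w) * F w) atTop (𝓝 0) := by
    refine squeeze_zero_norm hdiff ?_
    have e1 : Tendsto (fun k => 2 * (2 * ((R + 1) / t) + C) / (n k : ℝ)) atTop (𝓝 0) :=
      tendsto_const_nhds.div_atTop (tendsto_natCast_atTop_atTop.comp hn)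
    simpa using e1.mul_const K
  have h3 := h2.add h1
  rw [zero_add] at h3
  refine h3.congr fun k => ?_
  rw [← integral_add]
  · refine integral_congr_ae (Eventually.of_forall fun w => ?_)
    simp only
    ring
  · have e : ∀ w, (υa k t w - υ k t w) * F w = υa k t w * F w - υ k t w * F w := fun w => by ring
    simp only [e]
    exact (integrableOn_mul_of_bound (hma k) (hb k).1 hF hK).sub
      (integrableOn_mul_of_bound (hm k) (hvel k) hF hK)
  · exact integrableOn_mul_of_bound (hm k) (hvel k) hF hK

theorem weakStarLinftyBV_vel (hn : Tendsto n atTop atTop)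
    (h : ∀ k, DiscreteFlow (n k) T C R (ξ k) (υ k) (υa k) (l k) (υ0 k)) (hR : 0 ≤ R) (hC : 0 ≤ C)
    (hlim : LimitFlow T C R X U L V0)
    (hU : ∀ᵐ t ∂(volume.restrict (Ioo 0 T)), ∀ᵐ w ∂(volume.restrict (Ioo (0 : ℝ) 1)),
      Tendsto (fun k => υ k t w) atTop (𝓝 (U t w))) {α : ℝ} (hα : 0 < α) :
    WeakStarLinftyBV α T υa U := by
  intro f g hf hg
  have hsub : Ioo α T ⊆ Ioo 0 T := Ioo_subset_Ioo_left hα.le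
  have hb : ∀ k, ∀ᵐ t ∂(volume.restrict (Ioo α T)),
      (∀ w ∈ Ioo (0 : ℝ) 1, |υa k t w| ≤ variationBound C R α) ∧ IsBV (υa k t) ∧
      ((derivMeasure (υa k t)).totalVariation univ).toReal ≤ variationBound C R α := by
    intro k
    filter_upwards [ae_restrict_of_ae_restrict_of_subset hsub ((h k).ae_aff_bound hR hC),
      ae_restrict_mem measurableSet_Ioo] with t ht hmem
    have hKt := antitoneOn_variationBound (C := C) hR hα (hα.trans hmem.1) hmem.1.le
    exact ⟨fun w hw => (ht.1 w hw).trans hKt, ht.2.1, ht.2.2.trans hKt⟩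
  refine tendsto_integral_of_dominated_convergence
    (fun t => variationBound C R α * ‖f t‖ + ‖g t‖ * variationBound C R α) (fun k => ?_)
    ((hf.norm.const_mul _).add (hg.norm.mul_const _)) (fun k => ?_) ?_
  · refine aestronglyMeasurable_bvPairing (h k).meas_aff ?_ hf.aestronglyMeasurable
      hg.aestronglyMeasurable
    filter_upwards [hb k] with t ht using ⟨⟨_, ht.1⟩, ht.2.1⟩
  · filter_upwards [hb k] with t ht
    refine (norm_add_le _ _).trans (add_le_add ?_ ((abs_pairing_le _ _).trans
      (mul_le_mul_of_nonneg_left ht.2.2 (norm_nonneg _))))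
    rw [integral_lebI]
    exact abs_integral_mul_le ht.1 fun w hw => abs_zeroExtend_le _ hw
  · filter_upwards [ae_all_iff.2 hb, ae_restrict_of_ae_restrict_of_subset hsub
      (ae_tendsto_integral_aff_mul hn h hR hC hU),
      ae_restrict_of_ae_restrict_of_subset hsub (hlim.ae_isBV hR),
      ae_restrict_mem measurableSet_Ioo]
      with t ht hconv hBV hmem
    have hKt := antitoneOn_variationBound (C := C) hR hα (hα.trans hmem.1) hmem.1.le
    refine Tendsto.add ?_ (tendsto_pairing (fun k => (ht k).2.1) hBV.1 (fun k => (ht k).2.2)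
      (hBV.2.trans hKt) (fun φ hφ => ?_) _)
    · simp only [integral_lebI]
      exact hconv _ _ (measurable_zeroExtend _) fun w hw => abs_zeroExtend_le _ hw
    · obtain ⟨M, hM⟩ := hφ.exists_bound_deriv
      exact hconv _ M hφ.continuous_deriv.measurable fun w _ => hM w

lemma integral_timeDerivMeasure_test (hT : 0 < T) {B : ℝ} {l : ℝ → ℝ → ℝ}
    (hl : Measurable fun z : ℝ × ℝ => l z.1 z.2) (hmono : ∀ w, Monotone fun t => l t w)
    (hB : ∀ t w, |l t w| ≤ B) {ψ : ℝ × ℝ → ℝ} (hψ : IsTest T ψ) :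
    ∫ z, ψ z ∂(timeDerivMeasure T B l) =
      -∫ w in Ioo (0 : ℝ) 1, ∫ t in Ioo 0 T, l t w * dt ψ (t, w) := by
  obtain ⟨M, -, hM⟩ := hψ.exists_bound
  exact integral_timeDerivMeasure hT hl hmono hB hψ.smooth.continuous.measurable hM
    (fun z hz => hψ.eq_zero hz) (ψ' := fun t w => dt ψ (t, w))
    (Eventually.of_forall fun w => ⟨hψ.dt.integrableOn_slice_time w,
      fun s _ => hψ.eq_neg_integral_dt s w⟩)

/-- The pressure measures converge on test functions because the multipliers converge, and by
density on all of `C₀` because their masses are bounded. -/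
theorem weakStarMeasure_timeDerivMeasure (hT : 0 < T)
    (h : ∀ k, DiscreteFlow (n k) T C R (ξ k) (υ k) (υa k) (l k) (υ0 k))
    (hlim : LimitFlow T C R X U L V0)
    (hL : ∀ᵐ t ∂(volume.restrict (Ioo 0 T)), ∀ᵐ w ∂(volume.restrict (Ioo (0 : ℝ) 1)),
      Tendsto (fun k => l k t w) atTop (𝓝 (L t w))) :
    WeakStarMeasure T (fun k => timeDerivMeasure T (2 * C) (l k))
      (timeDerivMeasure T (2 * C) L) := by
  have hlb : ∀ k t w, |l k t w| ≤ 2 * C := fun k t w => by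
    have := (h k).mult_mem t w
    rw [abs_of_nonneg this.1]
    exact this.2
  have hC : 0 ≤ 2 * C := (abs_nonneg _).trans (hlb 0 0 0)
  have htest : ∀ φ, IsTest T φ → Tendsto (fun k => ∫ z, φ z ∂(timeDerivMeasure T (2 * C) (l k)))
      atTop (𝓝 (∫ z, φ z ∂(timeDerivMeasure T (2 * C) L))) := by
    intro φ hφ
    obtain ⟨M, hM0, hM⟩ := hφ.dt.exists_bound
    have hdom : ∀ {l : ℝ → ℝ → ℝ}, (Measurable fun z : ℝ × ℝ => l z.1 z.2) →
        (∀ w, Monotone fun t => l t w) → (∀ t w, |l t w| ≤ 2 * C) →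
        ∫ z, φ z ∂(timeDerivMeasure T (2 * C) l) = -∫ z in dom T, l z.1 z.2 * dt φ z := by
      intro l h1 h2 h3
      rw [integral_timeDerivMeasure_test hT h1 h2 h3 hφ, integral_dom_symm]
      exact integrableOn_mul_test h1 (Eventually.of_forall fun z => h3 _ _) hφ.dt
    simp only [hdom hlim.meas_mult hlim.mult_mono hlim.abs_mult_le,
      fun k => hdom (h k).meas_mult (h k).mult_mono (hlb k)]
    have := isFiniteMeasure_dom T
    refine (tendsto_integral_of_dominated_convergence (fun _ => 2 * C * M)
      (fun k => ((h k).meas_mult.mul hφ.dt.smooth.continuous.measurable).aestronglyMeasurable)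
      (integrable_const _) (fun k => Eventually.of_forall fun z => ?_) ?_).neg
    · change |l k z.1 z.2 * dt φ z| ≤ _
      rw [abs_mul]
      exact mul_le_mul (hlb k _ _) (hM z) (abs_nonneg _) hC
    · filter_upwards [ae_dom_tendsto (fun k => (h k).meas_mult) hlim.meas_mult hL] with z hz
      exact hz.mul_const _
  intro ψ hψ h0
  have hbdd : Bornology.IsBounded (dom T) :=
    (Metric.isBounded_Ioo _ _).prod (Metric.isBounded_Ioo _ _)
  rw [Metric.tendsto_atTop]
  intro ε hε
  obtain ⟨φ, h1, h2, h3, h4⟩ := exists_contDiff_approx hbdd hψ h0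
    (show 0 < ε / (12 * (2 * (2 * C) + 1)) by positivity)
  have hφ : IsTest T φ := ⟨h1, h2, h3⟩
  have hψc : HasCompactSupport ψ :=
    HasCompactSupport.intro hbdd.isCompact_closure fun z hz => h0 z fun h => hz (subset_closure h)
  have hclose : ∀ μ : Measure (ℝ × ℝ), μ univ ≤ ENNReal.ofReal (2 * (2 * C)) →
      |∫ z, φ z ∂μ - ∫ z, ψ z ∂μ| < ε / 3 := by
    intro μ hμ
    have : IsFiniteMeasure μ := ⟨hμ.trans_lt ENNReal.ofReal_lt_top⟩
    rw [← integral_sub (h1.continuous.integrable_of_hasCompactSupport h2)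
      (hψ.integrable_of_hasCompactSupport hψc)]
    refine (norm_integral_le_of_norm_le_const (f := fun z => φ z - ψ z)
      (Eventually.of_forall h4)).trans_lt ?_
    have hμr : μ.real univ ≤ 2 * (2 * C) := ENNReal.toReal_le_of_le_ofReal (by linarith) hμ
    have e : 4 * (ε / (12 * (2 * (2 * C) + 1))) * (2 * (2 * C) + 1) = ε / 3 := by
      have hD : 2 * (2 * C) + 1 ≠ 0 := by positivity
      rw [← div_div, mul_assoc, div_mul_cancel₀ _ hD]
      ring
    rw [← e]
    exact mul_lt_mul_of_pos_left (by linarith) (by positivity)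
  obtain ⟨k0, hk0⟩ := (Metric.tendsto_atTop.1 (htest φ hφ)) (ε / 3) (by positivity)
  refine ⟨k0, fun k hk => ?_⟩
  have e1 := hk0 k hk
  rw [Real.dist_eq] at e1 ⊢
  have e2 := abs_lt.1 e1
  have e3 := abs_lt.1 (hclose _ (timeDerivMeasure_univ_le (B := 2 * C) hT (h k).meas_mult
    (h k).mult_mono))
  have e4 := abs_lt.1 (hclose _ (timeDerivMeasure_univ_le (B := 2 * C) hT hlim.meas_mult
    hlim.mult_mono))
  exact abs_lt.2 ⟨by linarith, by linarith⟩

end Sequence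

/-! ### Pressures and interpolated positions of the microscopic system -/

lemma measurable_affInterp (N : ℕ) (a : ℕ → ℝ) : Measurable (affInterp N a) := by
  have h1 := measurable_pcInterp N a
  have h2 := measurable_pcInterp N fun i => a (i - 1)
  have h3 := measurable_pcInterp N fun i => ((i : ℝ) - 1) / N
  exact (((h1.sub h2).const_mul (N : ℝ)).mul (measurable_id.sub h3)).add h2

section Micro

variable {N : ℕ} {T C δ R : ℝ} {x0 u0 : ℕ → ℝ} {x lam l : ℕ → ℝ → ℝ}

/-- The interpolated pressure is the time derivative of the interpolated multiplier. -/
lemma integral_timeDerivMeasure_affInterp (hN : 0 < N) (hT : 0 < T) (hl1 : ∀ i, Monotone (l i))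
    (hl2 : ∀ i t, 0 ≤ l i t ∧ l i t ≤ 2 * C)
    (hlam : ∀ᵐ t ∂(volume.restrict (Ioo 0 T)), ∀ i ≤ N, l i t = lam i t)
    (hm : Measurable fun z : ℝ × ℝ => affInterp N (fun i => l i z.1) z.2)
    (hmono : ∀ w, Monotone fun t => affInterp N (fun i => l i t) w)
    (hb : ∀ t w, |affInterp N (fun i => l i t) w| ≤ 2 * C) {ψ : ℝ × ℝ → ℝ} (hψ : IsTest T ψ) :
    ∫ z, ψ z ∂(timeDerivMeasure T (2 * C) fun t w => affInterp N (fun i => l i t) w) =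
      PNaff N T lam ψ := by
  rw [integral_timeDerivMeasure_test hT hm hmono hb hψ, PNaff, ← integral_neg]
  refine setIntegral_congr_fun measurableSet_Ioo fun w hw => ?_
  have hd : ∀ i ≤ N, timeDerivDist T (lam i) (fun t => ψ (t, w)) =
      -∫ t in Ioo 0 T, l i t * dt ψ (t, w) := by
    intro i hi
    rw [timeDerivDist, neg_inj]
    refine integral_congr_ae ?_
    filter_upwards [hlam] with t ht
    rw [ht i hi]
    rfl
  have hi : ∀ i, IntegrableOn (fun t => l i t * dt ψ (t, w)) (Ioo 0 T) := fun i =>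
    Integrable.bdd_mul (c := 2 * C) (hψ.dt.integrableOn_slice_time w)
      (hl1 i).measurable.aestronglyMeasurable
      (Eventually.of_forall fun t => by
        rw [Real.norm_eq_abs, abs_of_nonneg (hl2 i t).1]
        exact (hl2 i t).2)
  have hj := ceil_mul_le (N := N) hw.2.le
  simp only [affInterp_eq hN]
  rw [hd _ hj, hd _ (by omega)]
  have e : ∀ t, ((1 - (N * w - ((⌈(N : ℝ) * w⌉₊ : ℝ) - 1))) * l (⌈(N : ℝ) * w⌉₊ - 1) t +
      (N * w - ((⌈(N : ℝ) * w⌉₊ : ℝ) - 1)) * l ⌈(N : ℝ) * w⌉₊ t) * dt ψ (t, w) =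
      (1 - (N * w - ((⌈(N : ℝ) * w⌉₊ : ℝ) - 1))) * (l (⌈(N : ℝ) * w⌉₊ - 1) t * dt ψ (t, w)) +
      (N * w - ((⌈(N : ℝ) * w⌉₊ : ℝ) - 1)) * (l ⌈(N : ℝ) * w⌉₊ t * dt ψ (t, w)) :=
    fun t => by ring
  simp only [e]
  rw [integral_add ((hi _).const_mul _) ((hi _).const_mul _), integral_const_mul,
    integral_const_mul]
  ring

lemma le_of_gap {a : ℕ → ℝ} (h : ∀ i, 1 ≤ i → i < N → 1 / (N : ℝ) ≤ a (i + 1) - a i) {i j : ℕ}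
    (h1 : 1 ≤ i) (hij : i ≤ j) (hj : j ≤ N) : a i ≤ a j := by
  induction j, hij using Nat.le_induction with
  | base => exact le_rfl
  | succ j hij ih =>
    have e1 := ih (by omega)
    have e2 := h j (by omega) (by omega)
    have e3 : (0 : ℝ) ≤ 1 / N := by positivity
    linarith

lemma abs_sub_le_of_gap {a : ℕ → ℝ} (h : ∀ i, 1 ≤ i → i < N → 1 / (N : ℝ) ≤ a (i + 1) - a i)
    {i j : ℕ} (hi : 1 ≤ i) (hi' : i ≤ N) (hj : 1 ≤ j) (hj' : j ≤ N) :
    |a i - a j| ≤ a N - a 1 := by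
  have e1 := le_of_gap h le_rfl hi hi'
  have e2 := le_of_gap h le_rfl hj hj'
  have e3 := le_of_gap h hi hi' le_rfl
  have e4 := le_of_gap h hj hj' le_rfl
  exact abs_le.2 ⟨by linarith, by linarith⟩

lemma integral_abs_XNaff_sub_le (hN : 2 ≤ N) (hδ : 0 < δ) {t : ℝ}
    (hR : ∀ i, 1 ≤ i → i ≤ N → |x i t| ≤ R)
    (hgap : ∀ i, 1 ≤ i → i < N → 1 / (N : ℝ) ≤ x (i + 1) t - x i t) {g : ℝ → ℝ} (hg : Measurable g)
    {M : ℝ} (hM : ∀ w ∈ Ioo (0 : ℝ) 1, |g w| ≤ M) :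
    ∫ w in Ioo (0 : ℝ) 1, |XNaff N δ x t w - g w| ≤
      (2 * R + 1 + δ) / N + ∫ w in Ioo (0 : ℝ) 1, |XN N x t w - g w| := by
  have hN' : 0 < N := by omega
  have hN1 : 1 / (N : ℝ) ≤ 1 := by
    rw [div_le_one (by exact_mod_cast hN')]
    exact_mod_cast hN'
  have hN0 : 0 ≤ 1 / (N : ℝ) := by positivity
  obtain ⟨a, ha⟩ : ∃ a : ℕ → ℝ, a = fun i => posExt N δ x i t := ⟨_, rfl⟩
  have e0 : ∀ w, XNaff N δ x t w = affInterp N a w := fun w => by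
    rw [ha]
    rfl
  have ha0 : a 0 = x 1 t - 1 / (N : ℝ) - δ := by simp [ha, posExt]
  have ha1 : ∀ i, 1 ≤ i → a i = x i t := fun i hi => by
    simp [ha, posExt, show i ≠ 0 by omega]
  have hab : ∀ i, i ≤ N → |a i| ≤ R + 1 + δ := by
    intro i hi
    rcases Nat.eq_zero_or_pos i with rfl | h1
    · have := abs_le.1 (hR 1 le_rfl (by omega))
      rw [ha0]
      exact abs_le.2 ⟨by linarith, by linarith⟩
    · rw [ha1 i h1]
      have := hR i h1 hi
      linarith
  have hmono : ∀ i, i < N → |a (i + 1) - a i| ≤ a (i + 1) - a i := by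
    intro i hi
    rw [abs_of_nonneg]
    rcases Nat.eq_zero_or_pos i with rfl | h1
    · rw [ha0, ha1 _ (by omega)]
      linarith
    · rw [ha1 i h1, ha1 _ (by omega)]
      linarith [hgap i h1 hi]
  have hpc : ∀ w ∈ Ioo (0 : ℝ) 1, XN N x t w = pcInterp N a w := fun w hw => by
    rw [XN, pcInterp, pcInterp, ha1 _ (one_le_ceil_mul hN' hw.1)]
  have i1 : IntegrableOn (affInterp N a) (Ioo 0 1) :=
    integrableOn_Ioo_of_bound (measurable_affInterp N a) fun w hw => abs_affInterp_le hN' hw hab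
  have i2 : IntegrableOn (pcInterp N a) (Ioo 0 1) :=
    (integrableOn_pcInterp N a).mono_set Ioo_subset_Icc_self
  have i3 : IntegrableOn g (Ioo 0 1) := integrableOn_Ioo_of_bound hg hM
  have e1 : ∫ w in Ioo (0 : ℝ) 1, |XN N x t w - g w| =
      ∫ w in Ioo (0 : ℝ) 1, |pcInterp N a w - g w| :=
    setIntegral_congr_fun measurableSet_Ioo fun w hw => by simp only [hpc w hw]
  have e2 := integral_abs_affInterp_sub_pcInterp_le hN' (e := a) (c := a) hmono
  have e3 : (a N - a 0) / N ≤ (2 * R + 1 + δ) / N := by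
    have h1 := abs_le.1 (hR N (by omega) le_rfl)
    have h2 := abs_le.1 (hR 1 le_rfl (by omega))
    rw [ha0, ha1 N (by omega)]
    gcongr
    linarith
  have e4 : ∫ w in Ioo (0 : ℝ) 1, |affInterp N a w - g w| ≤ ∫ w in Ioo (0 : ℝ) 1,
      (|affInterp N a w - pcInterp N a w| + |pcInterp N a w - g w|) :=
    integral_mono (i1.sub i3).abs ((i1.sub i2).abs.add (i2.sub i3).abs)
      fun w => abs_sub_le _ _ _
  have i4 : IntegrableOn (fun w => |affInterp N a w - pcInterp N a w|) (Ioo 0 1) := (i1.sub i2).abs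
  have i5 : IntegrableOn (fun w => |pcInterp N a w - g w|) (Ioo 0 1) := (i2.sub i3).abs
  rw [integral_add i4 i5] at e4
  simp only [e0]
  rw [e1]
  linarith

end Micro

/-! ### Convergence along subsequences -/

/-- Along a subsequence, the initial positions are bounded uniformly in the number of particles, and
the initial velocities converge almost everywhere. -/
lemma exists_subseq_initial {C : ℝ} {X0 U0 : ℝ → ℝ}
    (hX0 : MemLp X0 2 (volume.restrict (Ioo 0 1))) (hU0 : MemLp U0 2 (volume.restrict (Ioo 0 1)))
    {x0 u0 : ℕ → ℕ → ℝ}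
    (hx0 : ∀ N : ℕ, 2 ≤ N → ∀ i, 1 ≤ i → i < N → 1 / (N : ℝ) ≤ x0 N (i + 1) - x0 N i)
    (hC : ∀ N : ℕ, 2 ≤ N → x0 N N - x0 N 1 ≤ C)
    (hX0lim : Tendsto (fun N => eLpNorm (fun w => pcInterp N (x0 N) w - X0 w) 2
      (volume.restrict (Ioo 0 1))) atTop (𝓝 0))
    (hU0lim : Tendsto (fun N => eLpNorm (fun w => pcInterp N (u0 N) w - U0 w) 2
      (volume.restrict (Ioo 0 1))) atTop (𝓝 0)) :
    ∃ (τ : ℕ → ℕ) (B : ℝ), StrictMono τ ∧ (∀ k, 2 ≤ τ k) ∧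
      (∀ k i, 1 ≤ i → i ≤ τ k → |x0 (τ k) i| ≤ B) ∧
      ∀ᵐ w ∂(volume.restrict (Ioo (0 : ℝ) 1)),
        ∃ a, Tendsto (fun k => pcInterp (τ k) (u0 (τ k)) w) atTop (𝓝 a) := by
  obtain ⟨τ₁, hτ₁, h1⟩ := (tendstoInMeasure_of_tendsto_eLpNorm (p := 2) two_ne_zero
    (f := fun N => pcInterp N (x0 N)) (g := X0)
    (fun N => (measurable_pcInterp N (x0 N)).aestronglyMeasurable) hX0.aestronglyMeasurable
    hX0lim).exists_seq_tendsto_ae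
  obtain ⟨τ₂, hτ₂, h2⟩ := (tendstoInMeasure_of_tendsto_eLpNorm (p := 2) two_ne_zero
    (f := fun k => pcInterp (τ₁ k) (u0 (τ₁ k))) (g := U0)
    (fun k => (measurable_pcInterp (τ₁ k) (u0 (τ₁ k))).aestronglyMeasurable)
    hU0.aestronglyMeasurable (hU0lim.comp hτ₁.tendsto_atTop)).exists_seq_tendsto_ae
  have hs : StrictMono fun k => k + 2 := fun a b h => Nat.add_lt_add_right h 2
  have hτ : StrictMono fun k => τ₁ (τ₂ (k + 2)) := hτ₁.comp (hτ₂.comp hs)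
  have hτ2 : ∀ k, 2 ≤ τ₁ (τ₂ (k + 2)) := fun k =>
    le_trans (by omega) ((hτ₁.comp hτ₂).le_apply (x := k + 2))
  have hne : (ae (volume.restrict (Ioo (0 : ℝ) 1))).NeBot := by
    rw [ae_neBot, Ne, Measure.restrict_eq_zero, Real.volume_Ioo, ENNReal.ofReal_eq_zero]
    norm_num
  -- One point of convergence bounds the positions, because the particles stay close together.
  obtain ⟨w, hw1, hw⟩ := (h1.and (ae_restrict_mem measurableSet_Ioo)).exists
  obtain ⟨B, hB⟩ := (hw1.comp (hτ₂.comp hs).tendsto_atTop).abs.bddAbove_range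
  refine ⟨fun k => τ₁ (τ₂ (k + 2)), B + C, hτ, hτ2, fun k i hi hi' => ?_, ?_⟩
  · have e1 : |x0 (τ₁ (τ₂ (k + 2))) ⌈((τ₁ (τ₂ (k + 2)) : ℕ) : ℝ) * w⌉₊| ≤ B := hB (mem_range_self k)
    have hpos : 0 < τ₁ (τ₂ (k + 2)) := lt_of_lt_of_le two_pos (hτ2 k)
    have e2 := abs_sub_le_of_gap (hx0 _ (hτ2 k)) hi hi' (one_le_ceil_mul hpos hw.1)
      (ceil_mul_le hw.2.le)
    have e3 := hC _ (hτ2 k)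
    have e4 := abs_sub_abs_le_abs_sub (x0 (τ₁ (τ₂ (k + 2))) i)
      (x0 (τ₁ (τ₂ (k + 2))) ⌈((τ₁ (τ₂ (k + 2)) : ℕ) : ℝ) * w⌉₊)
    linarith
  · filter_upwards [h2] with w hw
    exact ⟨_, hw.comp hs.tendsto_atTop⟩

/-- The interpolated dynamics have a limit as soon as positions, multipliers and initial velocities
converge. -/
lemma exists_limitFlow {T C R : ℝ} {n : ℕ → ℕ} {ξ υ υa l : ℕ → ℝ → ℝ → ℝ} {υ0 : ℕ → ℝ → ℝ}
    (hC : 0 ≤ C) (hn : Tendsto n atTop atTop) (hn0 : ∀ k, 0 < n k)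
    (h : ∀ k, DiscreteFlow (n k) T C R (ξ k) (υ k) (υa k) (l k) (υ0 k))
    (h0 : ∀ᵐ w ∂(volume.restrict (Ioo (0 : ℝ) 1)), ∃ a, Tendsto (fun k => υ0 k w) atTop (𝓝 a))
    (hξ : ∀ t, ∀ᵐ w ∂(volume.restrict (Ioo (0 : ℝ) 1)),
      ∃ a, Tendsto (fun k => ξ k t w) atTop (𝓝 a))
    (hl : ∀ w ∈ Ioo (0 : ℝ) 1, ∀ᵐ t ∂(volume.restrict (Ioo 0 T)),
      ∃ a, Tendsto (fun k => l k t w) atTop (𝓝 a)) :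
    ∃ (X U L : ℝ → ℝ → ℝ) (V0 : ℝ → ℝ), LimitFlow T C R X U L V0 ∧
      (∀ t, ∀ᵐ w ∂(volume.restrict (Ioo (0 : ℝ) 1)),
        Tendsto (fun k => ξ k t w) atTop (𝓝 (X t w))) ∧
      (∀ᵐ t ∂(volume.restrict (Ioo 0 T)), ∀ᵐ w ∂(volume.restrict (Ioo (0 : ℝ) 1)),
        Tendsto (fun k => υ k t w) atTop (𝓝 (U t w))) ∧
      ∀ᵐ t ∂(volume.restrict (Ioo 0 T)), ∀ᵐ w ∂(volume.restrict (Ioo (0 : ℝ) 1)),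
        Tendsto (fun k => l k t w) atTop (𝓝 (L t w)) := by
  have hl' := (ae_ae_comm_exists_tendsto (A := Ioo 0 T) (B := Ioo 0 1) fun k => (h k).meas_mult).2
    ((ae_restrict_iff' measurableSet_Ioo).2 (Eventually.of_forall hl))
  have hυ := ae_exists_tendsto_vel hn hn0 h h0 hξ hl'
  refine ⟨_, _, _, _, limitFlow_of_tendsto hC hn hn0 h h0 hξ hl' hυ, fun t => ?_, ?_, ?_⟩
  · filter_upwards [hξ t] with w hw using tendsto_limsup_of_exists hw
  · filter_upwards [hυ] with t ht
    filter_upwards [ht] with w hw using tendsto_limsup_of_exists hw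
  · filter_upwards [hl'] with t ht
    filter_upwards [ht] with w hw using tendsto_limsup_of_exists hw

end LagrangianCongestion

end

theorem proposition3p7
    (T δ : ℝ) (hT : 0 < T) (hδ : 0 < δ)
    -- macroscopic initial data in Lagrangian variables
    (X0 U0 : ℝ → ℝ)
    (hX0 : MemLp X0 2 (volume.restrict (Ioo 0 1)))
    (hU0 : MemLp U0 2 (volume.restrict (Ioo 0 1)))
    (hX0mono : MonotoneOn X0 (Ioo 0 1))
    (hX0deriv : ∀ᵐ w ∂(volume.restrict (Ioo (0 : ℝ) 1)), 1 ≤ deriv X0 w)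
    -- microscopic initial data: `x0 N i`, `u0 N i` for `1 ≤ i ≤ N`
    (x0 u0 : ℕ → ℕ → ℝ)
    (hx0 : ∀ N : ℕ, 2 ≤ N → ∀ i, 1 ≤ i → i < N → 1 / (N : ℝ) ≤ x0 N (i + 1) - x0 N i)
    (hu0 : ∀ N : ℕ, 2 ≤ N → ∀ i, 1 ≤ i → i < N →
      x0 N (i + 1) = x0 N i + 1 / (N : ℝ) → u0 N i ≤ u0 N (i + 1))
    (hbound : ∃ C : ℝ, ∀ N : ℕ, 2 ≤ N →
      x0 N N - (x0 N 1 - 1 / (N : ℝ) - δ) ≤ C ∧ ∀ i, 1 ≤ i → i ≤ N → |u0 N i| ≤ C)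
    (hX0lim : Tendsto (fun N => eLpNorm
      (fun w => LagrangianCongestion.pcInterp N (x0 N) w - X0 w) 2 (volume.restrict (Ioo 0 1)))
      atTop (𝓝 0))
    (hU0lim : Tendsto (fun N => eLpNorm
      (fun w => LagrangianCongestion.pcInterp N (u0 N) w - U0 w) 2 (volume.restrict (Ioo 0 1)))
      atTop (𝓝 0))
    -- microscopic dynamics: `x N i t`, `lam N i t`
    (x lam : ℕ → ℕ → ℝ → ℝ)
    (hsol : ∀ N, 2 ≤ N → LagrangianCongestion.IsMicroSolution N T (x0 N) (u0 N) (x N) (lam N)) :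
    ∃ (X U : ℝ → ℝ → ℝ) (P : Measure (ℝ × ℝ)) (PN : ℕ → Measure (ℝ × ℝ)) (σ : ℕ → ℕ),
      StrictMono σ ∧
      -- `X` is the limit of the positions; monotone in `w`, Lipschitz in `t`, bounded
      (∀ t ∈ Icc 0 T, MonotoneOn (X t) (Ioo 0 1)) ∧
      (∃ L : NNReal, ∀ w ∈ Ioo (0 : ℝ) 1, LipschitzOnWith L (fun t => X t w) (Icc 0 T)) ∧
      (∃ C : ℝ, ∀ t ∈ Icc 0 T, ∀ w ∈ Ioo (0 : ℝ) 1, |X t w| ≤ C) ∧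
      TendstoUniformlyOn
        (fun k t => ∫ w in Ioo (0 : ℝ) 1, |LagrangianCongestion.XN (σ k) (x (σ k)) t w - X t w|)
        (fun _ => 0) atTop (Icc 0 T) ∧
      TendstoUniformlyOn
        (fun k t => ∫ w in Ioo (0 : ℝ) 1,
          |LagrangianCongestion.XNaff (σ k) δ (x (σ k)) t w - X t w|)
        (fun _ => 0) atTop (Icc 0 T) ∧
      -- function spaces for the limits `U` and `P`
      LagrangianCongestion.MemLinfty T U ∧
      (∀ α, 0 < α → α < T → LagrangianCongestion.MemLinftyBV α T U) ∧
      LagrangianCongestion.IsPosMeasure T P ∧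
      (∀ w : ℝ, P (univ ×ˢ {w}) = 0) ∧
      -- convergence of the velocities
      (∀ N, 2 ≤ N → LagrangianCongestion.MemLinfty T (LagrangianCongestion.UN N (x N))) ∧
      LagrangianCongestion.WeakStarLinfty T
        (fun k => LagrangianCongestion.UN (σ k) (x (σ k))) U ∧
      (∀ α, 0 < α → α < T →
        (∀ N, 2 ≤ N →
          LagrangianCongestion.MemLinftyBV α T (LagrangianCongestion.UNaff N δ (x N))) ∧
        LagrangianCongestion.WeakStarLinftyBV α T
          (fun k => LagrangianCongestion.UNaff (σ k) δ (x (σ k))) U) ∧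
      -- the interpolated pressures are nonnegative measures, and they converge
      (∀ N, 2 ≤ N → LagrangianCongestion.IsPosMeasure T (PN N) ∧
        ∀ ψ, LagrangianCongestion.IsTest T ψ →
          ∫ z, ψ z ∂(PN N) = LagrangianCongestion.PNaff N T (lam N) ψ) ∧
      LagrangianCongestion.WeakStarMeasure T (fun k => PN (σ k)) P ∧
      -- the limit system
      (∀ᵐ z ∂(volume.restrict (LagrangianCongestion.dom T)),
        HasDerivAt (fun s => X s z.2) (U z.1 z.2) z.1) ∧
      LagrangianCongestion.MomentumEq T U P ∧
      LagrangianCongestion.CongestionConstraint T X ∧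
      LagrangianCongestion.ExclusionRelation T X U P ∧
      LagrangianCongestion.OleinikStrict T X U := by
  obtain ⟨C, hC⟩ := hbound
  have hC0 : 0 ≤ C := (abs_nonneg _).trans ((hC 2 le_rfl).2 1 le_rfl (by norm_num))
  obtain ⟨τ, B, hτ, hτ2, hτB, hτlim⟩ := LagrangianCongestion.exists_subseq_initial (C := C) hX0 hU0
    hx0 (fun N hN => by
      have := (hC N hN).1
      have : (0 : ℝ) ≤ 1 / N := by positivity
      linarith) hX0lim hU0lim
  -- Representatives of the multipliers that are monotone in time.
  have hmult : ∀ N : ℕ, ∃ l : ℕ → ℝ → ℝ, 2 ≤ N → (∀ i, Monotone (l i)) ∧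
      (∀ i t, 0 ≤ l i t ∧ l i t ≤ 2 * C) ∧ (∀ t, l 0 t = 0) ∧ (∀ t, l N t = 0) ∧
      ∀ᵐ t ∂(volume.restrict (Ioo 0 T)), (∀ i, i ≤ N → l i t = lam N i t) ∧
        LagrangianCongestion.RegularTime N C (u0 N) (x N) l t := by
    intro N
    by_cases hN : 2 ≤ N
    · obtain ⟨l, hl⟩ := (hsol N hN).exists_monotone_multipliers hN hT (hx0 N hN) (hC N hN).2
      exact ⟨l, fun _ => hl⟩
    · exact ⟨fun _ _ => 0, fun h => absurd h hN⟩
  choose l hl using hmult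
  set lN : ℕ → ℝ → ℝ → ℝ :=
    fun N t w => LagrangianCongestion.affInterp N (fun i => l N i t) w with hlN
  have hflow : ∀ N, 2 ≤ N → ∀ R, (∀ i, 1 ≤ i → i ≤ N → |x0 N i| + C * T ≤ R) →
      LagrangianCongestion.DiscreteFlow N T C R (LagrangianCongestion.clampedPos N T (x N))
        (LagrangianCongestion.UN N (x N)) (LagrangianCongestion.UNaff N δ (x N)) (lN N)
        (LagrangianCongestion.pcInterp N (u0 N)) := by
    intro N hN R hR
    obtain ⟨h1, h2, h3, h4, h5⟩ := hl N hN
    exact (hsol N hN).discreteFlow hN hT (hC N hN).2 hR h1 h2 h3 h4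
      (by filter_upwards [h5] with t ht using ht.2)
  -- For a single `N` no uniformity is needed, so that any bound of the initial positions serves.
  have hflow1 : ∀ N, 2 ≤ N → ∃ R, 0 ≤ R ∧
      LagrangianCongestion.DiscreteFlow N T C R (LagrangianCongestion.clampedPos N T (x N))
        (LagrangianCongestion.UN N (x N)) (LagrangianCongestion.UNaff N δ (x N)) (lN N)
        (LagrangianCongestion.pcInterp N (u0 N)) := by
    intro N hN
    refine ⟨(∑ i ∈ Finset.range (N + 1), |x0 N i|) + C * T, by positivity, hflow N hN _ ?_⟩
    intro i _ hi
    have := Finset.single_le_sum (f := fun i => |x0 N i|) (fun _ _ => abs_nonneg _)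
      (Finset.mem_range.2 (Nat.lt_succ_of_le hi))
    linarith
  have hB0 : 0 ≤ B := (abs_nonneg _).trans (hτB 0 1 le_rfl (le_trans (by norm_num) (hτ2 0)))
  have hR : 0 ≤ B + C * T := by positivity
  have hflowτ := fun k => hflow (τ k) (hτ2 k) (B + C * T)
    fun i h1 hi => by linarith [hτB k i h1 hi]
  obtain ⟨σ, hσ, hξ, hL⟩ := LagrangianCongestion.exists_subseq_tendsto_pos_mult hC0 hflowτ
  have hn : StrictMono fun k => τ (σ k) := hτ.comp hσ
  have hn2 : ∀ k, 2 ≤ τ (σ k) := fun k => hτ2 _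
  have hn0 : ∀ k, 0 < τ (σ k) := fun k => lt_of_lt_of_le two_pos (hn2 k)
  have hf := fun k => hflowτ (σ k)
  have h0 : ∀ᵐ w ∂(volume.restrict (Ioo (0 : ℝ) 1)), ∃ a, Tendsto
      (fun k => LagrangianCongestion.pcInterp (τ (σ k)) (u0 (τ (σ k))) w) atTop (𝓝 a) := by
    filter_upwards [hτlim] with w ⟨a, ha⟩ using ⟨a, ha.comp hσ.tendsto_atTop⟩
  obtain ⟨X, U, L, V0, hlim, hX, hU, hLlim⟩ :=
    LagrangianCongestion.exists_limitFlow hC0 hn.tendsto_atTop hn0 hf h0 hξ hL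
  have hXN : TendstoUniformlyOn (fun k t => ∫ w in Ioo (0 : ℝ) 1,
      |LagrangianCongestion.XN (τ (σ k)) (x (τ (σ k))) t w - X t w|) (fun _ => 0) atTop
      (Icc 0 T) := by
    refine (LagrangianCongestion.tendstoUniformlyOn_pos hC0 hf hlim hX).congr
      (Eventually.of_forall fun k t ht => setIntegral_congr_fun measurableSet_Ioo fun w hw => ?_)
    simp only [LagrangianCongestion.clampedPos_eq_XN (hn0 k) ht hw]
  have hpos : ∀ k, ∀ t ∈ Icc 0 T, ∀ i, 1 ≤ i → i ≤ τ (σ k) → |x (τ (σ k)) i t| ≤ B + C * T := by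
    intro k t ht i h1 hi
    obtain ⟨-, -, -, -, h5⟩ := hl _ (hn2 k)
    have e1 := (hsol _ (hn2 k)).abs_sub_le (by filter_upwards [h5] with t ht using ht.2.bound)
      h1 hi (left_mem_Icc.2 hT.le) ht
    rw [(hsol _ (hn2 k)).initial i h1 hi, sub_zero, abs_of_nonneg ht.1] at e1
    have e2 := abs_sub_abs_le_abs_sub (x (τ (σ k)) i t) (x0 (τ (σ k)) i)
    have e3 := mul_le_mul_of_nonneg_left ht.2 hC0
    have e4 := hτB (σ k) i h1 hi
    linarith
  refine ⟨X, U, LagrangianCongestion.timeDerivMeasure T (2 * C) L,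
    fun N => LagrangianCongestion.timeDerivMeasure T (2 * C) (lN N), fun k => τ (σ k), hn,
    fun t _ v hv w hw hvw => ?_,
    ⟨C.toNNReal, fun w hw => (hlim.lipschitzWith hw).lipschitzOnWith⟩,
    ⟨B + C * T, fun t _ w hw => hlim.pos_bound t w hw⟩, hXN, ?_, hlim.memLinfty,
    fun α hα _ => hlim.memLinftyBV hR hC0 hα,
    LagrangianCongestion.isPosMeasure_timeDerivMeasure hT hlim.meas_mult hlim.mult_mono,
    LagrangianCongestion.timeDerivMeasure_line hT hlim.meas_mult hlim.mult_mono,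
    fun N hN => ?_, LagrangianCongestion.weakStarLinfty_vel hf hlim hU,
    fun α hα _ => ⟨fun N hN => ?_, LagrangianCongestion.weakStarLinftyBV_vel hn.tendsto_atTop hf hR
      hC0 hlim hU hα⟩,
    fun N hN => ?_, LagrangianCongestion.weakStarMeasure_timeDerivMeasure hT hf hlim hLlim,
    hlim.ae_hasDerivAt hT, hlim.momentumEq hT, hlim.congestionConstraint, hlim.exclusionRelation hT,
    hlim.oleinikStrict hT⟩
  · have := hlim.pos_sub_mono t hv hw hvw
    linarith
  · refine LagrangianCongestion.tendstoUniformlyOn_of_le_add hXN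
      (e := fun k => (2 * (B + C * T) + 1 + δ) / (τ (σ k) : ℝ))
      (tendsto_const_nhds.div_atTop (tendsto_natCast_atTop_atTop.comp hn.tendsto_atTop))
      fun k t ht => ⟨integral_nonneg fun w => abs_nonneg _, ?_⟩
    exact LagrangianCongestion.integral_abs_XNaff_sub_le (hn2 k) hδ (hpos k t ht)
      ((hsol _ (hn2 k)).nonoverlap t ht) (hlim.meas_pos.comp measurable_prodMk_left)
      (fun w hw => hlim.pos_bound t w hw)
  · obtain ⟨R, -, h⟩ := hflow1 N hN
    exact h.memLinfty
  · obtain ⟨R, hR, h⟩ := hflow1 N hN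
    exact h.memLinftyBV hR hC0 hα
  · obtain ⟨R, -, h⟩ := hflow1 N hN
    obtain ⟨h1, h2, -, -, h5⟩ := hl N hN
    exact ⟨LagrangianCongestion.isPosMeasure_timeDerivMeasure hT h.meas_mult h.mult_mono,
      fun ψ hψ => LagrangianCongestion.integral_timeDerivMeasure_affInterp (by omega) hT h1 h2
        (by filter_upwards [h5] with t ht using ht.1) h.meas_mult h.mult_mono
        (fun t w => by
          have := h.mult_mem t w
          rw [abs_of_nonneg this.1]
          exact this.2) hψ⟩
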